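/- Fix $q\in\mathbb C$ with $0<|q|<1$ and a branch of $\ln q$ (so $q^x=e^{x\ln q}$), and put $[x]=\frac{q^x-q^{-x}}{q-q^{-1}}$. Let $k=c$ and $r>0$ be real with $k\ne-2$ and $r^*=r-c>0$; put $p=q^{2r}$, $p^*=q^{2r^*}$, $(z;t)_\infty=\prod_{n\ge0}(1-zt^n)$, $\Theta_t(z)=(z;t)_\infty(tz^{-1};t)_\infty(t;t)_\infty$, $\delta(x)=\sum_{n\in\mathbb Z}x^n$. Consider three commuting bosons $a,b,c$ (the boson $c$ is not to be confused with the level $c$) with $[a_n,a_m]=\frac{[(k+2)n][2n]}{n}\delta_{n+m,0}$, $[b_n,b_m]=-\frac{[n]^2}{n}\delta_{n+m,0}$, $[c_n,c_m]=\frac{[n]^2}{n}\delta_{n+m,0}$ ($n\neq 0$), $[p_a,q_a]=2(k+2)$, $[p_b,q_b]=-1$, $[p_c,q_c]=1$, acting on the Fock spaces $\mathcal F_{l,m_1,m_2}$ generated by the negative modes from a highest weight state on which $p_a,p_b,p_c$ act by $l,-m_1,m_2$, where $l,m_1,m_2\in\mathbb C$ and $m_2-m_1\in\mathbb Z$ (so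 that the fields below have integral powers of $z$). For $x\in\{a,b,c\}$ put $$x(z)=-\sum_{n\ne0}\tfrac{x_n}{[n]}z^{-n}+q_x+p_x\ln z,\qquad x_\pm(z)=\pm\Big((q-q^{-1})\sum_{n>0}x_{\pm n}z^{\mp n}+p_x\ln q\Big),$$ $$x_+^*(z)=-\sum_{n>0}\tfrac{x_n}{[rn]}z^{-n},\qquad x_-^*(z)=\sum_{n>0}\tfrac{x_{-n}}{[r^*n]}z^n,$$ and $(b+c)(z)=b(z)+c(z)$. With normal ordering $:\ :$ (positive modes and $p_x$ to the right, negative modes and $q_x$ to the left) let $$\psi_\pm(z)=\,:\!\exp[b_\pm(q^{\pm k/2}z)+a_\pm(q^{\pm1}z)+b_\pm(q^{\pm(k/2+2)}z)]\!:,$$ $$e^+(z)=\tfrac{-1}{(q-q^{-1})z}:\!\{\exp[b_+(z)-(b+c)(qz)]-\exp[b_-(z)-(b+c)(q^{-1}z)]\}\!:,$$ $$e^-(z)=\tfrac{-1}{(q-q^{-1})z}:\!\{\exp[(b+c)(q^{-(k+1)}z)+a_-(q^{-\frac{k+2}2}z)+b_-(q^{-(k+2)}z)]-\exp[(b+c)(q^{k+1}z)+a_+(q^{\frac{k+2}2}z)+b_+(q^{k+2}z)]\}\!:,$$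 $$U^+(z)=\exp[a_-^*(q^{r^*+\frac k2-1}z)+b_-^*(q^{r^*}z)+b_-^*(q^{r^*-2}z)],$$ $$U^-(z)=\exp[a_+^*(q^{-(r-\frac k2-1)}z)+b_+^*(q^{-(r-k-2)}z)+b_+^*(q^{-(r-k)}z)],$$ $$\Psi^\pm(z)=U^+(q^{\pm k/2}z)\,\psi_\pm(z)\,U^-(q^{\mp k/2}z),\qquad e(z)=U^+(z)e^+(z),\qquad f(z)=e^-(z)U^-(z).$$ Then, on each such $\mathcal F_{l,m_1,m_2}$, the following relations hold: $$\Psi^{\pm}(z)\Psi^{\pm}(w)=\frac{\Theta_p(q^{-2}z/w)}{\Theta_p(q^2z/w)}\frac{\Theta_{p^*}(q^2z/w)}{\Theta_{p^*}(q^{-2}z/w)}\Psi^{\pm}(w)\Psi^{\pm}(z),$$ $$\Psi^{+}(z)\Psi^{-}(w)=\frac{\Theta_p(pq^{-2-c}z/w)}{\Theta_p(pq^{2-c}z/w)}\frac{\Theta_{p^*}(p^*q^{2+c}z/w)}{\Theta_{p^*}(p^*q^{-2+c}z/w)}\Psi^{-}(w)\Psi^{+}(z),$$ $$\Psi^{\pm}(z)e(w)=q^{-2}\frac{\Theta_{p^*}(q^{2\pm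 c/2}z/w)}{\Theta_{p^*}(q^{-2\pm c/2}z/w)}e(w)\Psi^{\pm}(z),\qquad \Psi^{\pm}(z)f(w)=q^{2}\frac{\Theta_{p}(q^{-2\mp c/2}z/w)}{\Theta_{p}(q^{2\mp c/2}z/w)}f(w)\Psi^{\pm}(z),$$ $$[e(z),f(w)]=\frac{1}{(q-q^{-1})zw}\Big[\delta(q^{-c}z/w)\Psi^{+}(q^{-c/2}z)-\delta(q^{c}z/w)\Psi^{-}(q^{-c/2}w)\Big],$$ $$e(z)e(w)=q^{-2}\frac{\Theta_{p^*}(q^2z/w)}{\Theta_{p^*}(q^{-2}z/w)}e(w)e(z),\qquad f(z)f(w)=q^{2}\frac{\Theta_{p}(q^{-2}z/w)}{\Theta_{p}(q^{2}z/w)}f(w)f(z).$$ The commutator relation is an identity of formal series in $z^{\pm1},w^{\pm1}$ with operator coefficients. The other relations hold in the sense of analytic continuation: for a relation $A(z)B(w)=\rho(z/w)B(w)A(z)$, the matrix coefficients (between a vector of the Fock space and a basis vector of the restricted dual) of $A(z)B(w)$ converge absolutely for $|z|\gg|w|>0$, those of $B(w)A(z)$ for $|w|\gg|z|>0$, both continue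 to meromorphic functions on $(\mathbb C\setminus\{0\})^2$, and the continuations satisfy the relation. -/

import Mathlib

noncomputable section

namespace EllipticCurrents

/-! Throughout, `h` is a fixed logarithm of `q`; all powers `q ^ x` are taken with this branch. -/

/-- `q ^ x = exp (x h)`. -/
def qpow (h x : ℂ) : ℂ := Complex.exp (x * h)

/-- The `q`-number `[x] = (q ^ x - q ^ (-x)) / (q - q ^ (-1))`. -/
def qint (h x : ℂ) : ℂ := (qpow h x - qpow h (-x)) / (qpow h 1 - qpow h (-1))

/-- `(z; t)_∞ = ∏_{n ≥ 0} (1 - z t ^ n)`. -/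
def qPoch (z t : ℂ) : ℂ := ∏' n : ℕ, (1 - z * t ^ n)

/-- `Θ_t(z) = (z; t)_∞ (t z⁻¹; t)_∞ (t; t)_∞`. -/
def theta (t z : ℂ) : ℂ := qPoch z t * qPoch (t * z⁻¹) t * qPoch t t

/-! ### The three bosons and their Fock spaces -/

/-- The three kinds of bosons. -/
inductive Boson
  | a
  | b
  | c
  deriving DecidableEq

instance : Fintype Boson where
  elems := {.a, .b, .c}
  complete i := by cases i <;> decide

/-- The label `(l, m₁, m₂)` of a Fock space `F_{l, m₁, m₂}`. -/
@[ext]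
structure Charge where
  l : ℂ
  m₁ : ℂ
  m₂ : ℂ

/-- Eigenvalues of the zero modes `p_a, p_b, p_c` on `F_{l, m₁, m₂}`: `l`, `-m₁`, `m₂`. -/
def Charge.p (χ : Charge) : Boson → ℂ
  | .a => χ.l
  | .b => -χ.m₁
  | .c => χ.m₂

/-- The effect of `exp (∑ i, x i • q_i)` on the label, according to
`[p_a, q_a] = 2 (k + 2)`, `[p_b, q_b] = -1`, `[p_c, q_c] = 1`. -/
def Charge.shift (k : ℝ) (x : Boson → ℂ) (χ : Charge) : Charge where
  l := χ.l + 2 * (k + 2) * x .a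
  m₁ := χ.m₁ + x .b
  m₂ := χ.m₂ + x .c

/-- A single Fock space: polynomials in the negative modes; the variable `(i, n)` is the mode
`i_{-n}`, and `1` is the highest weight state. -/
abbrev Fock := MvPolynomial (Boson × ℕ+) ℂ

/-- The direct sum of all the Fock spaces `F_{l, m₁, m₂}`. -/
abbrev TotalFock := Charge →₀ Fock

/-- The structure constants `[i_n, i_{-n}]`. -/
def bracket (h : ℂ) (k : ℝ) : Boson → ℤ → ℂ
  | .a, n => qint h ((k + 2) * n) * qint h (2 * n) / n
  | .b, n => -(qint h n ^ 2 / n)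
  | .c, n => qint h n ^ 2 / n

/-- The modes `i_n`, `n ∈ ℤ`, of the boson `i` (with `i_0 = p_i`) as operators on the total
Fock space: negative modes multiply, positive modes differentiate. -/
def mode (h : ℂ) (k : ℝ) (i : Boson) (n : ℤ) : Module.End ℂ TotalFock :=
  if n < 0 then
    Finsupp.mapRange.linearMap
      (LinearMap.mulLeft ℂ (MvPolynomial.X (i, n.natAbs.toPNat') : Fock))
  else if n = 0 then
    Finsupp.lsum ℂ fun χ => χ.p i • Finsupp.lsingle χ
  else
    bracket h k i n • Finsupp.mapRange.linearMap
      (MvPolynomial.pderiv (R := ℂ) (i, n.natAbs.toPNat')).toLinearMap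

/-! ### Linear boson fields -/

/-- A linear expression in the bosons,
`∑ i, (∑_{n ≠ 0} osc i n • i_n z ^ (-n) + q i • q_i + pConst i • p_i + pLog i • p_i ln z)`.
The values `osc i 0` are irrelevant. -/
structure LinField where
  osc : Boson → ℤ → ℂ
  q : Boson → ℂ
  pConst : Boson → ℂ
  pLog : Boson → ℂ

instance : Add LinField :=
  ⟨fun X Y => ⟨X.osc + Y.osc, X.q + Y.q, X.pConst + Y.pConst, X.pLog + Y.pLog⟩⟩

instance : Sub LinField :=
  ⟨fun X Y => ⟨X.osc - Y.osc, X.q - Y.q, X.pConst - Y.pConst, X.pLog - Y.pLog⟩⟩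

/-- The field `X (q ^ s z)`, where `ln (q ^ s z) = s h + ln z`. -/
def LinField.scale (h s : ℂ) (X : LinField) : LinField where
  osc i n := X.osc i n * qpow h (-(s * n))
  q := X.q
  pConst i := X.pConst i + s * h * X.pLog i
  pLog := X.pLog

/-- For `i = a`, the field `a(z) = -∑_{n ≠ 0} a_n / [n] z ^ (-n) + q_a + p_a ln z`; similarly
for `b` and `c`. -/
def full (h : ℂ) (i : Boson) : LinField where
  osc j n := if j = i then -(1 / qint h n) else 0
  q j := if j = i then 1 else 0
  pConst _ := 0
  pLog j := if j = i then 1 else 0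

/-- For `i = a`, the field `a_+(z) = (q - q⁻¹) ∑_{n > 0} a_n z ^ (-n) + p_a ln q`. -/
def plus (h : ℂ) (i : Boson) : LinField where
  osc j n := if j = i ∧ 0 < n then qpow h 1 - qpow h (-1) else 0
  q _ := 0
  pConst j := if j = i then h else 0
  pLog _ := 0

/-- For `i = a`, the field `a_-(z) = -((q - q⁻¹) ∑_{n > 0} a_{-n} z ^ n + p_a ln q)`. -/
def minus (h : ℂ) (i : Boson) : LinField where
  osc j n := if j = i ∧ n < 0 then -(qpow h 1 - qpow h (-1)) else 0
  q _ := 0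
  pConst j := if j = i then -h else 0
  pLog _ := 0

/-- For `i = a`, the twisted partner `a_+^*(z) = -∑_{n > 0} a_n / [r n] z ^ (-n)`. -/
def starPlus (h : ℂ) (r : ℝ) (i : Boson) : LinField where
  osc j n := if j = i ∧ 0 < n then -(1 / qint h (r * n)) else 0
  q _ := 0
  pConst _ := 0
  pLog _ := 0

/-- For `i = a`, the twisted partner `a_-^*(z) = ∑_{n > 0} a_{-n} / [r^* n] z ^ n`. -/
def starMinus (h : ℂ) (rs : ℝ) (i : Boson) : LinField where
  osc j n := if j = i ∧ n < 0 then 1 / qint h (rs * (-n)) else 0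
  q _ := 0
  pConst _ := 0
  pLog _ := 0

/-! ### Formal fields and normal ordered exponentials -/

/-- A formal field `A(z) = ∑_{m ∈ ℤ} A m z ^ m` on the total Fock space. -/
abbrev FormalField := ℤ → TotalFock → TotalFock

/-- The product `A(z) B(z)` at the same point. It is only used where, on each vector, the sum
for each coefficient has finitely many nonzero terms. -/
def fmul (A B : FormalField) : FormalField := fun m v => ∑ᶠ i : ℤ, A i (B (m - i) v)

/-- `A(q ^ s z)`. -/
def fscale (h s : ℂ) (A : FormalField) : FormalField := fun m v => qpow h (s * m) • A m v

/-- `exp X = ∑_N X ^ N / N!` for a power series `X` without constant term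
(so that only `N ≤ m` contributes to the `m`-th coefficient). -/
def psExp {R : Type*} [Ring R] [Algebra ℂ R] (X : PowerSeries R) : PowerSeries R :=
  PowerSeries.mk fun m =>
    ∑ N ∈ Finset.range (m + 1), ((N.factorial : ℂ)⁻¹) • PowerSeries.coeff m (X ^ N)

/-- `exp (∑_{n > 0} (∑ i, X.osc i (-n) • i_{-n}) z ^ n)`. -/
def creation (h : ℂ) (k : ℝ) (X : LinField) : FormalField := fun m v =>
  if 0 ≤ m then
    PowerSeries.coeff m.toNat (psExp (PowerSeries.mk fun n : ℕ =>
      if n = 0 then 0 else ∑ i : Boson, X.osc i (-(n : ℤ)) • mode h k i (-(n : ℤ)))) v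
  else 0

/-- `exp (∑_{n > 0} (∑ i, X.osc i n • i_n) z ^ (-n))`. -/
def annihilation (h : ℂ) (k : ℝ) (X : LinField) : FormalField := fun m v =>
  if m ≤ 0 then
    PowerSeries.coeff (-m).toNat (psExp (PowerSeries.mk fun n : ℕ =>
      if n = 0 then 0 else ∑ i : Boson, X.osc i (n : ℤ) • mode h k i (n : ℤ))) v
  else 0

open Classical in
/-- The zero mode part `exp (∑ q i • q_i) z ^ (∑ pLog i • p_i) exp (∑ pConst i • p_i)`: on
`F_χ`, where the exponent of `z` is the number `∑ i, pLog i * χ.p i`. -/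
def zeroMode (k : ℝ) (X : LinField) : FormalField := fun m =>
  Finsupp.lsum ℂ fun χ : Charge =>
    if ∑ i : Boson, X.pLog i * χ.p i = (m : ℂ) then
      Complex.exp (∑ i : Boson, X.pConst i * χ.p i) •
        (Finsupp.lsingle (χ.shift k X.q) : Fock →ₗ[ℂ] TotalFock)
    else 0

/-- The normal ordered exponential `:exp X(z):`, with the negative modes and the `q_i` to the
left of the positive modes and the `p_i`. -/
def normalExp (h : ℂ) (k : ℝ) (X : LinField) : FormalField :=
  fmul (creation h k X) (fmul (zeroMode k X) (annihilation h k X))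

/-! ### The currents of the quantum affine algebra -/

/-- `ψ_+(z) = :exp [b_+(q ^ (k/2) z) + a_+(q z) + b_+(q ^ (k/2 + 2) z)]:`. -/
def psiPlus (h : ℂ) (k : ℝ) : FormalField :=
  normalExp h k ((plus h .b).scale h (k / 2) + (plus h .a).scale h 1
    + (plus h .b).scale h (k / 2 + 2))

/-- `ψ_-(z) = :exp [b_-(q ^ (-k/2) z) + a_-(q⁻¹ z) + b_-(q ^ (-(k/2 + 2)) z)]:`. -/
def psiMinus (h : ℂ) (k : ℝ) : FormalField :=
  normalExp h k ((minus h .b).scale h (-(k / 2)) + (minus h .a).scale h (-1)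
    + (minus h .b).scale h (-(k / 2 + 2)))

/-- `(b + c)(z) = b(z) + c(z)`. -/
def fullBC (h : ℂ) : LinField := full h .b + full h .c

/-- `-1 / ((q - q⁻¹) z) • (A(z) - B(z))`. -/
def qdiff (h : ℂ) (A B : FormalField) : FormalField := fun m v =>
  (-1 / (qpow h 1 - qpow h (-1))) • (A (m + 1) v - B (m + 1) v)

/-- `e^+(z) = -1 / ((q - q⁻¹) z)
:{exp [b_+(z) - (b + c)(q z)] - exp [b_-(z) - (b + c)(q⁻¹ z)]}:`. -/
def ePlus (h : ℂ) (k : ℝ) : FormalField :=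
  qdiff h
    (normalExp h k (plus h .b - (fullBC h).scale h 1))
    (normalExp h k (minus h .b - (fullBC h).scale h (-1)))

/-- `e^-(z) = -1 / ((q - q⁻¹) z)
:{exp [(b + c)(q ^ (-(k+1)) z)] exp [a_-(q ^ (-(k+2)/2) z) + b_-(q ^ (-(k+2)) z)]
- exp [(b + c)(q ^ (k+1) z)] exp [a_+(q ^ ((k+2)/2) z) + b_+(q ^ (k+2) z)]}:`. -/
def eMinus (h : ℂ) (k : ℝ) : FormalField :=
  qdiff h
    (normalExp h k ((fullBC h).scale h (-(k + 1)) + (minus h .a).scale h (-((k + 2) / 2))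
      + (minus h .b).scale h (-(k + 2))))
    (normalExp h k ((fullBC h).scale h (k + 1) + (plus h .a).scale h ((k + 2) / 2)
      + (plus h .b).scale h (k + 2)))

/-! ### The twisting currents and the twisted fields -/

/-- `U^+(z; r, r^*) = exp [a_-^*(q ^ (r^* + k/2 - 1) z) + b_-^*(q ^ (r^* - 1) (q + q⁻¹) z)]`, where
`b_-^*(q ^ (r^* - 1) (q + q⁻¹) z)` stands for `b_-^*(q ^ r^* z) + b_-^*(q ^ (r^* - 2) z)`. -/
def UPlus (h : ℂ) (k rs : ℝ) : FormalField :=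
  normalExp h k ((starMinus h rs .a).scale h (rs + k / 2 - 1)
    + ((starMinus h rs .b).scale h (rs - 1 + 1) + (starMinus h rs .b).scale h (rs - 1 - 1)))

/-- `U^-(z; r, r^*) = exp [a_+^*(q ^ (-(r - k/2 - 1)) z) + b_+^*(q ^ (-(r - k - 1)) (q + q⁻¹) z)]`,
with the same convention for `q + q⁻¹`. -/
def UMinus (h : ℂ) (k r : ℝ) : FormalField :=
  normalExp h k ((starPlus h r .a).scale h (-(r - k / 2 - 1))
    + ((starPlus h r .b).scale h (-(r - k - 1) + 1)
      + (starPlus h r .b).scale h (-(r - k - 1) - 1)))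

/-- `Ψ^+(z) = U^+(q ^ (k/2) z) ψ_+(z) U^-(q ^ (-k/2) z)`. -/
def PsiPlus (h : ℂ) (k r rs : ℝ) : FormalField :=
  fmul (fscale h (k / 2) (UPlus h k rs))
    (fmul (psiPlus h k) (fscale h (-(k / 2)) (UMinus h k r)))

/-- `Ψ^-(z) = U^+(q ^ (-k/2) z) ψ_-(z) U^-(q ^ (k/2) z)`. -/
def PsiMinus (h : ℂ) (k r rs : ℝ) : FormalField :=
  fmul (fscale h (-(k / 2)) (UPlus h k rs))
    (fmul (psiMinus h k) (fscale h (k / 2) (UMinus h k r)))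

/-- `e(z) = U^+(z) e^+(z)`. -/
def eCurrent (h : ℂ) (k rs : ℝ) : FormalField := fmul (UPlus h k rs) (ePlus h k)

/-- `f(z) = e^-(z) U^-(z)`. -/
def fCurrent (h : ℂ) (k r : ℝ) : FormalField := fmul (eMinus h k) (UMinus h k r)

/-! ### Exchange relations between fields -/

/-- The domain `(ℂ \ {0})²`. -/
def torus : Set (ℂ × ℂ) := {x | x.1 ≠ 0 ∧ x.2 ≠ 0}

/-- The double series `∑ T m n z ^ m w ^ n` converges absolutely on `R`, and its sum continues to
the meromorphic function `P / Q` on `(ℂ \ {0})²`, with `P` and `Q` holomorphic, `Q ≢ 0`. -/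
def ContinuesTo (T : ℤ → ℤ → ℂ) (R : Set (ℂ × ℂ)) (P Q : ℂ × ℂ → ℂ) : Prop :=
  AnalyticOnNhd ℂ P torus ∧ AnalyticOnNhd ℂ Q torus ∧ (∃ x ∈ torus, Q x ≠ 0) ∧
    ∀ x ∈ R, ∃ s : ℂ,
      HasSum (fun mn : ℤ × ℤ => T mn.1 mn.2 * x.1 ^ mn.1 * x.2 ^ mn.2) s ∧ Q x * s = P x

/-- The matrix coefficient of `u` at the basis vector of the (restricted) dual Fock space given by
the label `χ` and the monomial `μ`. -/
def matrixCoeff (χ : Charge) (μ : (Boson × ℕ+) →₀ ℕ) (u : TotalFock) : ℂ :=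
  MvPolynomial.coeff μ (u χ)

/-- The exchange relation `A(z) B(w) = N(z / w) / D(z / w) * B(w) A(z)` on the Fock space `F_χ`,
in the sense of analytic continuation: every matrix coefficient of `A(z) B(w)` converges for
`|z| ≫ |w| > 0` and continues to a meromorphic function `P / Q` of `z, w ∈ ℂ \ {0}`, every matrix
coefficient of `B(w) A(z)` converges for `|w| ≫ |z| > 0` and continues to a meromorphic function
`P' / Q'`, and `P / Q = N(z / w) / D(z / w) * (P' / Q')` as meromorphic functions. -/
def Exchange (χ : Charge) (A B : FormalField) (N D : ℂ → ℂ) : Prop :=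
  (∃ x : ℂ, x ≠ 0 ∧ D x ≠ 0) ∧
  ∃ ε : ℝ, 0 < ε ∧ ∀ (v : Fock) (χ' : Charge) (μ : (Boson × ℕ+) →₀ ℕ),
    ∃ P Q P' Q' : ℂ × ℂ → ℂ,
      ContinuesTo (fun m n => matrixCoeff χ' μ (A m (B n (Finsupp.single χ v))))
        {x | 0 < ‖x.2‖ ∧ ‖x.2‖ < ε * ‖x.1‖} P Q ∧
      ContinuesTo (fun m n => matrixCoeff χ' μ (B n (A m (Finsupp.single χ v))))
        {x | 0 < ‖x.1‖ ∧ ‖x.1‖ < ε * ‖x.2‖} P' Q' ∧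
      ∀ x ∈ torus, P x * Q' x * D (x.1 / x.2) = N (x.1 / x.2) * P' x * Q x

/-- The coefficient of `z ^ m w ^ n` in `δ(t z / w) A(z)`, where `δ(x) = ∑_{j ∈ ℤ} x ^ j`:
only `j = -n` contributes. -/
def deltaLeft (t : ℂ) (A : FormalField) (m n : ℤ) (v : TotalFock) : TotalFock :=
  t ^ (-n) • A (m + n) v

/-- The coefficient of `z ^ m w ^ n` in `δ(t z / w) A(w)`: only `j = m` contributes. -/
def deltaRight (t : ℂ) (A : FormalField) (m n : ℤ) (v : TotalFock) : TotalFock :=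
  t ^ m • A (n + m) v

/-- The elliptic commutation relations, on the Fock space `F_χ`, of elliptic currents
`Ψ^±(z), e(z), f(z)` with central element acting by `c`, where `p = q ^ (2 r)`,
`p^* = q ^ (2 r^*)`. -/
structure IsElliptic (h : ℂ) (c r rs : ℝ) (χ : Charge) (Ψp Ψm e f : FormalField) : Prop where
  /-- `Ψ^+(z) Ψ^+(w)`. -/
  PsiPlus_PsiPlus : Exchange χ Ψp Ψp
    (fun x => theta (qpow h (2 * r)) (qpow h (-2) * x) * theta (qpow h (2 * rs)) (qpow h 2 * x))
    (fun x => theta (qpow h (2 * r)) (qpow h 2 * x) * theta (qpow h (2 * rs)) (qpow h (-2) * x))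
  /-- `Ψ^-(z) Ψ^-(w)`. -/
  PsiMinus_PsiMinus : Exchange χ Ψm Ψm
    (fun x => theta (qpow h (2 * r)) (qpow h (-2) * x) * theta (qpow h (2 * rs)) (qpow h 2 * x))
    (fun x => theta (qpow h (2 * r)) (qpow h 2 * x) * theta (qpow h (2 * rs)) (qpow h (-2) * x))
  /-- `Ψ^+(z) Ψ^-(w)`. -/
  PsiPlus_PsiMinus : Exchange χ Ψp Ψm
    (fun x => theta (qpow h (2 * r)) (qpow h (2 * r) * qpow h (-2 - c) * x)
      * theta (qpow h (2 * rs)) (qpow h (2 * rs) * qpow h (2 + c) * x))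
    (fun x => theta (qpow h (2 * r)) (qpow h (2 * r) * qpow h (2 - c) * x)
      * theta (qpow h (2 * rs)) (qpow h (2 * rs) * qpow h (-2 + c) * x))
  /-- `Ψ^+(z) e(w)`. -/
  PsiPlus_e : Exchange χ Ψp e
    (fun x => qpow h (-2) * theta (qpow h (2 * rs)) (qpow h (2 + c / 2) * x))
    (fun x => theta (qpow h (2 * rs)) (qpow h (-2 + c / 2) * x))
  /-- `Ψ^-(z) e(w)`. -/
  PsiMinus_e : Exchange χ Ψm e
    (fun x => qpow h (-2) * theta (qpow h (2 * rs)) (qpow h (2 - c / 2) * x))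
    (fun x => theta (qpow h (2 * rs)) (qpow h (-2 - c / 2) * x))
  /-- `Ψ^+(z) f(w)`. -/
  PsiPlus_f : Exchange χ Ψp f
    (fun x => qpow h 2 * theta (qpow h (2 * r)) (qpow h (-2 - c / 2) * x))
    (fun x => theta (qpow h (2 * r)) (qpow h (2 - c / 2) * x))
  /-- `Ψ^-(z) f(w)`. -/
  PsiMinus_f : Exchange χ Ψm f
    (fun x => qpow h 2 * theta (qpow h (2 * r)) (qpow h (-2 + c / 2) * x))
    (fun x => theta (qpow h (2 * r)) (qpow h (2 + c / 2) * x))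
  /-- `[e(z), f(w)] = 1 / ((q - q⁻¹) z w) (δ(q ^ (-c) z / w) Ψ^+(q ^ (-c/2) z)
  - δ(q ^ c z / w) Ψ^-(q ^ (-c/2) w))`, an identity of formal distributions. -/
  e_f : ∀ (m n : ℤ) (v : Fock),
    e m (f n (Finsupp.single χ v)) - f n (e m (Finsupp.single χ v)) =
      (1 / (qpow h 1 - qpow h (-1))) •
        (deltaLeft (qpow h (-c)) (fscale h (-(c / 2)) Ψp) (m + 1) (n + 1) (Finsupp.single χ v)
          - deltaRight (qpow h c) (fscale h (-(c / 2)) Ψm) (m + 1) (n + 1) (Finsupp.single χ v))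
  /-- `e(z) e(w)`. -/
  e_e : Exchange χ e e
    (fun x => qpow h (-2) * theta (qpow h (2 * rs)) (qpow h 2 * x))
    (fun x => theta (qpow h (2 * rs)) (qpow h (-2) * x))
  /-- `f(z) f(w)`. -/
  f_f : Exchange χ f f
    (fun x => qpow h 2 * theta (qpow h (2 * r)) (qpow h (-2) * x))
    (fun x => theta (qpow h (2 * r)) (qpow h 2 * x))

end EllipticCurrents

end

/-!
# Elliptic currents from three bosons

On a single Fock space, a polynomial ring in the negative modes, each of `Ψ^±(z)`, `e(z)`, `f(z)`
acts through *vertex operators*, the oscillator parts `vertexOp` of normal ordered exponentials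
`:exp X(z):`. The currents `Ψ^±` are single vertex operators and `e`, `f` are sums of two, up to
constants and integral powers of `z` that come from the zero modes (`ActsAs`, `ActsAsSum`). This
needs that the factors multiplied at the same point, such as `U^+(z)` and `e^+(z)`, have no
contraction.

Wick's theorem (`vertexOp_vertexOp`) states that `:exp X(z)::exp Y(w):` is the exponential of the
contraction of `X` and `Y`, a scalar power series in `w / z`, times the normal ordered product
`:exp (X(z) + Y(w)):`. It comes down to the rule `D C = (C + γ) D` for exponentials whose
commutator is scalar (`coeff_psExp_mul_of_commutator`), which follows from the Euler equation for
exponentials. The normal ordered product is symmetric in its two factors, and its matrix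
coefficients are Laurent polynomials. All convergence and continuation questions, and the whole
difference between `A(z) B(w)` and `B(w) A(z)`, therefore concern the scalar exponentials.

The `n`-th coefficient of every contraction is computed from the modes of the currents as rational
functions of `q`, `q ^ n`, `q ^ (k n / 2)`, `q ^ (r n)`, and turns out to be a combination of terms
`b ^ n / (n (1 - t ^ n))` with `t` one of `p`, `p^*`, and of terms `b ^ n / n`. Hence its exponential
is a quotient of products of `q`-Pochhammer symbols (`expSumsTo_qPoch`): it converges for small
`w / z` and continues to a meromorphic function. The quotient of the functions for the two orders
consists of theta functions (`theta_inv_mul_relation`, `theta_linear_relation`,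
`theta_reflection_relation`), and the zero modes contribute the powers of `q` in the relations.
This gives all the exchange relations, through `exchange_of_expSumsTo`.

In the commutator of `e(z)` and `f(w)` the contractions are rational. Two of the four pairs of
vertex operators commute, and for each of the other two the exponential has one simple pole, so
that the two expansions differ by a delta function (`vertexOp_commutator`). On its support the
exponents of `e` and `f` add up to that of `Ψ^+` or `Ψ^-` (`vertexOp_eField_add_fField`,
`vertexOp_eField_add_fField'`).
-/

noncomputable section

namespace EllipticCurrents

/-! ### Exponentials of power series with commuting coefficients -/

section PsExp

set_option linter.unusedSectionVars false

variable {R : Type*} [Ring R] [Algebra ℂ R]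

theorem coeff_psExp (X : PowerSeries R) (m : ℕ) :
    PowerSeries.coeff m (psExp X) =
      ∑ N ∈ Finset.range (m + 1), ((N.factorial : ℂ)⁻¹) • PowerSeries.coeff m (X ^ N) := by
  simp [psExp]

theorem coeff_zero_psExp (X : PowerSeries R) : PowerSeries.coeff 0 (psExp X) = 1 := by
  simp [coeff_psExp]

theorem coeff_pow_of_lt {X : PowerSeries R} (h0 : PowerSeries.coeff 0 X = 0) (N m : ℕ)
    (h : m < N) : PowerSeries.coeff m (X ^ N) = 0 := by
  induction N generalizing m with
  | zero => omega
  | succ N ih =>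
    rw [pow_succ, PowerSeries.coeff_mul]
    refine Finset.sum_eq_zero fun ij hij => ?_
    have := Finset.HasAntidiagonal.mem_antidiagonal.1 hij
    rcases Nat.eq_zero_or_pos ij.2 with h2 | h2
    · rw [h2, h0, mul_zero]
    · rw [ih _ (by omega), zero_mul]

/-- The coefficientwise action of a family of linear maps on power series. -/
def coeffMap (d : ℕ → R →ₗ[ℂ] R) (X : PowerSeries R) : PowerSeries R :=
  PowerSeries.mk fun n => d n (PowerSeries.coeff n X)

/-- The graded Leibniz rule, which makes `coeffMap d` a derivation. It holds for the Euler
operator `z ∂_z` and for a derivation of `R` acting on each coefficient. -/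
def GradedLeibniz (d : ℕ → R →ₗ[ℂ] R) : Prop :=
  ∀ i j x y, d (i + j) (x * y) = d i x * y + x * d j y

theorem coeffMap_mul {d : ℕ → R →ₗ[ℂ] R} (hd : GradedLeibniz d) (X Y : PowerSeries R) :
    coeffMap d (X * Y) = coeffMap d X * Y + X * coeffMap d Y := by
  ext n
  simp only [coeffMap, PowerSeries.coeff_mk, PowerSeries.coeff_mul, map_add, map_sum,
    ← Finset.sum_add_distrib]
  refine Finset.sum_congr rfl fun ij hij => ?_
  rw [← Finset.HasAntidiagonal.mem_antidiagonal.1 hij, hd]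

theorem coeffMap_pow_succ {d : ℕ → R →ₗ[ℂ] R} (hd : GradedLeibniz d) {X : PowerSeries R}
    (hX : Commute X (coeffMap d X)) (N : ℕ) :
    coeffMap d (X ^ (N + 1)) = (N + 1) • (coeffMap d X * X ^ N) := by
  induction N with
  | zero => simp
  | succ N ih =>
    rw [pow_succ, coeffMap_mul hd, ih, (hX.pow_left (N + 1)).eq, smul_mul_assoc, mul_assoc,
      ← pow_succ, succ_nsmul _ (N + 1)]

/-- The chain rule for the exponential. -/
theorem coeffMap_psExp {d : ℕ → R →ₗ[ℂ] R} (hd : GradedLeibniz d) {X : PowerSeries R}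
    (h0 : PowerSeries.coeff 0 X = 0) (hX : Commute X (coeffMap d X)) :
    coeffMap d (psExp X) = coeffMap d X * psExp X := by
  have hd1 : d 0 1 = 0 := by simpa using hd 0 0 1 1
  ext n
  have hl : PowerSeries.coeff n (coeffMap d (psExp X)) =
      ∑ N ∈ Finset.range (n + 1),
        ((N.factorial : ℂ)⁻¹) • PowerSeries.coeff n (coeffMap d (X ^ N)) := by
    simp only [coeffMap, PowerSeries.coeff_mk, coeff_psExp, map_sum, map_smul]
  have hz : PowerSeries.coeff n (coeffMap d (X ^ 0)) = 0 := by
    simp only [coeffMap, PowerSeries.coeff_mk, pow_zero, PowerSeries.coeff_one]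
    split_ifs with hn
    · rw [hn, hd1]
    · rw [map_zero]
  rw [hl, Finset.sum_range_succ', hz, smul_zero, add_zero]
  have hterm : ∀ N, (((N + 1).factorial : ℂ)⁻¹) • PowerSeries.coeff n (coeffMap d (X ^ (N + 1))) =
      ∑ ij ∈ Finset.HasAntidiagonal.antidiagonal n, PowerSeries.coeff ij.1 (coeffMap d X) *
        (((N.factorial : ℂ)⁻¹) • PowerSeries.coeff ij.2 (X ^ N)) := by
    intro N
    have hN : ((N : ℂ) + 1) ≠ 0 := Nat.cast_add_one_ne_zero N
    have hN' : (N.factorial : ℂ) ≠ 0 := Nat.cast_ne_zero.2 N.factorial_ne_zero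
    rw [coeffMap_pow_succ hd hX, map_nsmul, ← Nat.cast_smul_eq_nsmul ℂ, smul_smul,
      PowerSeries.coeff_mul, Finset.smul_sum]
    refine Finset.sum_congr rfl fun ij _ => ?_
    rw [mul_smul_comm]
    congr 1
    rw [Nat.factorial_succ]
    push_cast
    field_simp
  simp only [hterm]
  rw [Finset.sum_comm, PowerSeries.coeff_mul]
  refine Finset.sum_congr rfl fun ij hij => ?_
  have hij := Finset.HasAntidiagonal.mem_antidiagonal.1 hij
  rw [← Finset.mul_sum]
  rcases Nat.eq_zero_or_pos ij.1 with h1 | h1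
  · have : PowerSeries.coeff ij.1 (coeffMap d X) = 0 := by
      rw [h1]; simp [coeffMap, h0]
    rw [this, zero_mul, zero_mul]
  · congr 1
    rw [coeff_psExp]
    symm
    refine Finset.sum_subset (Finset.range_subset_range.2 (by omega)) fun N _ hN => ?_
    rw [Finset.mem_range, not_lt] at hN
    rw [coeff_pow_of_lt h0 N ij.2 (by omega), smul_zero]

/-- The operator `n • ·` on the `n`-th coefficient, which is `z ∂_z` on power series. -/
def eulerCoeff (n : ℕ) : R →ₗ[ℂ] R := n • LinearMap.id

theorem gradedLeibniz_eulerCoeff : GradedLeibniz (eulerCoeff (R := R)) := by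
  intro i j x y
  simp only [eulerCoeff, add_smul, LinearMap.add_apply, LinearMap.smul_apply, LinearMap.id_apply,
    smul_mul_assoc, mul_smul_comm]

theorem coeff_coeffMap (d : ℕ → R →ₗ[ℂ] R) (X : PowerSeries R) (n : ℕ) :
    PowerSeries.coeff n (coeffMap d X) = d n (PowerSeries.coeff n X) := by
  simp [coeffMap]

/-- Power series commute as soon as their coefficients do. -/
theorem commute_of_coeff {X Y : PowerSeries R}
    (h : ∀ i j, Commute (PowerSeries.coeff i X) (PowerSeries.coeff j Y)) : Commute X Y := by
  change X * Y = Y * X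
  ext n
  rw [PowerSeries.coeff_mul, PowerSeries.coeff_mul, ← Finset.Nat.sum_antidiagonal_swap]
  exact Finset.sum_congr rfl fun ij _ => (h _ _).eq

theorem commute_coeff_pow {X : PowerSeries R} {y : R}
    (h : ∀ i, Commute y (PowerSeries.coeff i X)) (N i : ℕ) :
    Commute y (PowerSeries.coeff i (X ^ N)) := by
  induction N generalizing i with
  | zero =>
    rw [pow_zero, PowerSeries.coeff_one]
    split_ifs
    · exact Commute.one_right y
    · exact Commute.zero_right y
  | succ N ih =>
    rw [pow_succ, PowerSeries.coeff_mul]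
    exact Commute.sum_right _ _ _ fun ij _ => (ih _).mul_right (h _)

theorem commute_coeff_psExp {X : PowerSeries R} {y : R}
    (h : ∀ i, Commute y (PowerSeries.coeff i X)) (i : ℕ) :
    Commute y (PowerSeries.coeff i (psExp X)) := by
  rw [coeff_psExp]
  exact Commute.sum_right _ _ _ fun N _ => (commute_coeff_pow h N i).smul_right _

theorem commute_coeff_psExp_psExp {X Y : PowerSeries R}
    (h : ∀ i j, Commute (PowerSeries.coeff i X) (PowerSeries.coeff j Y)) (i j : ℕ) :
    Commute (PowerSeries.coeff i (psExp X)) (PowerSeries.coeff j (psExp Y)) :=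
  commute_coeff_psExp (fun l => (commute_coeff_psExp (fun l' => (h l' l).symm) i).symm) j

theorem coeffMap_eulerCoeff_psExp {X : PowerSeries R} (h0 : PowerSeries.coeff 0 X = 0)
    (h : ∀ i j, Commute (PowerSeries.coeff i X) (PowerSeries.coeff j X)) :
    coeffMap eulerCoeff (psExp X) = coeffMap eulerCoeff X * psExp X := by
  refine coeffMap_psExp gradedLeibniz_eulerCoeff h0 (commute_of_coeff fun i j => ?_)
  rw [coeff_coeffMap]
  exact (h i j).smul_right j

/-- The equation `z E' = z X' E` determines `E` from its constant coefficient. -/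
theorem eq_of_euler_eq {X E F : PowerSeries R}
    (hE : coeffMap eulerCoeff E = coeffMap eulerCoeff X * E)
    (hF : coeffMap eulerCoeff F = coeffMap eulerCoeff X * F)
    (h0 : PowerSeries.coeff 0 E = PowerSeries.coeff 0 F) : E = F := by
  ext n
  induction n using Nat.strong_induction_on with
  | _ n ih =>
    rcases Nat.eq_zero_or_pos n with rfl | hn
    · exact h0
    have h1 := congrArg (PowerSeries.coeff n) hE
    have h2 := congrArg (PowerSeries.coeff n) hF
    rw [coeff_coeffMap, PowerSeries.coeff_mul] at h1 h2
    have h3 : (n : ℂ) • PowerSeries.coeff n E = (n : ℂ) • PowerSeries.coeff n F := by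
      rw [Nat.cast_smul_eq_nsmul, Nat.cast_smul_eq_nsmul]
      refine Eq.trans h1 (Eq.trans (Finset.sum_congr rfl fun ij hij => ?_) h2.symm)
      have hij := Finset.HasAntidiagonal.mem_antidiagonal.1 hij
      rcases Nat.eq_zero_or_pos ij.1 with h | h
      · simp [coeff_coeffMap, h, eulerCoeff]
      · rw [ih ij.2 (by omega)]
    have hn' : (n : ℂ) ≠ 0 := Nat.cast_ne_zero.2 hn.ne'
    rw [← inv_smul_smul₀ hn' (PowerSeries.coeff n E), h3, inv_smul_smul₀ hn']

theorem psExp_unique {X E : PowerSeries R} (h0 : PowerSeries.coeff 0 X = 0)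
    (h : ∀ i j, Commute (PowerSeries.coeff i X) (PowerSeries.coeff j X))
    (hE : coeffMap eulerCoeff E = coeffMap eulerCoeff X * E)
    (hE0 : PowerSeries.coeff 0 E = 1) : E = psExp X :=
  eq_of_euler_eq hE (coeffMap_eulerCoeff_psExp h0 h) (by rw [hE0, coeff_zero_psExp])

theorem coeffMap_add (d : ℕ → R →ₗ[ℂ] R) (X Y : PowerSeries R) :
    coeffMap d (X + Y) = coeffMap d X + coeffMap d Y := by
  ext n; simp [coeff_coeffMap]

theorem psExp_add {X Y : PowerSeries R} (hX0 : PowerSeries.coeff 0 X = 0)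
    (hY0 : PowerSeries.coeff 0 Y = 0)
    (hX : ∀ i j, Commute (PowerSeries.coeff i X) (PowerSeries.coeff j X))
    (hY : ∀ i j, Commute (PowerSeries.coeff i Y) (PowerSeries.coeff j Y))
    (hXY : ∀ i j, Commute (PowerSeries.coeff i X) (PowerSeries.coeff j Y)) :
    psExp (X + Y) = psExp X * psExp Y := by
  symm
  refine psExp_unique (by rw [map_add, hX0, hY0, add_zero]) (fun i j => ?_) ?_ ?_
  · simp only [map_add]
    exact ((hX i j).add_right (hXY i j)).add_left ((hXY j i).symm.add_right (hY i j))
  · have hc : Commute (psExp X) (coeffMap eulerCoeff Y) := by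
      refine commute_of_coeff fun i j => ?_
      rw [coeff_coeffMap]
      exact (commute_coeff_psExp (fun l => (hXY l j).symm) i).symm.smul_right j
    rw [coeffMap_mul gradedLeibniz_eulerCoeff, coeffMap_eulerCoeff_psExp hX0 hX,
      coeffMap_eulerCoeff_psExp hY0 hY, coeffMap_add, add_mul, mul_assoc, ← mul_assoc (psExp X),
      hc.eq, mul_assoc]
  · rw [PowerSeries.coeff_mul]; simp [coeff_zero_psExp]

theorem map_psExp {S : Type*} [Ring S] [Algebra ℂ S] (φ : R →ₐ[ℂ] S) (X : PowerSeries R) :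
    psExp (PowerSeries.map (φ : R →+* S) X) = PowerSeries.map (φ : R →+* S) (psExp X) := by
  ext n
  simp only [coeff_psExp, PowerSeries.coeff_map, map_sum, ← map_pow]
  simp

/-- Rescaling the variable. -/
theorem coeff_psExp_smul_pow {X : PowerSeries R} (h0 : PowerSeries.coeff 0 X = 0)
    (h : ∀ i j, Commute (PowerSeries.coeff i X) (PowerSeries.coeff j X)) (t : ℂ) (n : ℕ) :
    PowerSeries.coeff n (psExp (PowerSeries.mk fun i => t ^ i • PowerSeries.coeff i X)) =
      t ^ n • PowerSeries.coeff n (psExp X) := by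
  have : (PowerSeries.mk fun n => t ^ n • PowerSeries.coeff n (psExp X)) =
      psExp (PowerSeries.mk fun i => t ^ i • PowerSeries.coeff i X) := by
    refine psExp_unique (by simp [h0]) (fun i j => ?_) ?_ (by simp [coeff_zero_psExp])
    · simp only [PowerSeries.coeff_mk]
      exact ((h i j).smul_left _).smul_right _
    · ext n
      have h1 := congrArg (PowerSeries.coeff n) (coeffMap_eulerCoeff_psExp h0 h)
      rw [coeff_coeffMap, PowerSeries.coeff_mul] at h1
      rw [coeff_coeffMap, PowerSeries.coeff_mk, map_smul, h1, PowerSeries.coeff_mul,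
        Finset.smul_sum]
      refine Finset.sum_congr rfl fun ij hij => ?_
      rw [coeff_coeffMap, coeff_coeffMap, PowerSeries.coeff_mk, PowerSeries.coeff_mk, map_smul,
        smul_mul_smul_comm, ← pow_add, Finset.HasAntidiagonal.mem_antidiagonal.1 hij]
  rw [← this, PowerSeries.coeff_mk]

theorem psExp_zero : psExp (0 : PowerSeries R) = 1 := by
  symm
  refine psExp_unique (by simp) (by simp) ?_ (by simp)
  ext n
  have : coeffMap (eulerCoeff (R := R)) 0 = 0 := by ext n; simp [coeff_coeffMap]
  rw [this, zero_mul, coeff_coeffMap, PowerSeries.coeff_one]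
  split_ifs with h <;> simp [eulerCoeff, h]

/-- The commutation relation `exp (∑ D_n ζ ^ n) C(w) = exp (∑ γ_n (ζ w) ^ n) C(w) exp (∑ D_n ζ ^ n)`
when `[D_n, C(w)] = γ_n w ^ n C(w)`, read off at the coefficient of `ζ ^ j w ^ k`. Only the
coefficients of `C(w)` up to the order `K` need to satisfy the hypothesis. -/
theorem coeff_psExp_mul_of_commutator {D : PowerSeries R} {γ : PowerSeries ℂ} {C : ℤ → R}
    (hD0 : PowerSeries.coeff 0 D = 0) (hγ0 : PowerSeries.coeff 0 γ = 0)
    (hD : ∀ i j, Commute (PowerSeries.coeff i D) (PowerSeries.coeff j D))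
    {K : ℤ} (hC : ∀ (n : ℕ) (k : ℤ), k ≤ K → PowerSeries.coeff n D * C k =
      C k * PowerSeries.coeff n D + PowerSeries.coeff n γ • C (k - n)) (j : ℕ) {k : ℤ}
    (hk : k ≤ K) :
    PowerSeries.coeff j (psExp D) * C k = ∑ st ∈ Finset.HasAntidiagonal.antidiagonal j,
      PowerSeries.coeff st.1 (psExp γ) • (C (k - st.1) * PowerSeries.coeff st.2 (psExp D)) := by
  induction j using Nat.strong_induction_on with
  | _ j ih =>
    rcases Nat.eq_zero_or_pos j with rfl | hj
    · simp [coeff_zero_psExp]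
    set a := fun i => PowerSeries.coeff i (psExp D) with ha
    set g := fun i => PowerSeries.coeff i (psExp γ) with hg
    set d := fun i => PowerSeries.coeff i D with hd
    set c := fun i => PowerSeries.coeff i γ with hc
    -- The Euler equation for the two exponentials is a recursion for their coefficients.
    have ra : ∀ n, n • a n =
        ∑ ij ∈ Finset.HasAntidiagonal.antidiagonal n, ij.1 • (d ij.1 * a ij.2) := by
      intro n
      have h1 := congrArg (PowerSeries.coeff n) (coeffMap_eulerCoeff_psExp hD0 hD)
      rw [coeff_coeffMap, PowerSeries.coeff_mul] at h1
      refine Eq.trans h1 (Finset.sum_congr rfl fun ij _ => ?_)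
      simp [coeff_coeffMap, eulerCoeff, d, a, mul_assoc]
    have rg : ∀ n : ℕ, (n : ℂ) * g n =
        ∑ ij ∈ Finset.HasAntidiagonal.antidiagonal n, (ij.1 : ℂ) * (c ij.1 * g ij.2) := by
      intro n
      have h1 := congrArg (PowerSeries.coeff n)
        (coeffMap_eulerCoeff_psExp hγ0 fun _ _ => Commute.all _ _)
      rw [coeff_coeffMap, PowerSeries.coeff_mul] at h1
      refine Eq.trans (by simp [eulerCoeff, g]) (Eq.trans h1 (Finset.sum_congr rfl fun ij _ => ?_))
      simp [coeff_coeffMap, eulerCoeff, c, g, mul_assoc]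
    have hj' : (j : ℂ) ≠ 0 := Nat.cast_ne_zero.2 hj.ne'
    suffices h : (j : ℂ) • (a j * C k) =
        (j : ℂ) • ∑ st ∈ Finset.HasAntidiagonal.antidiagonal j, g st.1 • (C (k - st.1) * a st.2) by
      have := congrArg (fun x => (j : ℂ)⁻¹ • x) h
      simpa only [inv_smul_smul₀ hj'] using this
    have e1 : (j : ℂ) • (a j * C k) = ∑ ni ∈ Finset.HasAntidiagonal.antidiagonal j,
        ∑ st ∈ Finset.HasAntidiagonal.antidiagonal ni.2, ((ni.1 : ℂ) * g st.1) •
          (C (k - st.1) * (d ni.1 * a st.2)) +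
        ∑ ni ∈ Finset.HasAntidiagonal.antidiagonal j,
          ∑ st ∈ Finset.HasAntidiagonal.antidiagonal ni.2,
            ((ni.1 : ℂ) * (c ni.1 * g st.1)) • (C (k - (ni.1 + st.1 : ℕ)) * a st.2) := by
      rw [← smul_mul_assoc, Nat.cast_smul_eq_nsmul, ra, Finset.sum_mul, ← Finset.sum_add_distrib]
      refine Finset.sum_congr rfl fun ni hni => ?_
      have hni := Finset.HasAntidiagonal.mem_antidiagonal.1 hni
      rw [← Finset.sum_add_distrib]
      rcases Nat.eq_zero_or_pos ni.1 with h | h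
      · simp [h]
      · rw [smul_mul_assoc, mul_assoc, ih ni.2 (by omega), Finset.mul_sum, Finset.smul_sum]
        refine Finset.sum_congr rfl fun st _ => ?_
        rw [mul_smul_comm, ← mul_assoc, hC _ _ (by omega), ← Nat.cast_smul_eq_nsmul ℂ, smul_smul,
          add_mul, smul_add, mul_assoc, smul_mul_assoc, smul_smul]
        congr 2
        · ring
        · congr 2; push_cast; ring
    have e2 : ∑ ni ∈ Finset.HasAntidiagonal.antidiagonal j,
        ∑ st ∈ Finset.HasAntidiagonal.antidiagonal ni.2, ((ni.1 : ℂ) * g st.1) •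
          (C (k - st.1) * (d ni.1 * a st.2)) =
        ∑ st ∈ Finset.HasAntidiagonal.antidiagonal j,
          g st.1 • (C (k - st.1) * ((st.2 : ℂ) • a st.2)) := by
      have : ∀ st : ℕ × ℕ, g st.1 • (C (k - st.1) * ((st.2 : ℂ) • a st.2)) =
          ∑ ij ∈ Finset.HasAntidiagonal.antidiagonal st.2, ((ij.1 : ℂ) * g st.1) •
            (C (k - st.1) * (d ij.1 * a ij.2)) := by
        intro st
        rw [Nat.cast_smul_eq_nsmul, ra, Finset.mul_sum, Finset.smul_sum]
        refine Finset.sum_congr rfl fun ij _ => ?_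
        rw [← Nat.cast_smul_eq_nsmul ℂ, mul_smul_comm, smul_smul, mul_comm]
      rw [Finset.sum_congr rfl fun st _ => this st]
      rw [Finset.sum_sigma', Finset.sum_sigma']
      refine Finset.sum_nbij' (fun x => ⟨(x.2.1, x.1.1 + x.2.2), (x.1.1, x.2.2)⟩)
        (fun x => ⟨(x.2.1, x.1.1 + x.2.2), (x.1.1, x.2.2)⟩) ?_ ?_ ?_ ?_ ?_ <;>
      · rintro ⟨⟨n, i⟩, ⟨s, t⟩⟩ hx
        simp only [Finset.mem_sigma, Finset.HasAntidiagonal.mem_antidiagonal] at hx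
        obtain ⟨h1, h2⟩ := hx
        subst h2
        first
          | rfl
          | (simp only [Finset.mem_sigma, Finset.HasAntidiagonal.mem_antidiagonal, and_true]; omega)
    have e3 : ∑ ni ∈ Finset.HasAntidiagonal.antidiagonal j,
        ∑ st ∈ Finset.HasAntidiagonal.antidiagonal ni.2,
          ((ni.1 : ℂ) * (c ni.1 * g st.1)) • (C (k - (ni.1 + st.1 : ℕ)) * a st.2) =
        ∑ st ∈ Finset.HasAntidiagonal.antidiagonal j,
          ((st.1 : ℂ) * g st.1) • (C (k - st.1) * a st.2) := by
      have : ∀ st : ℕ × ℕ, ((st.1 : ℂ) * g st.1) • (C (k - st.1) * a st.2) =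
          ∑ ij ∈ Finset.HasAntidiagonal.antidiagonal st.1, ((ij.1 : ℂ) * (c ij.1 * g ij.2)) •
            (C (k - (ij.1 + ij.2 : ℕ)) * a st.2) := by
        intro st
        rw [rg, Finset.sum_smul]
        refine Finset.sum_congr rfl fun ij hij => ?_
        rw [Finset.HasAntidiagonal.mem_antidiagonal.1 hij]
      rw [Finset.sum_congr rfl fun st _ => this st]
      rw [Finset.sum_sigma', Finset.sum_sigma']
      refine Finset.sum_nbij' (fun x => ⟨(x.1.1 + x.2.1, x.2.2), (x.1.1, x.2.1)⟩)
        (fun x => ⟨(x.2.1, x.2.2 + x.1.2), (x.2.2, x.1.2)⟩) ?_ ?_ ?_ ?_ ?_ <;>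
      · rintro ⟨⟨n, i⟩, ⟨s, t⟩⟩ hx
        simp only [Finset.mem_sigma, Finset.HasAntidiagonal.mem_antidiagonal] at hx
        obtain ⟨h1, h2⟩ := hx
        subst h2
        first
          | rfl
          | (simp only [Finset.mem_sigma, Finset.HasAntidiagonal.mem_antidiagonal, and_true]; omega)
    rw [e1, e2, e3, ← Finset.sum_add_distrib, Finset.smul_sum]
    refine Finset.sum_congr rfl fun st hst => ?_
    rw [mul_smul_comm, smul_smul, ← add_smul, smul_smul,
      ← Finset.HasAntidiagonal.mem_antidiagonal.1 hst]
    push_cast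
    congr 1
    ring

end PsExp

/-! ### Coefficients of the creation and annihilation exponentials -/

open Finset.HasAntidiagonal (antidiagonal mem_antidiagonal)

/-- The exponent of the creation part of `:exp X(z):`, as a power series over the polynomial
ring. -/
def creationExponent (X : LinField) : PowerSeries Fock :=
  PowerSeries.mk fun n => if n = 0 then 0 else
    ∑ i : Boson, X.osc i (-(n : ℤ)) • (MvPolynomial.X (i, n.toPNat') : Fock)

/-- The coefficient of `z ^ m` in the creation part of `:exp X(z):`, which acts by multiplication
with this polynomial. It vanishes for `m < 0`. -/
def creationCoeff (X : LinField) (m : ℤ) : Fock :=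
  if 0 ≤ m then PowerSeries.coeff m.toNat (psExp (creationExponent X)) else 0

/-- The coefficient of `z ^ (-n)` in the exponent of the annihilation part of `:exp X(z):`: the
derivation that sends the variable `(i, n)` to the constant `X.osc i n • [i_n, i_{-n}]` and the
other variables to zero. -/
def annihilationMode (h : ℂ) (k : ℝ) (X : LinField) (n : ℕ) : Derivation ℂ Fock Fock :=
  MvPolynomial.mkDerivation ℂ fun a =>
    if (a.2 : ℕ) = n then MvPolynomial.C (X.osc a.1 n * bracket h k a.1 n) else 0

/-- The exponent of the annihilation part of `:exp X(z):`, as a power series in `z⁻¹`. -/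
def annihilationExponent (h : ℂ) (k : ℝ) (X : LinField) : PowerSeries (Module.End ℂ Fock) :=
  PowerSeries.mk fun n => (annihilationMode h k X n).toLinearMap

/-- The coefficient of `z ^ (-j)` in the annihilation part of `:exp X(z):`, as an operator on a
single Fock space. -/
def annihilationCoeff (h : ℂ) (k : ℝ) (X : LinField) (j : ℕ) : Module.End ℂ Fock :=
  PowerSeries.coeff j (psExp (annihilationExponent h k X))

/-- The exponent of the factor picked up when `:exp X(z)::exp Y(w):` is brought into normal order,
as a power series in `w / z`. -/
def contraction (h : ℂ) (k : ℝ) (X Y : LinField) : PowerSeries ℂ :=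
  PowerSeries.mk fun n => if n = 0 then 0 else
    ∑ i : Boson, X.osc i n * Y.osc i (-(n : ℤ)) * bracket h k i n

section

variable {h : ℂ} {k : ℝ}

theorem coeff_zero_creationExponent (X : LinField) :
    PowerSeries.coeff 0 (creationExponent X) = 0 := by
  rw [creationExponent, PowerSeries.coeff_mk, if_pos rfl]

theorem annihilationMode_X (X : LinField) (n : ℕ) (a : Boson × ℕ+) :
    annihilationMode h k X n (MvPolynomial.X a) = MvPolynomial.C
      (if (a.2 : ℕ) = n then X.osc a.1 n * bracket h k a.1 n else 0) := by
  rw [annihilationMode, MvPolynomial.mkDerivation_X]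
  split_ifs <;> simp

theorem coeff_zero_annihilationExponent (X : LinField) :
    PowerSeries.coeff 0 (annihilationExponent h k X) = 0 := by
  have : annihilationMode h k X 0 = 0 := by
    refine MvPolynomial.derivation_ext fun a => ?_
    simp [annihilationMode_X]
  rw [annihilationExponent, PowerSeries.coeff_mk, this]; rfl

theorem coeff_zero_contraction (X Y : LinField) :
    PowerSeries.coeff 0 (contraction h k X Y) = 0 := by
  rw [contraction, PowerSeries.coeff_mk, if_pos rfl]

theorem creationCoeff_natCast (X : LinField) (m : ℕ) :
    creationCoeff X m = PowerSeries.coeff m (psExp (creationExponent X)) := by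
  simp [creationCoeff]

theorem creationCoeff_of_neg (X : LinField) {m : ℤ} (hm : m < 0) : creationCoeff X m = 0 := by
  rw [creationCoeff, if_neg (not_le.2 hm)]

theorem annihilationMode_comm (X Y : LinField) (m n : ℕ) (f : Fock) :
    annihilationMode h k X m (annihilationMode h k Y n f) =
      annihilationMode h k Y n (annihilationMode h k X m f) := by
  have : ⁅annihilationMode h k X m, annihilationMode h k Y n⁆ = 0 := by
    refine MvPolynomial.derivation_ext fun i => ?_
    rw [Derivation.commutator_apply, annihilationMode_X, annihilationMode_X]
    simp
  have h2 := congrArg (fun D : Derivation ℂ Fock Fock => D f) this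
  simp only [Derivation.commutator_apply, Derivation.zero_apply] at h2
  exact sub_eq_zero.1 h2

theorem commute_annihilationExponent (X Y : LinField) (i j : ℕ) :
    Commute (PowerSeries.coeff i (annihilationExponent h k X))
      (PowerSeries.coeff j (annihilationExponent h k Y)) := by
  refine LinearMap.ext fun f => ?_
  simpa [annihilationExponent] using annihilationMode_comm X Y i j f

theorem annihilationCoeff_comm (X Y : LinField) (i j : ℕ) (f : Fock) :
    annihilationCoeff h k X i (annihilationCoeff h k Y j f) =
      annihilationCoeff h k Y j (annihilationCoeff h k X i f) :=
  LinearMap.congr_fun (commute_coeff_psExp_psExp (commute_annihilationExponent X Y) i j).eq f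

theorem annihilationMode_creationExponent (X Y : LinField) (n m : ℕ) :
    annihilationMode h k X n (PowerSeries.coeff m (creationExponent Y)) =
      if m = n then MvPolynomial.C (PowerSeries.coeff n (contraction h k X Y)) else 0 := by
  rw [creationExponent, PowerSeries.coeff_mk, contraction, PowerSeries.coeff_mk]
  rcases Nat.eq_zero_or_pos m with rfl | hm
  · by_cases hn : 0 = n <;> simp [hn]
  rw [if_neg hm.ne']
  simp only [map_sum, Derivation.map_smul, annihilationMode_X, Nat.toPNat'_coe, if_pos hm]
  by_cases hmn : m = n
  · subst hmn
    simp only [if_true, if_neg hm.ne', MvPolynomial.smul_eq_C_mul, ← map_mul, map_sum]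
    exact Finset.sum_congr rfl fun i _ => by congr 1; ring
  · simp [hmn]

/-- Annihilation modes act on the creation exponential by
`D_n exp (Y_-(w)) = γ_n w ^ n exp (Y_-(w))`. -/
theorem annihilationMode_creationCoeff (X Y : LinField) (n : ℕ) (m : ℤ) :
    annihilationMode h k X n (creationCoeff Y m) =
      PowerSeries.coeff n (contraction h k X Y) • creationCoeff Y (m - n) := by
  rcases lt_or_ge m 0 with hm | hm
  · rw [creationCoeff_of_neg _ hm, creationCoeff_of_neg _ (by omega), map_zero, smul_zero]
  lift m to ℕ using hm
  have hd : GradedLeibniz (R := Fock) fun _ => (annihilationMode h k X n).toLinearMap := by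
    intro i j x y
    simp [mul_comm, add_comm]
  have h1 := congrArg (PowerSeries.coeff m) (coeffMap_psExp hd (coeff_zero_creationExponent Y)
    (Commute.all _ _))
  rw [coeff_coeffMap, PowerSeries.coeff_mul] at h1
  simp only [coeff_coeffMap, Derivation.coeFn_coe, annihilationMode_creationExponent] at h1
  rw [creationCoeff_natCast, h1]
  rcases lt_or_ge m n with hmn | hmn
  · rw [creationCoeff_of_neg _ (by omega), smul_zero]
    refine Finset.sum_eq_zero fun ij hij => ?_
    have := mem_antidiagonal.1 hij
    rw [if_neg (by omega), zero_mul]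
  · obtain ⟨l, rfl⟩ := Nat.exists_eq_add_of_le hmn
    rw [Finset.sum_eq_single (n, l), if_pos rfl, MvPolynomial.C_mul']
    · rw [show ((n + l : ℕ) : ℤ) - n = l by push_cast; ring, creationCoeff_natCast]
    · intro ij hij hne
      have := mem_antidiagonal.1 hij
      rw [if_neg, zero_mul]
      rintro h2
      exact hne (Prod.ext h2 (by simp only; omega))
    · intro hne
      exact absurd (mem_antidiagonal.2 (by simp)) hne

/-- The exchange of an annihilation exponential with a creation exponential. -/
theorem annihilationCoeff_creationCoeff_mul (X Y : LinField) (j : ℕ) (m : ℤ) (u : Fock) :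
    annihilationCoeff h k X j (creationCoeff Y m * u) = ∑ st ∈ antidiagonal j,
      PowerSeries.coeff st.1 (psExp (contraction h k X Y)) •
        (creationCoeff Y (m - st.1) * annihilationCoeff h k X st.2 u) := by
  have := coeff_psExp_mul_of_commutator (D := annihilationExponent h k X)
    (γ := contraction h k X Y) (C := fun m => LinearMap.mulLeft ℂ (creationCoeff Y m))
    (coeff_zero_annihilationExponent X) (coeff_zero_contraction X Y)
    (commute_annihilationExponent X X) (K := m) (fun n m _ => LinearMap.ext fun f => by
      simp [annihilationExponent, annihilationMode_creationCoeff, mul_comm, add_comm]) j le_rfl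
  have h2 := LinearMap.congr_fun this u
  simpa [LinearMap.sum_apply, annihilationCoeff] using h2

/-- Annihilation exponentials act locally finitely. -/
theorem eventually_annihilationCoeff_eq_zero (X : LinField) (v : Fock) :
    ∃ J, ∀ j, J ≤ j → annihilationCoeff h k X j v = 0 := by
  have hX : ∀ (a : Boson × ℕ+) (j : ℕ) (u : Fock), (a.2 : ℕ) ≤ j → ∃ c : ℂ,
      annihilationCoeff h k X j (MvPolynomial.X a * u) =
        MvPolynomial.X a * annihilationCoeff h k X j u +
          c • annihilationCoeff h k X (j - a.2) u := by
    intro a j u hj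
    have ha : 0 < (a.2 : ℕ) := a.2.pos
    set κ : ℕ → ℂ := fun n => if (a.2 : ℕ) = n then X.osc a.1 n * bracket h k a.1 n else 0 with hκ
    have hκ0 : ∀ n : ℕ, n ≠ a.2 → κ n = 0 := fun n hn => if_neg hn.symm
    -- Up to order zero, `C(w) = X_a + w ^ (-a.2)` behaves like a creation exponential.
    set C : ℤ → Module.End ℂ Fock := fun m =>
      if m = 0 then LinearMap.mulLeft ℂ (MvPolynomial.X a) else if m = -a.2 then 1 else 0 with hC
    have h0 : C 0 = LinearMap.mulLeft ℂ (MvPolynomial.X a) := if_pos rfl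
    have h1 : C (-a.2) = 1 := by simp [hC]
    have h2 : ∀ m : ℤ, m ≠ 0 → m ≠ -a.2 → C m = 0 := fun m h h' => by
      rw [hC]; simp only; rw [if_neg h, if_neg h']
    have := coeff_psExp_mul_of_commutator (D := annihilationExponent h k X)
      (γ := PowerSeries.mk κ) (C := C) (K := 0)
      (coeff_zero_annihilationExponent X) (by rw [PowerSeries.coeff_mk]; exact hκ0 0 ha.ne)
      (commute_annihilationExponent X X) (fun n m hm => LinearMap.ext fun f => by
        rw [PowerSeries.coeff_mk, annihilationExponent, PowerSeries.coeff_mk]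
        by_cases hn : n = a.2
        · subst hn
          rcases eq_or_ne m 0 with rfl | hm0
          · rw [zero_sub, h0, h1]
            simp [annihilationMode_X, κ, mul_comm, add_comm, MvPolynomial.smul_eq_C_mul]
          · rw [h2 (m - a.2) (by omega) (by omega)]
            by_cases hm1 : m = -a.2
            · rw [hm1, h1]; simp
            · rw [h2 m hm0 hm1]; simp
        · rw [hκ0 n hn]
          rcases eq_or_ne m 0 with rfl | hm0
          · rw [h0]
            simp [annihilationMode_X, Ne.symm hn]
          · by_cases hm1 : m = -a.2
            · rw [hm1, h1]; simp
            · rw [h2 m hm0 hm1]; simp) j (le_refl 0)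
    have h3 := LinearMap.congr_fun this u
    rw [h0] at h3
    refine ⟨PowerSeries.coeff a.2 (psExp (PowerSeries.mk κ)), ?_⟩
    obtain ⟨l, rfl⟩ := Nat.exists_eq_add_of_le hj
    rw [Finset.sum_eq_add_of_mem (0, (a.2 : ℕ) + l) ((a.2 : ℕ), l) (by simp) (by simp)
      (fun e => ha.ne (congrArg Prod.fst e))] at h3
    · simpa [h0, h1, coeff_zero_psExp, annihilationCoeff] using h3
    · rintro ⟨s, t⟩ hst ⟨hne1, hne2⟩
      have hst := mem_antidiagonal.1 hst
      simp only [ne_eq, Prod.mk.injEq] at hne1 hne2 hst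
      rw [h2 _ (by simp only; omega) (by simp only; omega), zero_mul, smul_zero]
  induction v using MvPolynomial.induction_on with
  | C c =>
    refine ⟨1, fun j hj => ?_⟩
    rw [annihilationCoeff, coeff_psExp, LinearMap.sum_apply]
    refine Finset.sum_eq_zero fun N _ => ?_
    rw [LinearMap.smul_apply]
    rcases N with _ | N
    · rw [pow_zero, PowerSeries.coeff_one, if_neg (by omega)]; simp
    · rw [pow_succ, PowerSeries.coeff_mul, LinearMap.sum_apply, Finset.sum_eq_zero, smul_zero]
      intro ij _
      simp [annihilationExponent]
  | add f g hf hg =>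
    obtain ⟨J₁, h₁⟩ := hf
    obtain ⟨J₂, h₂⟩ := hg
    refine ⟨max J₁ J₂, fun j hj => ?_⟩
    rw [map_add, h₁ j (le_trans (le_max_left _ _) hj), h₂ j (le_trans (le_max_right _ _) hj),
      add_zero]
  | mul_X f a hf =>
    obtain ⟨J, h₁⟩ := hf
    refine ⟨J + a.2, fun j hj => ?_⟩
    obtain ⟨c, hc⟩ := hX a j f (by omega)
    rw [mul_comm, hc, h₁ j (by omega), h₁ (j - a.2) (by omega), mul_zero, smul_zero, add_zero]

end

/-! ### Vertex operators on a single Fock space -/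

open Finset.HasAntidiagonal (antidiagonal mem_antidiagonal)

section

variable {h : ℂ} {k : ℝ}

theorem finite_support_vertexOp (X : LinField) (N : ℤ) (v : Fock) :
    (Function.support fun j : ℕ =>
      creationCoeff X (N + j) * annihilationCoeff h k X j v).Finite := by
  obtain ⟨J, hJ⟩ := eventually_annihilationCoeff_eq_zero (h := h) (k := k) X v
  refine (Set.finite_Iio J).subset fun j hj => ?_
  by_contra hj'
  exact hj (by simp only; rw [hJ j (not_lt.1 hj'), mul_zero])

variable (h k) in
/-- The coefficient of `z ^ N` in the oscillator part of `:exp X(z):`. -/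
def vertexOp (X : LinField) (N : ℤ) : Fock →ₗ[ℂ] Fock where
  toFun v := ∑ᶠ j : ℕ, creationCoeff X (N + j) * annihilationCoeff h k X j v
  map_add' u v := by
    rw [← finsum_add_distrib (finite_support_vertexOp X N u) (finite_support_vertexOp X N v)]
    simp only [map_add, mul_add]
  map_smul' c v := by
    rw [RingHom.id_apply, smul_finsum]
    simp only [map_smul, mul_smul_comm]

theorem vertexOp_eq_sum {X : LinField} {v : Fock} {J : ℕ}
    (hJ : ∀ j, J ≤ j → annihilationCoeff h k X j v = 0) (N : ℤ) :
    vertexOp h k X N v =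
      ∑ j ∈ Finset.range J, creationCoeff X (N + j) * annihilationCoeff h k X j v := by
  refine finsum_eq_sum_of_support_subset _ fun j hj => ?_
  by_contra hj'
  rw [Finset.mem_coe, Finset.mem_range, not_lt] at hj'
  exact hj (by simp only; rw [hJ j hj', mul_zero])

variable (h k) in
/-- The coefficient of `z ^ M w ^ N` in the oscillator part of `:exp (X(z) + Y(w)):`, applied
to `v`. -/
def normalPair (X Y : LinField) (M N : ℤ) (v : Fock) : Fock :=
  ∑ᶠ p : ℕ × ℕ, creationCoeff X (M + p.1) * creationCoeff Y (N + p.2) *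
    annihilationCoeff h k X p.1 (annihilationCoeff h k Y p.2 v)

variable (h k) in
/-- `J` bounds the modes of the annihilation exponentials of `X` and `Y` that act nontrivially
on `v`. -/
structure AnnihilationBound (X Y : LinField) (v : Fock) (J : ℕ) : Prop where
  right : ∀ l, J ≤ l → annihilationCoeff h k Y l v = 0
  left : ∀ j l, J ≤ j → annihilationCoeff h k X j (annihilationCoeff h k Y l v) = 0

theorem exists_annihilationBound (X Y : LinField) (v : Fock) :
    ∃ J, AnnihilationBound h k X Y v J := by
  obtain ⟨J₁, h₁⟩ := eventually_annihilationCoeff_eq_zero (h := h) (k := k) X v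
  obtain ⟨J₂, h₂⟩ := eventually_annihilationCoeff_eq_zero (h := h) (k := k) Y v
  refine ⟨max J₁ J₂, fun l hl => h₂ l ((le_max_right _ _).trans hl), fun j l hj => ?_⟩
  rw [annihilationCoeff_comm, h₁ j ((le_max_left _ _).trans hj), map_zero]

theorem normalPair_eq_sum {X Y : LinField} {v : Fock} {J : ℕ}
    (hJ : AnnihilationBound h k X Y v J) (M N : ℤ) :
    normalPair h k X Y M N v = ∑ l ∈ Finset.range J, ∑ t ∈ Finset.range J,
      creationCoeff X (M + t) * creationCoeff Y (N + l) *
        annihilationCoeff h k X t (annihilationCoeff h k Y l v) := by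
  rw [Finset.sum_comm, ← Finset.sum_product']
  refine finsum_eq_sum_of_support_subset _ fun p hp => ?_
  by_contra hp'
  rw [Finset.mem_coe, Finset.mem_product, Finset.mem_range, Finset.mem_range, not_and_or, not_lt,
    not_lt] at hp'
  refine hp ?_
  simp only
  rcases hp' with h1 | h1
  · rw [hJ.left _ _ h1, mul_zero]
  · rw [hJ.right _ h1, map_zero, mul_zero]

theorem normalPair_eq_zero_left {X Y : LinField} {v : Fock} {J : ℕ}
    (hJ : AnnihilationBound h k X Y v J) {M : ℤ} (hM : M + J ≤ 0) (N : ℤ) :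
    normalPair h k X Y M N v = 0 := by
  rw [normalPair_eq_sum hJ]
  refine Finset.sum_eq_zero fun l _ => Finset.sum_eq_zero fun t ht => ?_
  have := Finset.mem_range.1 ht
  rw [creationCoeff_of_neg X (by omega), zero_mul, zero_mul]

theorem normalPair_eq_zero_right {X Y : LinField} {v : Fock} {J : ℕ}
    (hJ : AnnihilationBound h k X Y v J) (M : ℤ) {N : ℤ} (hN : N + J ≤ 0) :
    normalPair h k X Y M N v = 0 := by
  rw [normalPair_eq_sum hJ]
  refine Finset.sum_eq_zero fun l hl => Finset.sum_eq_zero fun t _ => ?_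
  have := Finset.mem_range.1 hl
  rw [creationCoeff_of_neg Y (by omega), mul_zero, zero_mul]

theorem normalPair_comm (X Y : LinField) (M N : ℤ) (v : Fock) :
    normalPair h k Y X N M v = normalPair h k X Y M N v := by
  rw [normalPair, normalPair, ← finsum_comp_equiv (Equiv.prodComm ℕ ℕ)]
  refine finsum_congr fun p => ?_
  simp only [Equiv.prodComm_apply, Prod.fst_swap, Prod.snd_swap]
  rw [annihilationCoeff_comm, mul_comm (creationCoeff Y _)]

theorem sum_range_antidiagonal {M : Type*} [AddCommMonoid M] (F : ℕ × ℕ → M) {S J : ℕ}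
    (hF : ∀ s t, S ≤ s ∨ J ≤ t → F (s, t) = 0) :
    ∑ j ∈ Finset.range (S + J), ∑ p ∈ antidiagonal j, F p =
      ∑ s ∈ Finset.range S, ∑ t ∈ Finset.range J, F (s, t) := by
  rw [← Finset.sum_product', ← Finset.sum_fiberwise_of_maps_to (t := Finset.range (S + J))
    (g := fun p : ℕ × ℕ => p.1 + p.2)]
  · refine Finset.sum_congr rfl fun j _ => ?_
    symm
    refine Finset.sum_subset (fun p hp => ?_) fun p hp hp' => ?_
    · exact mem_antidiagonal.2 (Finset.mem_filter.1 hp).2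
    · rw [Finset.mem_filter, Finset.mem_product, Finset.mem_range, Finset.mem_range] at hp'
      have := mem_antidiagonal.1 hp
      exact hF p.1 p.2 (by omega)
  · intro p hp
    rw [Finset.mem_product, Finset.mem_range, Finset.mem_range] at hp
    rw [Finset.mem_range]; omega

/-- A vertex operator applied to a vector with a creation factor. -/
theorem vertexOp_creationCoeff_mul {X Y : LinField} {u : Fock} {J S : ℕ}
    (hJ : ∀ j, J ≤ j → annihilationCoeff h k X j u = 0) (M : ℤ) {K : ℤ} (hS : K < S) :
    vertexOp h k X M (creationCoeff Y K * u) = ∑ s ∈ Finset.range S, ∑ t ∈ Finset.range J,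
      PowerSeries.coeff s (psExp (contraction h k X Y)) •
        (creationCoeff X (M + s + t) * creationCoeff Y (K - s) * annihilationCoeff h k X t u) := by
  have hF : ∀ s t, S ≤ s ∨ J ≤ t → PowerSeries.coeff s (psExp (contraction h k X Y)) •
      (creationCoeff X (M + s + t) * creationCoeff Y (K - s) *
        annihilationCoeff h k X t u) = 0 := by
    rintro s t (hs | ht)
    · rw [creationCoeff_of_neg Y (by omega), mul_zero, zero_mul, smul_zero]
    · rw [hJ t ht, mul_zero, smul_zero]
  rw [vertexOp_eq_sum (J := S + J), ← sum_range_antidiagonal (fun p =>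
    PowerSeries.coeff p.1 (psExp (contraction h k X Y)) •
      (creationCoeff X (M + p.1 + p.2) * creationCoeff Y (K - p.1) *
        annihilationCoeff h k X p.2 u)) hF]
  · refine Finset.sum_congr rfl fun j _ => ?_
    rw [annihilationCoeff_creationCoeff_mul, Finset.mul_sum]
    refine Finset.sum_congr rfl fun p hp => ?_
    rw [mul_smul_comm, ← mul_assoc, ← mem_antidiagonal.1 hp]
    push_cast
    rw [add_assoc]
  · intro j hj
    rw [annihilationCoeff_creationCoeff_mul]
    refine Finset.sum_eq_zero fun p hp => ?_
    have := mem_antidiagonal.1 hp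
    rcases le_or_gt S p.1 with h1 | h1
    · rw [creationCoeff_of_neg Y (by omega), zero_mul, smul_zero]
    · rw [hJ p.2 (by omega), mul_zero, smul_zero]

/-- Wick's theorem as a finite sum: beyond `S` all normal ordered terms vanish on `v`. -/
theorem vertexOp_vertexOp_eq_sum {X Y : LinField} {v : Fock} {J S : ℕ}
    (hJ : AnnihilationBound h k X Y v J) (M : ℤ) {N : ℤ} (hS : N + J ≤ S) :
    vertexOp h k X M (vertexOp h k Y N v) = ∑ s ∈ Finset.range S,
      PowerSeries.coeff s (psExp (contraction h k X Y)) •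
        normalPair h k X Y (M + s) (N - s) v := by
  rw [vertexOp_eq_sum hJ.right, map_sum]
  have : ∀ l ∈ Finset.range J, vertexOp h k X M (creationCoeff Y (N + l) *
      annihilationCoeff h k Y l v) = ∑ s ∈ Finset.range S, ∑ t ∈ Finset.range J,
      PowerSeries.coeff s (psExp (contraction h k X Y)) •
        (creationCoeff X (M + s + t) * creationCoeff Y (N + l - s) *
          annihilationCoeff h k X t (annihilationCoeff h k Y l v)) := by
    intro l hl
    have := Finset.mem_range.1 hl
    exact vertexOp_creationCoeff_mul (fun j hj => hJ.left j l hj) M (by omega)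
  rw [Finset.sum_congr rfl this, Finset.sum_comm]
  refine Finset.sum_congr rfl fun s _ => ?_
  rw [normalPair_eq_sum hJ, Finset.smul_sum]
  refine Finset.sum_congr rfl fun l _ => ?_
  rw [Finset.smul_sum]
  refine Finset.sum_congr rfl fun t _ => ?_
  rw [show N + (l : ℤ) - s = N - s + l by ring]

/-- Wick's theorem: a product of two vertex operators is the exponential of their contraction, as a
power series in `w / z`, times their normal ordered product. -/
theorem vertexOp_vertexOp (X Y : LinField) (M N : ℤ) (v : Fock) :
    vertexOp h k X M (vertexOp h k Y N v) = ∑ᶠ s : ℕ,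
      PowerSeries.coeff s (psExp (contraction h k X Y)) •
        normalPair h k X Y (M + s) (N - s) v := by
  obtain ⟨J, hJ⟩ := exists_annihilationBound (h := h) (k := k) X Y v
  rw [vertexOp_vertexOp_eq_sum hJ M (S := (N + J).toNat) (Int.self_le_toNat _)]
  symm
  refine finsum_eq_sum_of_support_subset _ fun s hs => ?_
  by_contra hs'
  rw [Finset.mem_coe, Finset.mem_range, not_lt] at hs'
  refine hs ?_
  simp only
  rw [normalPair_eq_zero_right hJ _ (by omega), smul_zero]

theorem finite_support_normalPair (X Y : LinField) (M N : ℤ) (v : Fock) :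
    (Function.support fun s : ℤ => normalPair h k X Y (M + s) (N - s) v).Finite := by
  obtain ⟨J, hJ⟩ := exists_annihilationBound (h := h) (k := k) X Y v
  refine (Set.finite_Icc (-M - J) (N + J)).subset fun s hs => ?_
  by_contra hs'
  rw [Set.mem_Icc, not_and_or, not_le, not_le] at hs'
  refine hs ?_
  simp only
  rcases hs' with h1 | h1
  · rw [normalPair_eq_zero_left hJ (by omega)]
  · rw [normalPair_eq_zero_right hJ _ (by omega)]

/-! ### Sums and rescalings of exponents -/

theorem osc_add (X Y : LinField) (i : Boson) (n : ℤ) :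
    (X + Y).osc i n = X.osc i n + Y.osc i n := rfl

theorem osc_sub (X Y : LinField) (i : Boson) (n : ℤ) :
    (X - Y).osc i n = X.osc i n - Y.osc i n := rfl

theorem creationExponent_add (X Y : LinField) :
    creationExponent (X + Y) = creationExponent X + creationExponent Y := by
  ext1 n
  rw [map_add, creationExponent, creationExponent, creationExponent, PowerSeries.coeff_mk,
    PowerSeries.coeff_mk, PowerSeries.coeff_mk]
  split_ifs
  · simp
  · simp only [osc_add, add_smul, Finset.sum_add_distrib]

theorem annihilationExponent_add (X Y : LinField) :
    annihilationExponent h k (X + Y) =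
      annihilationExponent h k X + annihilationExponent h k Y := by
  ext1 n
  have : annihilationMode h k (X + Y) n = annihilationMode h k X n + annihilationMode h k Y n := by
    refine MvPolynomial.derivation_ext fun a => ?_
    rw [Derivation.add_apply, annihilationMode_X, annihilationMode_X, annihilationMode_X,
      ← map_add, osc_add]
    split_ifs <;> simp [add_mul]
  rw [map_add, annihilationExponent, annihilationExponent, annihilationExponent,
    PowerSeries.coeff_mk, PowerSeries.coeff_mk, PowerSeries.coeff_mk, this]
  rfl

theorem annihilationCoeff_add (X Y : LinField) (j : ℕ) (v : Fock) :
    annihilationCoeff h k (X + Y) j v = ∑ p ∈ antidiagonal j,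
      annihilationCoeff h k X p.1 (annihilationCoeff h k Y p.2 v) := by
  rw [annihilationCoeff, annihilationExponent_add, psExp_add (coeff_zero_annihilationExponent X)
    (coeff_zero_annihilationExponent Y) (commute_annihilationExponent X X)
    (commute_annihilationExponent Y Y) (commute_annihilationExponent X Y), PowerSeries.coeff_mul,
    LinearMap.sum_apply]
  rfl

theorem creationCoeff_add (X Y : LinField) {A B K : ℤ} (hA : A ≤ 0) (hB : K ≤ B) :
    creationCoeff (X + Y) K =
      ∑ a ∈ Finset.Icc A B, creationCoeff X a * creationCoeff Y (K - a) := by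
  rcases lt_or_ge K 0 with hK | hK
  · rw [creationCoeff_of_neg _ hK]
    symm
    refine Finset.sum_eq_zero fun a _ => ?_
    rcases lt_or_ge a 0 with ha | ha
    · rw [creationCoeff_of_neg X ha, zero_mul]
    · rw [creationCoeff_of_neg Y (by omega), mul_zero]
  lift K to ℕ using hK
  rw [creationCoeff_natCast, creationExponent_add, psExp_add (coeff_zero_creationExponent X)
    (coeff_zero_creationExponent Y) (fun _ _ => Commute.all _ _) (fun _ _ => Commute.all _ _)
    (fun _ _ => Commute.all _ _), PowerSeries.coeff_mul]
  refine Finset.sum_of_injOn (fun p : ℕ × ℕ => (p.1 : ℤ)) ?_ ?_ ?_ ?_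
  · rintro ⟨a, b⟩ hp ⟨a', b'⟩ hp' e
    have h1 := mem_antidiagonal.1 hp
    have h2 := mem_antidiagonal.1 hp'
    simp only at h1 h2 e
    ext <;> simp only <;> omega
  · intro p hp
    have := mem_antidiagonal.1 hp
    rw [Finset.mem_coe, Finset.mem_Icc]
    constructor <;> simp only <;> omega
  · intro a _ ha
    rcases lt_or_ge a 0 with ha0 | ha0
    · rw [creationCoeff_of_neg X ha0, zero_mul]
    rcases lt_or_ge (K - a) 0 with hb0 | hb0
    · rw [creationCoeff_of_neg Y hb0, mul_zero]
    refine absurd ⟨(a.toNat, (K - a).toNat), ?_, ?_⟩ ha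
    · rw [Finset.mem_coe, mem_antidiagonal]; omega
    · exact Int.toNat_of_nonneg ha0
  · intro p hp
    have := mem_antidiagonal.1 hp
    rw [creationCoeff_natCast, show (K : ℤ) - p.1 = p.2 by omega, creationCoeff_natCast]

/-- Normal ordered products at the same point: setting `w = z` in `:exp (X(z) + Y(w)):`. -/
theorem vertexOp_add (X Y : LinField) (L : ℤ) (v : Fock) :
    vertexOp h k (X + Y) L v = ∑ᶠ s : ℤ, normalPair h k X Y s (L - s) v := by
  obtain ⟨J, hJ⟩ := exists_annihilationBound (h := h) (k := k) X Y v
  have hF : ∀ t l, J ≤ t ∨ J ≤ l →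
      creationCoeff (X + Y) (L + (t + l : ℕ)) *
        annihilationCoeff h k X t (annihilationCoeff h k Y l v) = 0 := by
    rintro t l (h1 | h1)
    · rw [hJ.left _ _ h1, mul_zero]
    · rw [hJ.right _ h1, map_zero, mul_zero]
  have e1 : vertexOp h k (X + Y) L v = ∑ t ∈ Finset.range J, ∑ l ∈ Finset.range J,
      creationCoeff (X + Y) (L + (t + l : ℕ)) *
        annihilationCoeff h k X t (annihilationCoeff h k Y l v) := by
    rw [← sum_range_antidiagonal (fun p : ℕ × ℕ => creationCoeff (X + Y) (L + (p.1 + p.2 : ℕ)) *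
        annihilationCoeff h k X p.1 (annihilationCoeff h k Y p.2 v)) hF,
      vertexOp_eq_sum (J := J + J)]
    · refine Finset.sum_congr rfl fun j _ => ?_
      rw [annihilationCoeff_add, Finset.mul_sum]
      refine Finset.sum_congr rfl fun p hp => ?_
      rw [mem_antidiagonal.1 hp]
    · intro j hj
      rw [annihilationCoeff_add]
      refine Finset.sum_eq_zero fun p hp => ?_
      have := mem_antidiagonal.1 hp
      rcases le_or_gt J p.1 with h1 | h1
      · rw [hJ.left _ _ h1]
      · rw [hJ.right _ (by omega), map_zero]
  have e2 : ∑ᶠ s : ℤ, normalPair h k X Y s (L - s) v =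
      ∑ s ∈ Finset.Icc (-(J : ℤ)) (L + J), normalPair h k X Y s (L - s) v := by
    refine finsum_eq_sum_of_support_subset _ fun s hs => ?_
    by_contra hs'
    rw [Finset.mem_coe, Finset.mem_Icc, not_and_or, not_le, not_le] at hs'
    refine hs ?_
    simp only
    rcases hs' with h1 | h1
    · rw [normalPair_eq_zero_left hJ (by omega)]
    · rw [normalPair_eq_zero_right hJ _ (by omega)]
  rw [e1, e2, Finset.sum_congr rfl fun s _ => normalPair_eq_sum hJ s (L - s), Finset.sum_comm,
    Finset.sum_comm (s := Finset.Icc (-(J : ℤ)) (L + J))]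
  refine Finset.sum_congr rfl fun l hl => ?_
  rw [Finset.sum_comm]
  refine Finset.sum_congr rfl fun t ht => ?_
  have hl := Finset.mem_range.1 hl
  have ht := Finset.mem_range.1 ht
  rw [← Finset.sum_mul, creationCoeff_add X Y (A := -(J : ℤ) + t) (B := L + J + t) (by omega)
    (by push_cast; omega)]
  congr 1
  rw [← Finset.map_add_right_Icc, Finset.sum_map]
  refine Finset.sum_congr rfl fun s _ => ?_
  rw [addRightEmbedding_apply]
  congr 2
  push_cast; ring

/-- Fields without contraction multiply to their normal ordered product. -/
theorem finsum_vertexOp_vertexOp {X Y : LinField} (hXY : contraction h k X Y = 0) (L : ℤ)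
    (v : Fock) :
    ∑ᶠ s : ℤ, vertexOp h k X s (vertexOp h k Y (L - s) v) = vertexOp h k (X + Y) L v := by
  rw [vertexOp_add]
  refine finsum_congr fun s => ?_
  rw [vertexOp_vertexOp, hXY, psExp_zero, finsum_eq_single _ 0]
  · simp
  · intro n hn
    rw [PowerSeries.coeff_one, if_neg hn, zero_smul]

theorem qpow_add (x y : ℂ) : qpow h (x + y) = qpow h x * qpow h y := by
  rw [qpow, add_mul, Complex.exp_add]; rfl

theorem qpow_zero : qpow h 0 = 1 := by simp [qpow]

theorem qpow_ne_zero (x : ℂ) : qpow h x ≠ 0 := Complex.exp_ne_zero _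

theorem qpow_mul_natCast (x : ℂ) (n : ℕ) : qpow h (x * n) = qpow h x ^ n := by
  rw [qpow, qpow, ← Complex.exp_nat_mul]; congr 1; ring

theorem qpow_mul_intCast (x : ℂ) (n : ℤ) : qpow h (x * n) = qpow h x ^ n := by
  rw [qpow, qpow, ← Complex.exp_int_mul]; congr 1; ring

theorem qpow_neg (x : ℂ) : qpow h (-x) = (qpow h x)⁻¹ := by
  rw [qpow, qpow, ← Complex.exp_neg, neg_mul]

theorem creationCoeff_scale (s : ℂ) (X : LinField) (m : ℤ) :
    creationCoeff (X.scale h s) m = qpow h (s * m) • creationCoeff X m := by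
  rcases lt_or_ge m 0 with hm | hm
  · rw [creationCoeff_of_neg _ hm, creationCoeff_of_neg _ hm, smul_zero]
  lift m to ℕ using hm
  rw [creationCoeff_natCast, creationCoeff_natCast, Int.cast_natCast, qpow_mul_natCast,
    ← coeff_psExp_smul_pow (coeff_zero_creationExponent X) fun _ _ => Commute.all _ _]
  congr 2
  ext1 n
  rw [PowerSeries.coeff_mk, creationExponent, creationExponent, PowerSeries.coeff_mk,
    PowerSeries.coeff_mk, ← qpow_mul_natCast]
  split_ifs
  · rw [smul_zero]
  · rw [Finset.smul_sum]
    refine Finset.sum_congr rfl fun i _ => ?_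
    rw [smul_smul, LinField.scale]
    simp only
    rw [mul_comm]
    congr 3
    push_cast; ring

theorem annihilationCoeff_scale (s : ℂ) (X : LinField) (j : ℕ) :
    annihilationCoeff h k (X.scale h s) j = qpow h (-s * j) • annihilationCoeff h k X j := by
  rw [qpow_mul_natCast, annihilationCoeff, annihilationCoeff,
    ← coeff_psExp_smul_pow (coeff_zero_annihilationExponent X) (commute_annihilationExponent X X)]
  congr 2
  ext1 n
  rw [PowerSeries.coeff_mk, annihilationExponent, annihilationExponent, PowerSeries.coeff_mk,
    PowerSeries.coeff_mk, ← qpow_mul_natCast]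
  have : annihilationMode h k (X.scale h s) n = qpow h (-s * n) • annihilationMode h k X n := by
    refine MvPolynomial.derivation_ext fun a => ?_
    rw [Derivation.smul_apply, annihilationMode_X, annihilationMode_X, LinField.scale,
      MvPolynomial.smul_eq_C_mul, ← map_mul]
    split_ifs
    · simp only
      congr 1
      rw [show -s * (n : ℂ) = -(s * ((n : ℤ) : ℂ)) by push_cast; ring]
      ring
    · simp
  rw [this]; rfl

theorem qpow_add_mul_qpow_neg_mul (s : ℂ) (N : ℤ) (j : ℕ) :
    qpow h (s * (N + j : ℤ)) * qpow h (-s * j) = qpow h (s * N) := by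
  rw [← qpow_add]; congr 1; push_cast; ring

theorem vertexOp_scale (s : ℂ) (X : LinField) (N : ℤ) (v : Fock) :
    vertexOp h k (X.scale h s) N v = qpow h (s * N) • vertexOp h k X N v := by
  change finsum _ = _ • finsum _
  rw [smul_finsum]
  refine finsum_congr fun j => ?_
  rw [creationCoeff_scale, annihilationCoeff_scale, LinearMap.smul_apply, smul_mul_smul_comm,
    qpow_add_mul_qpow_neg_mul]

theorem normalPair_scale_right (s : ℂ) (X Y : LinField) (M N : ℤ) (v : Fock) :
    normalPair h k X (Y.scale h s) M N v = qpow h (s * N) • normalPair h k X Y M N v := by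
  rw [normalPair, normalPair, smul_finsum]
  refine finsum_congr fun p => ?_
  rw [creationCoeff_scale, annihilationCoeff_scale, LinearMap.smul_apply, map_smul, mul_smul_comm,
    mul_smul_comm, smul_mul_assoc, smul_smul, mul_comm (qpow h _), qpow_add_mul_qpow_neg_mul]

theorem creationExponent_congr {X Y : LinField}
    (hXY : ∀ (i : Boson) (n : ℕ), n ≠ 0 → X.osc i (-(n : ℤ)) = Y.osc i (-(n : ℤ))) :
    creationExponent X = creationExponent Y := by
  ext1 n
  rw [creationExponent, creationExponent, PowerSeries.coeff_mk, PowerSeries.coeff_mk]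
  split_ifs with hn
  · rfl
  · exact Finset.sum_congr rfl fun i _ => by rw [hXY i n hn]

theorem annihilationExponent_congr {X Y : LinField}
    (hXY : ∀ (i : Boson) (n : ℕ), n ≠ 0 → X.osc i n = Y.osc i n) :
    annihilationExponent h k X = annihilationExponent h k Y := by
  ext1 n
  have : annihilationMode h k X n = annihilationMode h k Y n := by
    refine MvPolynomial.derivation_ext fun a => ?_
    rw [annihilationMode_X, annihilationMode_X]
    split_ifs with ha
    · rw [hXY _ _ (ha ▸ a.2.ne_zero)]
    · rfl
  rw [annihilationExponent, annihilationExponent, PowerSeries.coeff_mk, PowerSeries.coeff_mk, this]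

/-- Vertex operators only depend on the nonzero modes. -/
theorem vertexOp_congr {X Y : LinField}
    (hc : ∀ (i : Boson) (n : ℕ), n ≠ 0 → X.osc i (-(n : ℤ)) = Y.osc i (-(n : ℤ)))
    (ha : ∀ (i : Boson) (n : ℕ), n ≠ 0 → X.osc i n = Y.osc i n) (N : ℤ) :
    vertexOp h k X N = vertexOp h k Y N := by
  refine LinearMap.ext fun v => ?_
  change finsum _ = finsum _
  refine finsum_congr fun j => ?_
  rw [creationCoeff, creationCoeff, creationExponent_congr hc, annihilationCoeff,
    annihilationCoeff, annihilationExponent_congr ha]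

end

open Finset.HasAntidiagonal (antidiagonal mem_antidiagonal)

/-! ### Normal ordered exponentials as vertex operators -/

section

variable {h : ℂ} {k : ℝ}

theorem sum_boson {M : Type*} [AddCommMonoid M] (f : Boson → M) :
    ∑ i : Boson, f i = f .a + f .b + f .c := by
  have : (Finset.univ : Finset Boson) = {.a, .b, .c} := rfl
  rw [this, Finset.sum_insert (by decide), Finset.sum_insert (by decide), Finset.sum_singleton,
    add_assoc]

/-- The action of operators of a single Fock space on the total Fock space, label by label. -/
def onEachFock : Module.End ℂ Fock →ₐ[ℂ] Module.End ℂ TotalFock where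
  toFun T := Finsupp.mapRange.linearMap T
  map_one' := Finsupp.mapRange.linearMap_id
  map_mul' S T := Finsupp.mapRange.linearMap_comp S T
  map_zero' := by ext; simp
  map_add' S T := by ext; simp
  commutes' c := by ext; simp [Algebra.algebraMap_eq_smul_one]

theorem onEachFock_single (T : Module.End ℂ Fock) (χ : Charge) (v : Fock) :
    onEachFock T (Finsupp.single χ v) = Finsupp.single χ (T v) := by
  simp [onEachFock]

theorem creation_single (X : LinField) (m : ℤ) (χ : Charge) (u : Fock) :
    creation h k X m (Finsupp.single χ u) = Finsupp.single χ (creationCoeff X m * u) := by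
  rw [creation]
  split_ifs with hm
  · have : (PowerSeries.mk fun n : ℕ => if n = 0 then 0 else
        ∑ i : Boson, X.osc i (-(n : ℤ)) • mode h k i (-(n : ℤ))) =
        PowerSeries.map ((onEachFock.comp (Algebra.lmul ℂ Fock) :
          Fock →ₐ[ℂ] Module.End ℂ TotalFock) : Fock →+* Module.End ℂ TotalFock)
          (creationExponent X) := by
      ext1 n
      rw [PowerSeries.coeff_mk, PowerSeries.coeff_map, creationExponent, PowerSeries.coeff_mk]
      split_ifs with hn
      · simp
      · rw [map_sum]
        refine Finset.sum_congr rfl fun i _ => ?_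
        rw [RingHom.coe_coe, map_smul, mode, if_pos (by omega), Int.natAbs_neg, Int.natAbs_natCast]
        rfl
    rw [this, map_psExp, PowerSeries.coeff_map, creationCoeff, if_pos hm]
    exact onEachFock_single _ _ _
  · rw [creationCoeff, if_neg hm, zero_mul, Finsupp.single_zero]

theorem annihilation_single (X : LinField) (m : ℤ) (χ : Charge) (u : Fock) :
    annihilation h k X m (Finsupp.single χ u) =
      if m ≤ 0 then Finsupp.single χ (annihilationCoeff h k X (-m).toNat u) else 0 := by
  rw [annihilation]
  split_ifs with hm
  · have : (PowerSeries.mk fun n : ℕ => if n = 0 then 0 else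
        ∑ i : Boson, X.osc i (n : ℤ) • mode h k i (n : ℤ)) =
        PowerSeries.map (onEachFock : Module.End ℂ Fock →+* Module.End ℂ TotalFock)
          (annihilationExponent h k X) := by
      ext1 n
      rw [PowerSeries.coeff_mk, PowerSeries.coeff_map]
      split_ifs with hn
      · rw [hn, coeff_zero_annihilationExponent, map_zero]
      · have e : annihilationMode h k X n = X.osc .a n • bracket h k .a n •
              MvPolynomial.pderiv (R := ℂ) (Boson.a, n.toPNat') +
            X.osc .b n • bracket h k .b n • MvPolynomial.pderiv (R := ℂ) (Boson.b, n.toPNat') +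
            X.osc .c n • bracket h k .c n •
              MvPolynomial.pderiv (R := ℂ) (Boson.c, n.toPNat') := by
          refine MvPolynomial.derivation_ext fun a => ?_
          obtain ⟨i, m⟩ := a
          rw [annihilationMode_X]
          simp only [Derivation.add_apply, Derivation.smul_apply, MvPolynomial.pderiv_X,
            Pi.single_apply, Prod.mk.injEq]
          have hmn : m = n.toPNat' ↔ (m : ℕ) = n := by
            rw [← PNat.coe_inj, Nat.toPNat'_coe, if_pos (Nat.pos_of_ne_zero hn)]
          simp only [hmn]
          cases i <;> by_cases hm : (m : ℕ) = n <;>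
            simp [hm, MvPolynomial.smul_eq_C_mul]
        have hmode : ∀ i, mode h k i (n : ℤ) = onEachFock (bracket h k i n •
            (MvPolynomial.pderiv (R := ℂ) (i, n.toPNat')).toLinearMap) := by
          intro i
          rw [mode, if_neg (by omega), if_neg (by omega), Int.natAbs_natCast, map_smul]
          rfl
        rw [annihilationExponent, PowerSeries.coeff_mk, e, sum_boson, hmode, hmode, hmode,
          RingHom.coe_coe, ← map_smul, ← map_smul, ← map_smul, ← map_add, ← map_add]
        rfl
    rw [this, map_psExp, PowerSeries.coeff_map]
    exact onEachFock_single _ _ _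
  · rfl

theorem zeroMode_single {X : LinField} {χ : Charge} {e : ℤ}
    (he : ∑ i : Boson, X.pLog i * χ.p i = e) (m : ℤ) (u : Fock) :
    zeroMode k X m (Finsupp.single χ u) = if m = e then
      Complex.exp (∑ i : Boson, X.pConst i * χ.p i) • Finsupp.single (χ.shift k X.q) u else 0 := by
  rw [zeroMode, Finsupp.lsum_single, he]
  by_cases hm : m = e
  · rw [if_pos hm, if_pos (by rw [hm])]; rfl
  · rw [if_neg hm, if_neg (by exact_mod_cast Ne.symm hm)]; rfl

theorem creation_zero (X : LinField) (m : ℤ) : creation h k X m 0 = 0 := by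
  rw [creation]; split_ifs <;> simp

theorem zeroMode_zero (X : LinField) (m : ℤ) : zeroMode k X m 0 = 0 := map_zero _

/-- The normal ordered exponential on the Fock space of label `χ`, when the exponent of `z` is the
integer `e` there. -/
theorem normalExp_single {X : LinField} {χ : Charge} {e : ℤ}
    (he : ∑ i : Boson, X.pLog i * χ.p i = e) (m : ℤ) (v : Fock) :
    normalExp h k X m (Finsupp.single χ v) = Finsupp.single (χ.shift k X.q)
      (Complex.exp (∑ i : Boson, X.pConst i * χ.p i) • vertexOp h k X (m - e) v) := by
  set c := Complex.exp (∑ i : Boson, X.pConst i * χ.p i)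
  have h1 : ∀ m, fmul (zeroMode k X) (annihilation h k X) m (Finsupp.single χ v) =
      if m ≤ e then
        Finsupp.single (χ.shift k X.q) (c • annihilationCoeff h k X (e - m).toNat v) else 0 := by
    intro m
    rw [fmul, finsum_eq_single _ e]
    · rw [annihilation_single]
      by_cases hm : m ≤ e
      · rw [if_pos hm, if_pos (by omega), zeroMode_single he, if_pos rfl, Finsupp.smul_single,
          neg_sub]
      · rw [if_neg hm, if_neg (by omega), zeroMode_zero]
    · intro i hi
      rw [annihilation_single]
      split_ifs
      · rw [zeroMode_single he, if_neg hi]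
      · exact zeroMode_zero _ _
  obtain ⟨J, hJ⟩ := eventually_annihilationCoeff_eq_zero (h := h) (k := k) X v
  rw [normalExp, fmul]
  simp only [h1]
  have h2 : ∀ i : ℤ, creation h k X i (if m - i ≤ e then Finsupp.single (χ.shift k X.q)
      (c • annihilationCoeff h k X (e - (m - i)).toNat v) else 0) =
      if m - i ≤ e then Finsupp.single (χ.shift k X.q)
        (c • (creationCoeff X i * annihilationCoeff h k X (e - (m - i)).toNat v)) else 0 := by
    intro i
    split_ifs
    · rw [creation_single, mul_smul_comm]
    · exact creation_zero _ _
  simp only [h2]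
  rw [vertexOp_eq_sum hJ, Finset.smul_sum, ← Finsupp.singleAddHom_apply, map_sum,
    finsum_eq_sum_of_support_subset (s := (Finset.range J).map
      (Nat.castEmbedding.trans (addLeftEmbedding (m - e)))), Finset.sum_map]
  · refine Finset.sum_congr rfl fun j _ => ?_
    simp only [Function.Embedding.trans_apply, Nat.castEmbedding_apply, addLeftEmbedding_apply]
    rw [if_pos (by omega), show (e - (m - (m - e + j))).toNat = j by omega]
    rfl
  · intro i hi
    by_contra hi'
    refine hi ?_
    simp only
    split_ifs with h3
    · rw [hJ, mul_zero, smul_zero, Finsupp.single_zero]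
      by_contra hlt
      refine hi' ?_
      rw [Finset.mem_coe, Finset.mem_map]
      refine ⟨(e - (m - i)).toNat, Finset.mem_range.2 (by omega), ?_⟩
      simp only [Function.Embedding.trans_apply, Nat.castEmbedding_apply, addLeftEmbedding_apply]
      omega
    · rfl

/-! ### Fields that act through vertex operators -/

/-- On the Fock space of label `χ`, the field `A` is the vertex operator of `X` times the constant
`c`, with target label `χ'` and with the powers of `z` shifted by `e`. -/
def ActsAs (h : ℂ) (k : ℝ) (A : FormalField) (χ χ' : Charge) (c : ℂ) (X : LinField) (e : ℤ) :
    Prop :=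
  ∀ (m : ℤ) (v : Fock),
    A m (Finsupp.single χ v) = Finsupp.single χ' (c • vertexOp h k X (m - e) v)

theorem actsAs_normalExp {X : LinField} {χ : Charge} {e : ℤ}
    (he : ∑ i : Boson, X.pLog i * χ.p i = e) :
    ActsAs h k (normalExp h k X) χ (χ.shift k X.q)
      (Complex.exp (∑ i : Boson, X.pConst i * χ.p i)) X e :=
  normalExp_single he

theorem finite_support_vertexOp_vertexOp {X Y : LinField} (hXY : contraction h k X Y = 0)
    (M L : ℤ) (v : Fock) : (Function.support fun s : ℤ =>
      vertexOp h k X (M + s) (vertexOp h k Y (L - s) v)).Finite := by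
  refine (finite_support_normalPair (h := h) (k := k) X Y M L v).subset fun s hs hs' => hs ?_
  simp only
  rw [vertexOp_vertexOp, hXY, psExp_zero, finsum_eq_single _ 0]
  · simpa using hs'
  · intro n hn
    rw [PowerSeries.coeff_one, if_neg hn, zero_smul]

/-- Products at the same point of fields without contraction. -/
theorem ActsAs.fmul {A B : FormalField} {χ χ' χ'' : Charge} {a b : ℂ} {X Y : LinField} {e e' : ℤ}
    (hA : ActsAs h k A χ' χ'' a X e) (hB : ActsAs h k B χ χ' b Y e')
    (hXY : contraction h k X Y = 0) :
    ActsAs h k (fmul A B) χ χ'' (a * b) (X + Y) (e + e') := by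
  intro m v
  rw [EllipticCurrents.fmul]
  have h1 : ∀ i : ℤ, A i (B (m - i) (Finsupp.single χ v)) = Finsupp.singleAddHom χ''
      ((a * b) • vertexOp h k X (-e + i) (vertexOp h k Y (m - e' - i) v)) := by
    intro i
    rw [hB, hA, map_smul, smul_smul, Finsupp.singleAddHom_apply, neg_add_eq_sub,
      sub_right_comm m]
  have hfin := finite_support_vertexOp_vertexOp hXY (-e) (m - e') v
  rw [finsum_congr h1, ← AddMonoidHom.map_finsum, ← smul_finsum]
  · rw [Finsupp.singleAddHom_apply, ← finsum_vertexOp_vertexOp hXY]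
    congr 2
    refine Eq.trans (finsum_comp_equiv (Equiv.addLeft e)).symm (finsum_congr fun s => ?_)
    simp only [Equiv.coe_addLeft]
    rw [neg_add_cancel_left, show m - e' - (e + s) = m - (e + e') - s by ring]
  · exact hfin.subset fun s hs hs' => hs (by
      simp only at hs' ⊢
      rw [hs', smul_zero])

theorem ActsAs.congr {A : FormalField} {χ χ' : Charge} {c : ℂ} {X Y : LinField} {e : ℤ}
    (hA : ActsAs h k A χ χ' c X e)
    (hc : ∀ (i : Boson) (n : ℕ), n ≠ 0 → X.osc i (-(n : ℤ)) = Y.osc i (-(n : ℤ)))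
    (ha : ∀ (i : Boson) (n : ℕ), n ≠ 0 → X.osc i n = Y.osc i n) :
    ActsAs h k A χ χ' c Y e := by
  intro m v
  rw [hA, vertexOp_congr hc ha]

theorem ActsAs.fscale {A : FormalField} {χ χ' : Charge} {c : ℂ} {X : LinField} {e : ℤ}
    (hA : ActsAs h k A χ χ' c X e) (s : ℂ) :
    ActsAs h k (fscale h s A) χ χ' (qpow h (s * e) * c) (X.scale h s) e := by
  intro m v
  rw [EllipticCurrents.fscale, hA, vertexOp_scale, Finsupp.smul_single, smul_smul, smul_smul]
  congr 2
  rw [mul_right_comm, ← qpow_add, ← mul_add, ← Int.cast_add, add_sub_cancel, mul_comm]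

/-! ### Vanishing of matrix coefficients -/

/-- The degree of a monomial, where the mode `i_{-n}` has degree `n`. -/
def monomialDegree (μ : (Boson × ℕ+) →₀ ℕ) : ℕ :=
  Finsupp.weight (fun a : Boson × ℕ+ => (a.2 : ℕ)) μ

theorem isWeightedHomogeneous_creationCoeff (X : LinField) (m : ℕ) :
    (creationCoeff X m).IsWeightedHomogeneous (fun a : Boson × ℕ+ => (a.2 : ℕ)) m := by
  have hX : ∀ n, (PowerSeries.coeff n (creationExponent X)).IsWeightedHomogeneous
      (fun a : Boson × ℕ+ => (a.2 : ℕ)) n := by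
    intro n
    rw [creationExponent, PowerSeries.coeff_mk]
    split_ifs with hn
    · exact MvPolynomial.isWeightedHomogeneous_zero _ _ _
    · refine MvPolynomial.IsWeightedHomogeneous.sum _ _ _ fun i _ => ?_
      rw [MvPolynomial.smul_eq_C_mul]
      refine MvPolynomial.IsWeightedHomogeneous.C_mul ?_ _
      have := MvPolynomial.isWeightedHomogeneous_X ℂ
        (fun a : Boson × ℕ+ => (a.2 : ℕ)) (i, n.toPNat')
      simpa only [Nat.toPNat'_coe, if_pos (Nat.pos_of_ne_zero hn)] using this
  have hpow : ∀ N n, (PowerSeries.coeff n (creationExponent X ^ N)).IsWeightedHomogeneous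
      (fun a : Boson × ℕ+ => (a.2 : ℕ)) n := by
    intro N
    induction N with
    | zero =>
      intro n
      rw [pow_zero, PowerSeries.coeff_one]
      split_ifs with hn
      · rw [hn]; exact MvPolynomial.isWeightedHomogeneous_one _ _
      · exact MvPolynomial.isWeightedHomogeneous_zero _ _ _
    | succ N ih =>
      intro n
      rw [pow_succ, PowerSeries.coeff_mul]
      refine MvPolynomial.IsWeightedHomogeneous.sum _ _ _ fun ij hij => ?_
      have := (ih ij.1).mul (hX ij.2)
      rwa [mem_antidiagonal.1 hij] at this
  rw [creationCoeff_natCast, coeff_psExp]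
  refine MvPolynomial.IsWeightedHomogeneous.sum _ _ _ fun N _ => ?_
  rw [MvPolynomial.smul_eq_C_mul]
  exact (hpow N m).C_mul _

theorem coeff_creationCoeff_mul_eq_zero (X : LinField) {m : ℤ} {μ : (Boson × ℕ+) →₀ ℕ}
    (hm : monomialDegree μ < m) (u : Fock) :
    MvPolynomial.coeff μ (creationCoeff X m * u) = 0 := by
  lift m to ℕ using by omega
  rw [MvPolynomial.coeff_mul]
  refine Finset.sum_eq_zero fun ab hab => ?_
  have hab := mem_antidiagonal.1 hab
  rw [(isWeightedHomogeneous_creationCoeff X m).coeff_eq_zero, zero_mul]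
  intro hw
  have : monomialDegree μ = monomialDegree ab.1 + monomialDegree ab.2 := by
    rw [← hab, monomialDegree, map_add]; rfl
  rw [monomialDegree] at this
  change _ = Finsupp.weight _ ab.1 + _ at this
  unfold monomialDegree at hm
  omega

/-- Matrix coefficients of `:exp (X(z) + Y(w)):` are Laurent polynomials in `z` and `w`. -/
theorem finite_support_coeff_normalPair (X Y : LinField) (v : Fock) (μ : (Boson × ℕ+) →₀ ℕ) :
    (Function.support fun p : ℤ × ℤ =>
      MvPolynomial.coeff μ (normalPair h k X Y p.1 p.2 v)).Finite := by
  obtain ⟨J, hJ⟩ := exists_annihilationBound (h := h) (k := k) X Y v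
  refine ((Set.finite_Icc (-J : ℤ) (monomialDegree μ)).prod
    (Set.finite_Icc (-J : ℤ) (monomialDegree μ))).subset fun p hp => ?_
  by_contra hp'
  refine hp ?_
  rw [Set.mem_prod, Set.mem_Icc, Set.mem_Icc] at hp'
  simp only
  by_cases h1 : p.1 + J ≤ 0
  · rw [normalPair_eq_zero_left hJ h1, MvPolynomial.coeff_zero]
  by_cases h2 : p.2 + J ≤ 0
  · rw [normalPair_eq_zero_right hJ _ h2, MvPolynomial.coeff_zero]
  rw [normalPair_eq_sum hJ, MvPolynomial.coeff_sum]
  refine Finset.sum_eq_zero fun l _ => ?_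
  rw [MvPolynomial.coeff_sum]
  refine Finset.sum_eq_zero fun t _ => ?_
  by_cases h3 : (monomialDegree μ : ℤ) < p.1
  · rw [mul_assoc, coeff_creationCoeff_mul_eq_zero X (by omega)]
  · rw [mul_comm (creationCoeff X _), mul_assoc, coeff_creationCoeff_mul_eq_zero Y (by omega)]

end

/-! ### Convergence of exponentials and infinite products -/

open Filter Topology
open Finset.HasAntidiagonal (antidiagonal mem_antidiagonal)

section

/-- Cauchy products of absolutely convergent series. -/
theorem summable_norm_and_tsum_antidiagonal {a b : ℕ → ℂ} (ha : Summable fun n => ‖a n‖)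
    (hb : Summable fun n => ‖b n‖) :
    (Summable fun n => ‖∑ p ∈ antidiagonal n, a p.1 * b p.2‖) ∧
      ∑' n, ‖∑ p ∈ antidiagonal n, a p.1 * b p.2‖ ≤ (∑' n, ‖a n‖) * ∑' n, ‖b n‖ ∧
      ∑' n, ∑ p ∈ antidiagonal n, a p.1 * b p.2 = (∑' n, a n) * ∑' n, b n := by
  have h1 := summable_norm_sum_mul_antidiagonal_of_summable_norm ha hb
  have ha' : Summable fun n => ‖‖a n‖‖ := by simpa only [norm_norm] using ha
  have hb' : Summable fun n => ‖‖b n‖‖ := by simpa only [norm_norm] using hb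
  refine ⟨h1, ?_, (tsum_mul_tsum_eq_tsum_sum_antidiagonal_of_summable_norm ha hb).symm⟩
  rw [tsum_mul_tsum_eq_tsum_sum_antidiagonal_of_summable_norm ha' hb']
  refine Summable.tsum_le_tsum (fun n => ?_) h1
    (summable_norm_sum_mul_antidiagonal_of_summable_norm ha' hb').of_norm
  exact (norm_sum_le _ _).trans_eq (Finset.sum_congr rfl fun p _ => norm_mul _ _)

/-- On the disc of absolute convergence of a power series without constant term, its formal
exponential sums to the exponential of its sum. -/
theorem hasSum_psExp {γ : PowerSeries ℂ} (h0 : PowerSeries.coeff 0 γ = 0) {x S : ℂ}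
    (hs : Summable fun n => ‖PowerSeries.coeff n γ * x ^ n‖)
    (hS : HasSum (fun n => PowerSeries.coeff n γ * x ^ n) S) :
    HasSum (fun n => PowerSeries.coeff n (psExp γ) * x ^ n) (Complex.exp S) := by
  set B := ∑' n, ‖PowerSeries.coeff n γ * x ^ n‖ with hB
  have hpow : ∀ N, Summable (fun n => ‖PowerSeries.coeff n (γ ^ N) * x ^ n‖) ∧
      ∑' n, ‖PowerSeries.coeff n (γ ^ N) * x ^ n‖ ≤ B ^ N ∧
      ∑' n, PowerSeries.coeff n (γ ^ N) * x ^ n = S ^ N := by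
    intro N
    induction N with
    | zero =>
      have h1 : ∀ n, n ≠ 0 → PowerSeries.coeff n (γ ^ 0) * x ^ n = 0 := by
        intro n hn
        rw [pow_zero, PowerSeries.coeff_one, if_neg hn, zero_mul]
      refine ⟨?_, ?_, ?_⟩
      · refine summable_of_ne_finset_zero (s := {0}) fun n hn => ?_
        rw [h1 n (by simpa using hn), norm_zero]
      · rw [tsum_eq_single 0 fun n hn => by rw [h1 n hn, norm_zero]]; simp
      · rw [tsum_eq_single 0 h1]; simp
    | succ N ih =>
      obtain ⟨ih1, ih2, ih3⟩ := ih
      have e : ∀ n, PowerSeries.coeff n (γ ^ (N + 1)) * x ^ n = ∑ p ∈ antidiagonal n,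
          (PowerSeries.coeff p.1 (γ ^ N) * x ^ p.1) * (PowerSeries.coeff p.2 γ * x ^ p.2) := by
        intro n
        rw [pow_succ, PowerSeries.coeff_mul, Finset.sum_mul]
        refine Finset.sum_congr rfl fun p hp => ?_
        rw [← mem_antidiagonal.1 hp, pow_add]; ring
      obtain ⟨h1, h2, h3⟩ := summable_norm_and_tsum_antidiagonal ih1 hs
      simp only [e]
      refine ⟨h1, h2.trans ?_, by rw [h3, ih3, hS.tsum_eq, pow_succ]⟩
      rw [pow_succ]
      exact mul_le_mul_of_nonneg_right ih2 (tsum_nonneg fun _ => norm_nonneg _)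
  set F : ℕ × ℕ → ℂ := fun p =>
    (p.1.factorial : ℂ)⁻¹ * (PowerSeries.coeff p.2 (γ ^ p.1) * x ^ p.2) with hF
  have hFs : Summable F := by
    refine Summable.of_norm ?_
    rw [summable_prod_of_nonneg fun _ => norm_nonneg _]
    simp only [hF, norm_mul (_⁻¹ : ℂ), tsum_mul_left]
    refine ⟨fun N => (hpow N).1.mul_left _, ?_⟩
    refine Summable.of_nonneg_of_le (fun N => mul_nonneg (norm_nonneg _)
      (tsum_nonneg fun _ => norm_nonneg _)) (fun N => ?_) (Real.summable_pow_div_factorial B)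
    rw [norm_inv, Complex.norm_natCast, div_eq_inv_mul]
    exact mul_le_mul_of_nonneg_left (hpow N).2.1 (by positivity)
  have hT : HasSum F (Complex.exp S) := by
    have h1 := hFs.hasSum
    have hrow : ∀ N, HasSum (fun n => F (N, n)) ((N.factorial : ℂ)⁻¹ * S ^ N) := by
      intro N
      have h5 : Summable fun n => PowerSeries.coeff n (γ ^ N) * x ^ n := (hpow N).1.of_norm
      have h6 := h5.hasSum
      rw [(hpow N).2.2] at h6
      exact h6.mul_left (N.factorial : ℂ)⁻¹
    have h2 := h1.prod_fiberwise hrow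
    have h3 : HasSum (fun N => (N.factorial : ℂ)⁻¹ * S ^ N) (Complex.exp S) := by
      have := NormedSpace.exp_series_hasSum_exp' (𝕂 := ℂ) S
      rw [← Complex.exp_eq_exp_ℂ] at this
      simpa only [smul_eq_mul] using this
    rw [← h2.unique h3]
    exact h1
  have hsw := (Equiv.prodComm ℕ ℕ).hasSum_iff.2 hT
  refine hsw.prod_fiberwise fun n => ?_
  have : PowerSeries.coeff n (psExp γ) * x ^ n =
      ∑ N ∈ Finset.range (n + 1), (F ∘ Equiv.prodComm ℕ ℕ) (n, N) := by
    rw [coeff_psExp, Finset.sum_mul]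
    exact Finset.sum_congr rfl fun N _ => by simp [F, mul_assoc]
  rw [this]
  refine hasSum_sum_of_ne_finset_zero fun N hN => ?_
  rw [Finset.mem_range, not_lt] at hN
  simp only [F, Function.comp_apply, Equiv.prodComm_apply, Prod.swap_prod_mk]
  rw [coeff_pow_of_lt h0 _ _ (by omega), zero_mul, mul_zero]

theorem summable_mul_pow (z : ℂ) {t : ℂ} (ht : ‖t‖ < 1) : Summable fun n : ℕ => ‖-(z * t ^ n)‖ := by
  simp only [norm_neg, norm_mul, norm_pow]
  exact (summable_geometric_of_lt_one (norm_nonneg _) ht).mul_left _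

theorem multipliable_qPoch (z : ℂ) {t : ℂ} (ht : ‖t‖ < 1) :
    Multipliable fun n : ℕ => 1 - z * t ^ n := by
  simp only [sub_eq_add_neg]
  exact multipliable_one_add_of_summable (summable_mul_pow z ht)

theorem qPoch_eq_mul (z : ℂ) {t : ℂ} (ht : ‖t‖ < 1) :
    qPoch z t = (1 - z) * qPoch (z * t) t := by
  have h1 : (fun n : ℕ => 1 - z * t ^ (n + 1)) = fun n : ℕ => 1 - z * t * t ^ n := by
    ext n; rw [pow_succ']; ring
  rw [qPoch, tprod_eq_zero_mul', h1, pow_zero, mul_one]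
  · rfl
  · rw [h1]; exact multipliable_qPoch _ ht

theorem qPoch_ne_zero {z t : ℂ} (ht : ‖t‖ < 1) (hz : ∀ n : ℕ, 1 - z * t ^ n ≠ 0) :
    qPoch z t ≠ 0 := by
  rw [qPoch]
  simp only [sub_eq_add_neg]
  exact tprod_one_add_ne_zero_of_summable (fun n => by rw [← sub_eq_add_neg]; exact hz n)
    (summable_mul_pow z ht)

theorem qPoch_zero_left (t : ℂ) : qPoch 0 t = 1 := by simp [qPoch]

theorem qPoch_zero_right (z : ℂ) : qPoch z 0 = 1 - z := by
  rw [qPoch_eq_mul z (by simp), mul_zero, qPoch_zero_left, mul_one]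

theorem differentiable_qPoch {t : ℂ} (ht : ‖t‖ < 1) : Differentiable ℂ fun z => qPoch z t := by
  intro z
  have hU : IsOpen (Metric.ball (0 : ℂ) (‖z‖ + 1)) := Metric.isOpen_ball
  have h1 : HasProdLocallyUniformlyOn (fun (n : ℕ) z => 1 + -(z * t ^ n))
      (fun z => ∏' n : ℕ, (1 + -(z * t ^ n))) (Metric.ball (0 : ℂ) (‖z‖ + 1)) := by
    refine Summable.hasProdLocallyUniformlyOn_nat_one_add hU
      (u := fun n => (‖z‖ + 1) * ‖t‖ ^ n)
      ((summable_geometric_of_lt_one (norm_nonneg _) ht).mul_left _) ?_ fun n => by fun_prop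
    refine Eventually.of_forall fun n y hy => ?_
    rw [norm_neg, norm_mul, norm_pow]
    rw [Metric.mem_ball, dist_zero_right] at hy
    exact mul_le_mul_of_nonneg_right hy.le (by positivity)
  have h2 := h1.differentiableOn (.of_forall fun s => by
    simpa [Finset.prod_fn] using DifferentiableOn.finsetProd (fun _ _ ↦ by fun_prop)) hU
  have h3 : (fun z => ∏' n : ℕ, (1 + -(z * t ^ n))) = fun z => qPoch z t := by
    ext z; simp only [qPoch, sub_eq_add_neg]
  rw [h3] at h2
  exact h2.differentiableAt (hU.mem_nhds (by simp))

/-- `(z; t)_∞ = exp (-∑_{n > 0} z ^ n / (n (1 - t ^ n)))` on the unit disc. -/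
theorem exists_hasSum_log_qPoch {z t : ℂ} (hz : ‖z‖ < 1) (ht : ‖t‖ < 1) :
    ∃ L, HasSum (fun n : ℕ => z ^ n / (n * (1 - t ^ n))) L ∧
      (Summable fun n : ℕ => ‖z ^ n / (n * (1 - t ^ n))‖) ∧ Complex.exp (-L) = qPoch z t := by
  set F : ℕ × ℕ → ℂ := fun p => (z * t ^ p.2) ^ p.1 / p.1 with hF
  have hle : ∀ p : ℕ × ℕ, ‖F p‖ ≤ ‖z‖ ^ p.1 * ‖t‖ ^ p.2 := by
    rintro ⟨n, m⟩
    rcases Nat.eq_zero_or_pos n with rfl | hn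
    · simp only [F, Nat.cast_zero, div_zero, norm_zero]; positivity
    · simp only [F, norm_div, norm_pow, norm_mul, Complex.norm_natCast, mul_pow]
      have h1 : (1 : ℝ) ≤ n := by exact_mod_cast hn
      refine (div_le_self (by positivity) h1).trans ?_
      refine mul_le_mul_of_nonneg_left ?_ (by positivity)
      rw [← pow_mul]
      exact pow_le_pow_of_le_one (norm_nonneg _) ht.le (Nat.le_mul_of_pos_right m hn)
  have hs' : Summable fun p => ‖F p‖ :=
    Summable.of_nonneg_of_le (fun _ => norm_nonneg _) hle
      ((summable_geometric_of_lt_one (norm_nonneg _) hz).mul_of_nonneg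
        (summable_geometric_of_lt_one (norm_nonneg _) ht) (fun _ => by positivity)
        (fun _ => by positivity))
  have hs : Summable F := hs'.of_norm
  have hrow : ∀ n : ℕ, HasSum (fun m => F (n, m)) (z ^ n / (n * (1 - t ^ n))) := by
    intro n
    rcases Nat.eq_zero_or_pos n with rfl | hn
    · simp [F, hasSum_zero]
    · have h1 : ‖t ^ n‖ < 1 := by
        rw [norm_pow]; exact pow_lt_one₀ (norm_nonneg _) ht hn.ne'
      have h2 := (hasSum_geometric_of_norm_lt_one h1).mul_left (z ^ n / n)
      have h3 : z ^ n / (n * (1 - t ^ n)) = z ^ n / n * (1 - t ^ n)⁻¹ := by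
        rw [div_mul_eq_div_div, div_eq_mul_inv (z ^ n / n)]
      rw [h3]
      refine h2.congr_fun fun m => ?_
      simp only [F]
      rw [mul_pow, ← pow_mul, ← pow_mul, mul_comm m n]; ring
  have hcol : ∀ m : ℕ, HasSum (fun n => F (n, m)) (-Complex.log (1 - z * t ^ m)) := by
    intro m
    change HasSum (fun n : ℕ => (z * t ^ m) ^ n / (n : ℂ)) _
    refine Complex.hasSum_taylorSeries_neg_log ?_
    rw [norm_mul, norm_pow]
    exact (mul_le_of_le_one_right (norm_nonneg _) (pow_le_one₀ (norm_nonneg _) ht.le)).trans_lt hz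
  refine ⟨∑' p, F p, hs.hasSum.prod_fiberwise hrow, ?_, ?_⟩
  · refine Summable.of_nonneg_of_le (fun _ => norm_nonneg _) (fun n => ?_) hs'.prod
    rw [← (hrow n).tsum_eq]
    exact norm_tsum_le_tsum_norm (hs'.prod_factor n)
  · have h1 := ((Equiv.prodComm ℕ ℕ).hasSum_iff.2 hs.hasSum).prod_fiberwise hcol
    have h2 := h1.neg.cexp
    rw [← h2.tprod_eq, qPoch]
    refine tprod_congr fun m => ?_
    simp only [Function.comp_apply, neg_neg]
    refine Complex.exp_log ?_
    intro h3
    have h4 : ‖z * t ^ m‖ = 1 := by rw [← sub_eq_zero.1 h3, norm_one]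
    rw [norm_mul, norm_pow] at h4
    have := (mul_le_of_le_one_right (norm_nonneg z)
      (pow_le_one₀ (norm_nonneg t) ht.le (n := m))).trans_lt hz
    exact this.ne h4

/-- The formal exponential of `γ` is, near the origin, the Taylor series of the meromorphic function
`P / Q`, where `P` and `Q` are entire. -/
structure ExpSumsTo (γ : PowerSeries ℂ) (P Q : ℂ → ℂ) : Prop where
  differentiable_num : Differentiable ℂ P
  differentiable_den : Differentiable ℂ Q
  den_zero : Q 0 ≠ 0
  eventually : ∀ᶠ x in 𝓝 (0 : ℂ), ∃ s,
    HasSum (fun n => PowerSeries.coeff n (psExp γ) * x ^ n) s ∧ Q x * s = P x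

/-- Every contraction below is a combination of four logarithms of `q`-Pochhammer symbols, with
`qPoch z 0 = 1 - z` for the rational factors and `qPoch 0 t = 1` for the absent ones. -/
theorem expSumsTo_qPoch {γ : PowerSeries ℂ} (h0 : PowerSeries.coeff 0 γ = 0)
    {a₁ a₂ b₁ b₂ s₁ s₂ t₁ t₂ : ℂ} (hs₁ : ‖s₁‖ < 1) (hs₂ : ‖s₂‖ < 1) (ht₁ : ‖t₁‖ < 1)
    (ht₂ : ‖t₂‖ < 1)
    (hγ : ∀ n : ℕ, n ≠ 0 → PowerSeries.coeff n γ = 1 / n * (b₁ ^ n / (1 - t₁ ^ n) +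
      b₂ ^ n / (1 - t₂ ^ n) - a₁ ^ n / (1 - s₁ ^ n) - a₂ ^ n / (1 - s₂ ^ n))) :
    ExpSumsTo γ (fun x => qPoch (a₁ * x) s₁ * qPoch (a₂ * x) s₂)
      (fun x => qPoch (b₁ * x) t₁ * qPoch (b₂ * x) t₂) where
  differentiable_num := ((differentiable_qPoch hs₁).comp (by fun_prop)).mul
    ((differentiable_qPoch hs₂).comp (by fun_prop))
  differentiable_den := ((differentiable_qPoch ht₁).comp (by fun_prop)).mul
    ((differentiable_qPoch ht₂).comp (by fun_prop))
  den_zero := by simp [qPoch_zero_left]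
  eventually := by
    have hsmall : ∀ c : ℂ, ∀ᶠ x in 𝓝 (0 : ℂ), ‖c * x‖ < 1 := by
      intro c
      have : Tendsto (fun x : ℂ => ‖c * x‖) (𝓝 0) (𝓝 ‖c * 0‖) := by
        refine Continuous.tendsto ?_ 0
        fun_prop
      rw [mul_zero, norm_zero] at this
      exact this.eventually_lt_const one_pos
    filter_upwards [hsmall a₁, hsmall a₂, hsmall b₁, hsmall b₂] with x ha₁ ha₂ hb₁ hb₂
    obtain ⟨A₁, hA₁, sA₁, eA₁⟩ := exists_hasSum_log_qPoch ha₁ hs₁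
    obtain ⟨A₂, hA₂, sA₂, eA₂⟩ := exists_hasSum_log_qPoch ha₂ hs₂
    obtain ⟨B₁, hB₁, sB₁, eB₁⟩ := exists_hasSum_log_qPoch hb₁ ht₁
    obtain ⟨B₂, hB₂, sB₂, eB₂⟩ := exists_hasSum_log_qPoch hb₂ ht₂
    have e : ∀ n, PowerSeries.coeff n γ * x ^ n =
        (b₁ * x) ^ n / (n * (1 - t₁ ^ n)) + (b₂ * x) ^ n / (n * (1 - t₂ ^ n)) -
          (a₁ * x) ^ n / (n * (1 - s₁ ^ n)) - (a₂ * x) ^ n / (n * (1 - s₂ ^ n)) := by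
      intro n
      rcases Nat.eq_zero_or_pos n with rfl | hn
      · rw [h0]; simp
      · rw [hγ n hn.ne']
        simp only [mul_pow, div_eq_mul_inv, mul_inv]
        ring
    refine ⟨Complex.exp (B₁ + B₂ - A₁ - A₂), hasSum_psExp h0 ?_ ?_, ?_⟩
    · refine Summable.of_nonneg_of_le (fun _ => norm_nonneg _) (fun n => ?_)
        (((sB₁.add sB₂).add sA₁).add sA₂)
      rw [e]
      exact (norm_sub_le _ _).trans (add_le_add_left ((norm_sub_le _ _).trans
        (add_le_add_left (norm_add_le _ _) _)) _)
    · simp only [e]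
      exact ((hB₁.add hB₂).sub hA₁).sub hA₂
    · rw [← eA₁, ← eA₂, ← eB₁, ← eB₂, ← Complex.exp_add, ← Complex.exp_add, ← Complex.exp_add]
      congr 1; ring

theorem theta_ne_zero {t z : ℂ} (ht : ‖t‖ < 1) (ht0 : t ≠ 0) (hz : z ≠ 0)
    (hz' : ∀ n : ℤ, ‖z‖ ≠ ‖t‖ ^ n) : theta t z ≠ 0 := by
  have htn : ‖t‖ ≠ 0 := norm_ne_zero_iff.2 ht0
  rw [theta]
  refine mul_ne_zero (mul_ne_zero (qPoch_ne_zero ht fun n hn => ?_)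
    (qPoch_ne_zero ht fun n hn => ?_)) (qPoch_ne_zero ht fun n hn => ?_)
  · have h1 : ‖z‖ * ‖t‖ ^ n = 1 := by
      rw [← norm_pow, ← norm_mul, ← sub_eq_zero.1 hn, norm_one]
    refine hz' (-n) ?_
    rw [zpow_neg, zpow_natCast]
    exact eq_inv_of_mul_eq_one_left h1
  · have h1 : t * z⁻¹ * t ^ n = 1 := (sub_eq_zero.1 hn).symm
    refine hz' (n + 1 : ℕ) ?_
    rw [zpow_natCast, ← norm_pow]
    congr 1
    have h2 : t * z⁻¹ * t ^ n * z = z := by rw [h1, one_mul]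
    rw [← h2]
    field_simp
    ring
  · have h1 : ‖t ^ (n + 1)‖ = 1 := by
      rw [pow_succ', ← sub_eq_zero.1 hn, norm_one]
    rw [norm_pow] at h1
    exact (pow_lt_one₀ (norm_nonneg _) ht (by omega)).ne h1

/-- Two theta functions have a common point of nonvanishing. -/
theorem exists_theta_ne_zero {t₁ t₂ a₁ a₂ : ℂ} (ht₁ : ‖t₁‖ < 1) (ht₂ : ‖t₂‖ < 1)
    (h₁ : t₁ ≠ 0) (h₂ : t₂ ≠ 0) (ha₁ : a₁ ≠ 0) (ha₂ : a₂ ≠ 0) :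
    ∃ x : ℂ, x ≠ 0 ∧ theta t₁ (a₁ * x) * theta t₂ (a₂ * x) ≠ 0 := by
  -- The zeros lie on countably many circles.
  have hc : (Set.range (fun n : ℤ => ‖t₁‖ ^ n / ‖a₁‖) ∪
      Set.range (fun n : ℤ => ‖t₂‖ ^ n / ‖a₂‖)).Countable :=
    (Set.countable_range _).union (Set.countable_range _)
  obtain ⟨ρ, hρ, hρ'⟩ : ∃ ρ ∈ Set.Ioi (0 : ℝ), ρ ∉ (Set.range (fun n : ℤ => ‖t₁‖ ^ n / ‖a₁‖) ∪
      Set.range (fun n : ℤ => ‖t₂‖ ^ n / ‖a₂‖)) := by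
    obtain ⟨ρ, h1, h2⟩ := (hc.dense_compl ℝ).exists_between one_pos
    exact ⟨ρ, h2.1, h1⟩
  rw [Set.mem_Ioi] at hρ
  have hn : ‖(ρ : ℂ)‖ = ρ := by rw [Complex.norm_real, Real.norm_of_nonneg hρ.le]
  have hρ0 : (ρ : ℂ) ≠ 0 := Complex.ofReal_ne_zero.2 hρ.ne'
  refine ⟨ρ, hρ0, mul_ne_zero (theta_ne_zero ht₁ h₁ (mul_ne_zero ha₁ hρ0) fun n hn' => hρ' ?_)
    (theta_ne_zero ht₂ h₂ (mul_ne_zero ha₂ hρ0) fun n hn' => hρ' ?_)⟩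
  · refine Or.inl ⟨n, ?_⟩
    rw [norm_mul, hn] at hn'
    simp only
    rw [← hn', mul_div_cancel_left₀ _ (norm_ne_zero_iff.2 ha₁)]
  · refine Or.inr ⟨n, ?_⟩
    rw [norm_mul, hn] at hn'
    simp only
    rw [← hn', mul_div_cancel_left₀ _ (norm_ne_zero_iff.2 ha₂)]

end

/-! ### Exchange relations from contractions -/

open Filter Topology

section

variable {h : ℂ} {k : ℝ}

/-- On the Fock space of label `χ`, the field `A` is the linear combination of the vertex operators
of the `X i` with coefficients `c i`, with target label `χ'` and with the powers of `z` shifted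
by `e`. -/
def ActsAsSum (h : ℂ) (k : ℝ) (A : FormalField) (χ χ' : Charge) {ι : Type} [Fintype ι]
    (c : ι → ℂ) (X : ι → LinField) (e : ℤ) : Prop :=
  ∀ (m : ℤ) (v : Fock),
    A m (Finsupp.single χ v) = Finsupp.single χ' (∑ i, c i • vertexOp h k (X i) (m - e) v)

theorem ActsAs.actsAsSum {A : FormalField} {χ χ' : Charge} {c : ℂ} {X : LinField} {e : ℤ}
    (hA : ActsAs h k A χ χ' c X e) :
    ActsAsSum h k A χ χ' (fun _ : Unit => c) (fun _ => X) e := by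
  intro m v
  rw [hA]; simp

/-- The matrix coefficient of `z ^ e w ^ e' :exp (X(z) + Y(w)):`, a Laurent polynomial. -/
def laurentCoeff (h : ℂ) (k : ℝ) (X Y : LinField) (v : Fock) (μ : (Boson × ℕ+) →₀ ℕ) (e e' : ℤ)
    (x : ℂ × ℂ) : ℂ :=
  ∑ᶠ p : ℤ × ℤ, MvPolynomial.coeff μ (normalPair h k X Y p.1 p.2 v) *
    x.1 ^ (p.1 + e) * x.2 ^ (p.2 + e')

theorem laurentCoeff_swap (X Y : LinField) (v : Fock) (μ : (Boson × ℕ+) →₀ ℕ) (e e' : ℤ)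
    (x : ℂ × ℂ) :
    laurentCoeff h k Y X v μ e' e x.swap = laurentCoeff h k X Y v μ e e' x := by
  rw [laurentCoeff, laurentCoeff, ← finsum_comp_equiv (Equiv.prodComm ℤ ℤ)]
  refine finsum_congr fun p => ?_
  simp only [Equiv.prodComm_apply, Prod.fst_swap, Prod.snd_swap]
  rw [normalPair_comm]; ring

theorem laurentCoeff_eq_sum (X Y : LinField) (v : Fock) (μ : (Boson × ℕ+) →₀ ℕ) (e e' : ℤ)
    (x : ℂ × ℂ) :
    laurentCoeff h k X Y v μ e e' x =
      ∑ p ∈ (finite_support_coeff_normalPair (h := h) (k := k) X Y v μ).toFinset,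
        MvPolynomial.coeff μ (normalPair h k X Y p.1 p.2 v) *
          x.1 ^ (p.1 + e) * x.2 ^ (p.2 + e') := by
  refine finsum_eq_sum_of_support_subset _ fun p hp => ?_
  rw [Finset.mem_coe, Set.Finite.mem_toFinset]
  intro h0
  refine hp ?_
  simp only at h0 ⊢
  rw [h0, zero_mul, zero_mul]

theorem analyticOnNhd_laurentCoeff (X Y : LinField) (v : Fock) (μ : (Boson × ℕ+) →₀ ℕ)
    (e e' : ℤ) : AnalyticOnNhd ℂ (laurentCoeff h k X Y v μ e e') torus := by
  intro x hx
  rw [show laurentCoeff h k X Y v μ e e' = _ from funext (laurentCoeff_eq_sum X Y v μ e e')]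
  refine Finset.analyticAt_fun_sum _ fun p _ => ?_
  exact (analyticAt_const.mul (analyticAt_fst.zpow hx.1)).mul (analyticAt_snd.zpow hx.2)

theorem coeff_vertexOp_vertexOp (X Y : LinField) (M N : ℤ) (v : Fock)
    (μ : (Boson × ℕ+) →₀ ℕ) :
    MvPolynomial.coeff μ (vertexOp h k X M (vertexOp h k Y N v)) =
      ∑ᶠ s : ℕ, PowerSeries.coeff s (psExp (contraction h k X Y)) *
        MvPolynomial.coeff μ (normalPair h k X Y (M + s) (N - s) v) := by
  have hfin := (finite_support_normalPair (h := h) (k := k) X Y M N v).preimage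
    (f := fun s : ℕ => (s : ℤ)) (fun _ _ _ _ e => Int.ofNat.inj e)
  have := (MvPolynomial.coeffAddMonoidHom (R := ℂ) μ).map_finsum (f := fun s : ℕ =>
    PowerSeries.coeff s (psExp (contraction h k X Y)) • normalPair h k X Y (M + s) (N - s) v)
    (hfin.subset fun s hs hs' => hs (by simp only at hs' ⊢; rw [hs', smul_zero]))
  rw [vertexOp_vertexOp]
  refine this.trans (finsum_congr fun s => ?_)
  rw [MvPolynomial.coeffAddMonoidHom_apply, MvPolynomial.coeff_smul, smul_eq_mul]

/-- The double series of a power series in `w / z` times a Laurent polynomial. -/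
theorem hasSum_mul_laurent {g : ℕ → ℂ} {L : ℤ × ℤ → ℂ} (S : Finset (ℤ × ℤ))
    (hL : ∀ p, p ∉ S → L p = 0) {z w s : ℂ} (hz : z ≠ 0) (hw : w ≠ 0)
    (hg : HasSum (fun n => g n * (w / z) ^ n) s) :
    HasSum (fun mn : ℤ × ℤ => (∑ᶠ n : ℕ, g n * L (mn.1 + n, mn.2 - n)) * z ^ mn.1 * w ^ mn.2)
      (∑ p ∈ S, s * (L p * z ^ p.1 * w ^ p.2)) := by
  classical
  have e : ∀ mn : ℤ × ℤ, (∑ᶠ n : ℕ, g n * L (mn.1 + n, mn.2 - n)) * z ^ mn.1 * w ^ mn.2 =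
      ∑ p ∈ S, (∑ᶠ n : ℕ, if p = (mn.1 + (n : ℤ), mn.2 - (n : ℤ)) then g n * L p else 0) *
        z ^ mn.1 * w ^ mn.2 := by
    intro mn
    rw [← Finset.sum_mul, ← Finset.sum_mul]
    congr 2
    rw [← finsum_sum_comm]
    · refine finsum_congr fun n => ?_
      rw [Finset.sum_ite_eq']
      split_ifs with hmem
      · rfl
      · rw [hL _ hmem, mul_zero]
    · intro p _
      refine (Set.finite_singleton (p.1 - mn.1).toNat).subset fun n hn => ?_
      by_contra hn'
      refine hn (if_neg fun hp => hn' ?_)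
      have := congrArg Prod.fst hp
      simp only at this
      rw [Set.mem_singleton_iff]; omega
  rw [funext e]
  refine hasSum_sum fun p _ => ?_
  set φ : ℕ → ℤ × ℤ := fun n => (p.1 - n, p.2 + n) with hφ
  have hinj : Function.Injective φ := fun a b hab => by
    have := congrArg Prod.fst hab
    simp only [hφ] at this
    omega
  rw [← hinj.hasSum_iff]
  · have h1 := hg.mul_right (L p * z ^ p.1 * w ^ p.2)
    refine h1.congr_fun fun n => ?_
    simp only [Function.comp_apply, hφ]
    rw [finsum_eq_single _ n, if_pos (by ext <;> simp), zpow_sub₀ hz, zpow_add₀ hw, zpow_natCast,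
      zpow_natCast, div_pow]
    · field_simp
    · intro n' hn'
      refine if_neg fun hp => hn' ?_
      have := congrArg Prod.fst hp
      simp only at this
      omega
  · intro mn hmn
    have : ∀ n : ℕ, (if p = (mn.1 + (n : ℤ), mn.2 - (n : ℤ)) then g n * L p else 0) = 0 := by
      intro n
      refine if_neg fun hp => hmn ⟨n, ?_⟩
      rw [hφ, hp]; ext <;> simp
    rw [finsum_congr this, finsum_zero, zero_mul, zero_mul]

theorem ContinuesTo.swap {T : ℤ → ℤ → ℂ} {R : Set (ℂ × ℂ)} {P Q : ℂ × ℂ → ℂ}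
    (hT : ContinuesTo T R P Q) :
    ContinuesTo (fun m n => T n m) {x | x.swap ∈ R} (fun x => P x.swap) (fun x => Q x.swap) := by
  obtain ⟨hP, hQ, ⟨x, hx, hQx⟩, hs⟩ := hT
  have hswap : ∀ x : ℂ × ℂ, AnalyticAt ℂ (Prod.swap : ℂ × ℂ → ℂ × ℂ) x := fun x =>
    analyticAt_snd.prod analyticAt_fst
  refine ⟨fun y hy => ?_, fun y hy => ?_, ⟨x.swap, hx.symm, by simpa using hQx⟩, fun y hy => ?_⟩
  · exact (hP y.swap hy.symm).comp (hswap y)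
  · exact (hQ y.swap hy.symm).comp (hswap y)
  · obtain ⟨s, h1, h2⟩ := hs y.swap hy
    refine ⟨s, ?_, h2⟩
    rw [← (Equiv.prodComm ℤ ℤ).hasSum_iff]
    refine h1.congr_fun fun mn => ?_
    simp only [Function.comp_apply, Equiv.prodComm_apply, Prod.fst_swap, Prod.snd_swap]
    ring

theorem analyticAt_comp_div {f : ℂ → ℂ} (hf : Differentiable ℂ f) {x : ℂ × ℂ} (hx : x.1 ≠ 0) :
    AnalyticAt ℂ (fun x : ℂ × ℂ => f (x.2 / x.1)) x :=
  (hf.analyticAt (x.2 / x.1)).comp (f := fun x : ℂ × ℂ => x.2 / x.1)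
    (analyticAt_snd.div analyticAt_fst hx)

/-- Matrix coefficients of a product of two combinations of vertex operators converge and continue
to meromorphic functions. -/
theorem continuesTo_of_expSumsTo {ι κ : Type} [Fintype ι] [Fintype κ] [Nonempty ι] [Nonempty κ]
    {X : ι → LinField} {Y : κ → LinField} {P : ι → κ → ℂ → ℂ} {Q : ℂ → ℂ} (c : ι → κ → ℂ)
    (hC : ∀ i j, ExpSumsTo (contraction h k (X i) (Y j)) (P i j) Q) {ε : ℝ}
    (hε : ∀ x : ℂ, ‖x‖ < ε → ∀ i j, ∃ s,
      HasSum (fun n => PowerSeries.coeff n (psExp (contraction h k (X i) (Y j))) * x ^ n) s ∧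
        Q x * s = P i j x)
    (v : Fock) (μ : (Boson × ℕ+) →₀ ℕ) (e e' : ℤ) {T : ℤ → ℤ → ℂ}
    (hT : ∀ m n, T m n = ∑ i, ∑ j, c i j * MvPolynomial.coeff μ
      (vertexOp h k (X i) (m - e) (vertexOp h k (Y j) (n - e') v))) :
    ContinuesTo T {x | 0 < ‖x.2‖ ∧ ‖x.2‖ < ε * ‖x.1‖}
      (fun x => ∑ i, ∑ j, c i j * laurentCoeff h k (X i) (Y j) v μ e e' x * P i j (x.2 / x.1))
      (fun x => Q (x.2 / x.1)) := by
  obtain ⟨i₀⟩ := ‹Nonempty ι›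
  obtain ⟨j₀⟩ := ‹Nonempty κ›
  have hQ := (hC i₀ j₀).differentiable_den
  refine ⟨fun x hx => ?_, fun x hx => analyticAt_comp_div hQ hx.1, ?_, fun x hx => ?_⟩
  · refine Finset.analyticAt_fun_sum _ fun i _ => Finset.analyticAt_fun_sum _ fun j _ => ?_
    exact (analyticAt_const.mul (analyticOnNhd_laurentCoeff _ _ _ _ _ _ x hx)).mul
      (analyticAt_comp_div (hC i j).differentiable_num hx.1)
  · have h1 : ∀ᶠ x in 𝓝 (0 : ℂ), Q x ≠ 0 :=
      hQ.continuous.continuousAt.eventually_ne (hC i₀ j₀).den_zero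
    have h2 : ∀ᶠ x in 𝓝[≠] (0 : ℂ), Q x ≠ 0 := h1.filter_mono nhdsWithin_le_nhds
    obtain ⟨w, hw, hw0⟩ := (h2.and self_mem_nhdsWithin).exists
    exact ⟨(1, w), ⟨one_ne_zero, hw0⟩, by simpa using hw⟩
  · obtain ⟨z, w⟩ := x
    obtain ⟨hw, hwz⟩ := hx
    simp only at hw hwz ⊢
    have hw0 : w ≠ 0 := norm_pos_iff.1 hw
    have hz0 : z ≠ 0 := by
      rintro rfl
      rw [norm_zero, mul_zero] at hwz
      exact absurd hwz (not_lt.2 hw.le)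
    have hx : ‖w / z‖ < ε := by
      rw [norm_div, div_lt_iff₀ (norm_pos_iff.2 hz0)]; exact hwz
    choose s hs hsQ using hε (w / z) hx
    refine ⟨∑ i, ∑ j, c i j * (s i j * laurentCoeff h k (X i) (Y j) v μ e e' (z, w)), ?_, ?_⟩
    · have hpair : ∀ i j, HasSum (fun mn : ℤ × ℤ => MvPolynomial.coeff μ
          (vertexOp h k (X i) (mn.1 - e) (vertexOp h k (Y j) (mn.2 - e') v)) *
            z ^ mn.1 * w ^ mn.2)
          (s i j * laurentCoeff h k (X i) (Y j) v μ e e' (z, w)) := by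
        intro i j
        have h1 := hasSum_mul_laurent
          (g := fun n => PowerSeries.coeff n (psExp (contraction h k (X i) (Y j))))
          (L := fun p => MvPolynomial.coeff μ (normalPair h k (X i) (Y j) p.1 p.2 v))
          (finite_support_coeff_normalPair (h := h) (k := k) (X i) (Y j) v μ).toFinset
          (fun p hp => by
            rw [Set.Finite.mem_toFinset] at hp
            exact Function.notMem_support.1 hp) hz0 hw0 (hs i j)
        rw [← ((Equiv.subRight e).prodCongr (Equiv.subRight e')).hasSum_iff] at h1
        have h2 := h1.mul_right (z ^ e * w ^ e')
        have h3 : (∑ p ∈ (finite_support_coeff_normalPair (h := h) (k := k)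
            (X i) (Y j) v μ).toFinset, s i j *
              (MvPolynomial.coeff μ (normalPair h k (X i) (Y j) p.1 p.2 v) *
                z ^ p.1 * w ^ p.2)) * (z ^ e * w ^ e') =
            s i j * laurentCoeff h k (X i) (Y j) v μ e e' (z, w) := by
          rw [laurentCoeff_eq_sum, Finset.mul_sum, Finset.sum_mul]
          refine Finset.sum_congr rfl fun p _ => ?_
          rw [zpow_add₀ hz0, zpow_add₀ hw0]; ring
        rw [h3] at h2
        refine h2.congr_fun fun mn => ?_
        simp only [Function.comp_apply, Equiv.prodCongr_apply, Prod.map_fst, Prod.map_snd,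
          Equiv.subRight_apply]
        rw [coeff_vertexOp_vertexOp, zpow_sub₀ hz0, zpow_sub₀ hw0]
        have hz' : z ^ e ≠ 0 := zpow_ne_zero _ hz0
        have hw' : w ^ e' ≠ 0 := zpow_ne_zero _ hw0
        field_simp
      have h4 := hasSum_sum (s := Finset.univ) fun i _ =>
        hasSum_sum (s := Finset.univ) fun j _ => (hpair i j).mul_left (c i j)
      refine h4.congr_fun fun mn => ?_
      rw [hT, Finset.sum_mul, Finset.sum_mul]
      refine Finset.sum_congr rfl fun i _ => ?_
      rw [Finset.sum_mul, Finset.sum_mul]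
      exact Finset.sum_congr rfl fun j _ => by ring
    · rw [Finset.mul_sum]
      refine Finset.sum_congr rfl fun i _ => ?_
      rw [Finset.mul_sum]
      refine Finset.sum_congr rfl fun j _ => ?_
      rw [← hsQ i j]; ring

theorem matrixCoeff_single_of_ne {χ χ' : Charge} (hχ : χ ≠ χ') (μ : (Boson × ℕ+) →₀ ℕ)
    (u : Fock) : matrixCoeff χ' μ (Finsupp.single χ u) = 0 := by
  rw [matrixCoeff, Finsupp.single_eq_of_ne hχ.symm, MvPolynomial.coeff_zero]

theorem matrixCoeff_single_self (χ : Charge) (μ : (Boson × ℕ+) →₀ ℕ) (u : Fock) :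
    matrixCoeff χ μ (Finsupp.single χ u) = MvPolynomial.coeff μ u := by
  rw [matrixCoeff, Finsupp.single_eq_same]

theorem continuesTo_zero {T : ℤ → ℤ → ℂ} (hT : ∀ m n, T m n = 0) (R : Set (ℂ × ℂ)) :
    ContinuesTo T R (fun _ => 0) (fun _ => 1) := by
  refine ⟨fun _ _ => analyticAt_const, fun _ _ => analyticAt_const,
    ⟨(1, 1), ⟨one_ne_zero, one_ne_zero⟩, one_ne_zero⟩, fun x _ => ⟨0, ?_, by simp⟩⟩
  simp only [hT, zero_mul]
  exact hasSum_zero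

theorem matrixCoeff_comp {ι κ : Type} [Fintype ι] [Fintype κ] {A B : FormalField}
    {χ χ₁ χ₂ : Charge} {X : ι → LinField} {Y : κ → LinField} {a : ι → ℂ} {b : κ → ℂ} {eA eB : ℤ}
    (hB : ActsAsSum h k B χ χ₁ b Y eB) (hA : ActsAsSum h k A χ₁ χ₂ a X eA)
    (μ : (Boson × ℕ+) →₀ ℕ) (v : Fock) (m n : ℤ) :
    matrixCoeff χ₂ μ (A m (B n (Finsupp.single χ v))) = ∑ i, ∑ j, a i * b j *
      MvPolynomial.coeff μ (vertexOp h k (X i) (m - eA) (vertexOp h k (Y j) (n - eB) v)) := by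
  rw [hB, hA, matrixCoeff_single_self, MvPolynomial.coeff_sum]
  refine Finset.sum_congr rfl fun i _ => ?_
  rw [MvPolynomial.coeff_smul, map_sum, MvPolynomial.coeff_sum, Finset.smul_sum]
  refine Finset.sum_congr rfl fun j _ => ?_
  rw [map_smul, MvPolynomial.coeff_smul, smul_eq_mul, smul_eq_mul, mul_assoc]

/-- An exchange relation between combinations of vertex operators follows from the same relation
between the contraction functions of all pairs. The primed coefficients are those of the fields in
the opposite order, on the labels that occur there. -/
theorem exchange_of_expSumsTo {ι κ : Type} [Fintype ι] [Fintype κ] [Nonempty ι] [Nonempty κ]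
    {A B : FormalField} {χ χA χB χAB : Charge} {X : ι → LinField} {Y : κ → LinField}
    {a a' : ι → ℂ} {b b' : κ → ℂ} {eA eB : ℤ} {P : ι → κ → ℂ → ℂ} {P' : κ → ι → ℂ → ℂ}
    {Q Q' N D : ℂ → ℂ}
    (hD : ∃ x : ℂ, x ≠ 0 ∧ D x ≠ 0)
    (hB : ActsAsSum h k B χ χB b Y eB) (hA : ActsAsSum h k A χB χAB a X eA)
    (hA' : ActsAsSum h k A χ χA a' X eA) (hB' : ActsAsSum h k B χA χAB b' Y eB)
    (hC : ∀ i j, ExpSumsTo (contraction h k (X i) (Y j)) (P i j) Q)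
    (hC' : ∀ j i, ExpSumsTo (contraction h k (Y j) (X i)) (P' j i) Q')
    (hrel : ∀ i j, ∀ u : ℂ, u ≠ 0 → a i * b j * P i j u⁻¹ * Q' u * D u =
      N u * (b' j * a' i * P' j i u) * Q u⁻¹) :
    Exchange χ A B N D := by
  refine ⟨hD, ?_⟩
  have h1 : ∀ᶠ x in 𝓝 (0 : ℂ), ∀ i j, ∃ s, HasSum
      (fun n => PowerSeries.coeff n (psExp (contraction h k (X i) (Y j))) * x ^ n) s ∧
        Q x * s = P i j x :=
    eventually_all.2 fun i => eventually_all.2 fun j => (hC i j).eventually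
  have h2 : ∀ᶠ x in 𝓝 (0 : ℂ), ∀ j i, ∃ s, HasSum
      (fun n => PowerSeries.coeff n (psExp (contraction h k (Y j) (X i))) * x ^ n) s ∧
        Q' x * s = P' j i x :=
    eventually_all.2 fun j => eventually_all.2 fun i => (hC' j i).eventually
  obtain ⟨ε, hε, hε'⟩ := Metric.eventually_nhds_iff.1 (h1.and h2)
  refine ⟨ε, hε, fun v χ' μ => ?_⟩
  rcases eq_or_ne χAB χ' with rfl | hχ
  · refine ⟨_, _, _, _, continuesTo_of_expSumsTo (fun i j => a i * b j) hC
        (fun x hx => (hε' (by simpa using hx)).1) v μ eA eB (matrixCoeff_comp hB hA μ v),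
      (continuesTo_of_expSumsTo (fun j i => b' j * a' i) hC'
        (fun x hx => (hε' (by simpa using hx)).2) v μ eB eA
        (matrixCoeff_comp hA' hB' μ v)).swap, fun x hx => ?_⟩
    simp only [Prod.fst_swap, Prod.snd_swap]
    have hu : x.1 / x.2 ≠ 0 := div_ne_zero hx.1 hx.2
    rw [Finset.sum_comm (s := (Finset.univ : Finset κ)), Finset.sum_mul, Finset.sum_mul,
      Finset.mul_sum, Finset.sum_mul]
    refine Finset.sum_congr rfl fun i _ => ?_
    rw [Finset.sum_mul, Finset.sum_mul, Finset.mul_sum, Finset.sum_mul]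
    refine Finset.sum_congr rfl fun j _ => ?_
    have h3 := hrel i j _ hu
    rw [inv_div] at h3
    rw [laurentCoeff_swap]
    linear_combination laurentCoeff h k (X i) (Y j) v μ eA eB x * h3
  · refine ⟨_, _, _, _, continuesTo_zero (fun m n => ?_) _, continuesTo_zero (fun m n => ?_) _,
      fun x _ => by simp⟩
    · rw [hB, hA, matrixCoeff_single_of_ne hχ]
    · rw [hA', hB', matrixCoeff_single_of_ne hχ]

end

/-! ### Modes of the exponents of the currents -/

section

variable {h : ℂ} {k r rs : ℝ}

/-- The exponent of `ψ_+(z)`. -/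
def psiPlusField (h : ℂ) (k : ℝ) : LinField :=
  (plus h .b).scale h (k / 2) + (plus h .a).scale h 1 + (plus h .b).scale h (k / 2 + 2)

/-- The exponent of `ψ_-(z)`. -/
def psiMinusField (h : ℂ) (k : ℝ) : LinField :=
  (minus h .b).scale h (-(k / 2)) + (minus h .a).scale h (-1)
    + (minus h .b).scale h (-(k / 2 + 2))

/-- The exponents of the two terms of `e^+(z)`. -/
def ePlusField (h : ℂ) : Fin 2 → LinField :=
  ![plus h .b - (fullBC h).scale h 1, minus h .b - (fullBC h).scale h (-1)]

/-- The exponents of the two terms of `e^-(z)`. -/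
def eMinusField (h : ℂ) (k : ℝ) : Fin 2 → LinField :=
  ![(fullBC h).scale h (-(k + 1)) + (minus h .a).scale h (-((k + 2) / 2))
      + (minus h .b).scale h (-(k + 2)),
    (fullBC h).scale h (k + 1) + (plus h .a).scale h ((k + 2) / 2)
      + (plus h .b).scale h (k + 2)]

/-- The exponent of `U^+(z)`. -/
def uPlusField (h : ℂ) (k rs : ℝ) : LinField :=
  (starMinus h rs .a).scale h (rs + k / 2 - 1)
    + ((starMinus h rs .b).scale h (rs - 1 + 1) + (starMinus h rs .b).scale h (rs - 1 - 1))

/-- The exponent of `U^-(z)`. -/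
def uMinusField (h : ℂ) (k r : ℝ) : LinField :=
  (starPlus h r .a).scale h (-(r - k / 2 - 1))
    + ((starPlus h r .b).scale h (-(r - k - 1) + 1)
      + (starPlus h r .b).scale h (-(r - k - 1) - 1))

/-- The exponent of `Ψ^+(z)`. -/
def bigPsiPlusField (h : ℂ) (k r rs : ℝ) : LinField :=
  (uPlusField h k rs).scale h (k / 2) +
    (psiPlusField h k + (uMinusField h k r).scale h (-(k / 2)))

/-- The exponent of `Ψ^-(z)`. -/
def bigPsiMinusField (h : ℂ) (k r rs : ℝ) : LinField :=
  (uPlusField h k rs).scale h (-(k / 2)) +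
    (psiMinusField h k + (uMinusField h k r).scale h (k / 2))

/-- The exponents of the two terms of `e(z)`. -/
def eField (h : ℂ) (k rs : ℝ) (i : Fin 2) : LinField := uPlusField h k rs + ePlusField h i

/-- The exponents of the two terms of `f(z)`. -/
def fField (h : ℂ) (k r : ℝ) (i : Fin 2) : LinField := eMinusField h k i + uMinusField h k r

theorem coeff_contraction (X Y : LinField) {n : ℕ} (hn : n ≠ 0) :
    PowerSeries.coeff n (contraction h k X Y) =
      X.osc .a n * Y.osc .a (-(n : ℤ)) * bracket h k .a n +
      X.osc .b n * Y.osc .b (-(n : ℤ)) * bracket h k .b n +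
      X.osc .c n * Y.osc .c (-(n : ℤ)) * bracket h k .c n := by
  rw [contraction, PowerSeries.coeff_mk, if_neg hn, sum_boson]

theorem osc_scale (s : ℂ) (X : LinField) (i : Boson) (n : ℤ) :
    (X.scale h s).osc i n = X.osc i n * qpow h (-(s * n)) := rfl

theorem osc_plus (i j : Boson) (n : ℤ) :
    (plus h i).osc j n = if j = i ∧ 0 < n then qpow h 1 - qpow h (-1) else 0 := rfl

theorem osc_minus (i j : Boson) (n : ℤ) :
    (minus h i).osc j n = if j = i ∧ n < 0 then -(qpow h 1 - qpow h (-1)) else 0 := rfl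

theorem osc_full (i j : Boson) (n : ℤ) :
    (full h i).osc j n = if j = i then -(1 / qint h n) else 0 := rfl

theorem osc_starPlus (i j : Boson) (n : ℤ) :
    (starPlus h r i).osc j n = if j = i ∧ 0 < n then -(1 / qint h (r * n)) else 0 := rfl

theorem osc_starMinus (i j : Boson) (n : ℤ) :
    (starMinus h rs i).osc j n = if j = i ∧ n < 0 then 1 / qint h (rs * (-n)) else 0 := rfl

theorem norm_qpow_ofReal (h : ℂ) (x : ℝ) : ‖qpow h x‖ = Real.exp (x * h.re) := by
  rw [qpow, Complex.norm_exp, Complex.re_ofReal_mul]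

theorem norm_qpow_lt_one (hre : h.re < 0) {x : ℝ} (hx : 0 < x) : ‖qpow h x‖ < 1 := by
  rw [norm_qpow_ofReal, Real.exp_lt_one_iff]
  exact mul_neg_of_pos_of_neg hx hre

/-- The numbers `x = q`, `y = q ^ n`, `κ = q ^ (k n / 2)` and `ρ = q ^ (r n)`, through which all
modes `± n` of the currents are expressed as rational functions, with the inequalities needed for
division. The last one says that `q ^ (2 r^* n) ≠ 1`. -/
structure ModeVars (h : ℂ) (k r rs : ℝ) (n : ℕ) (x y κ ρ : ℂ) : Prop where
  n_ne : n ≠ 0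
  x_eq : qpow h 1 = x
  y_eq : qpow h n = y
  κ_eq : qpow h (k / 2 * n) = κ
  ρ_eq : qpow h (r * n) = ρ
  rs_eq : rs = r - k
  x_ne : x ≠ 0
  y_ne : y ≠ 0
  x_sq : x ^ 2 - 1 ≠ 0
  κ_ne : κ ≠ 0
  ρ_ne : ρ ≠ 0
  y_sq : y ^ 2 - 1 ≠ 0
  ρ_sq : 1 - ρ ^ 2 ≠ 0
  ρs_sq : κ ^ 4 - ρ ^ 2 ≠ 0

theorem exists_modeVars (hre : h.re < 0) (hr : 0 < r) (hrs : 0 < rs) (hrc : rs = r - k) {n : ℕ}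
    (hn : n ≠ 0) : ∃ x y κ ρ, ModeVars h k r rs n x y κ ρ := by
  have hn0 : (0 : ℝ) < n := by exact_mod_cast Nat.pos_of_ne_zero hn
  have key : ∀ x : ℝ, 0 < x → qpow h x ^ 2 ≠ 1 := by
    intro x hx h1
    have h2 := pow_lt_one₀ (norm_nonneg _) (norm_qpow_lt_one hre hx) two_ne_zero
    rw [← norm_pow, h1, norm_one] at h2
    exact lt_irrefl _ h2
  refine ⟨_, _, _, _, hn, rfl, rfl, rfl, rfl, hrc, qpow_ne_zero _, qpow_ne_zero _, ?_,
    qpow_ne_zero _, qpow_ne_zero _, ?_, ?_, ?_⟩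
  · have := key 1 one_pos
    rw [Complex.ofReal_one] at this
    exact sub_ne_zero.2 this
  · have := key n hn0
    rw [Complex.ofReal_natCast] at this
    exact sub_ne_zero.2 this
  · have := key (r * n) (mul_pos hr hn0)
    push_cast at this
    exact sub_ne_zero.2 this.symm
  · have := key (rs * n) (mul_pos hrs hn0)
    intro h1
    refine this ?_
    have h2 : qpow h (r * n) = qpow h ((rs * n : ℝ) : ℂ) * qpow h (k / 2 * n) ^ 2 := by
      rw [sq, ← qpow_add, ← qpow_add, hrc]; congr 1; push_cast; ring
    rw [h2, mul_pow, ← pow_mul, sub_eq_zero] at h1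
    exact (mul_right_cancel₀ (pow_ne_zero 4 (qpow_ne_zero _))
      ((one_mul _).trans h1)).symm

/-- The shapes that a difference may take as a denominator in the normal forms of `simp`. -/
def DifferenceNeZero (a b : ℂ) : Prop :=
  a - b ≠ 0 ∧ b - a ≠ 0 ∧ a + -b ≠ 0 ∧ b + -a ≠ 0 ∧ -a + b ≠ 0 ∧ -b + a ≠ 0

theorem differenceNeZero_of_sub_ne_zero {a b : ℂ} (hab : a - b ≠ 0) : DifferenceNeZero a b := by
  have hba : b - a ≠ 0 := sub_ne_zero.2 (sub_ne_zero.1 hab).symm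
  refine ⟨hab, hba, ?_, ?_, ?_, ?_⟩
  · rwa [← sub_eq_add_neg]
  · rwa [← sub_eq_add_neg]
  · rwa [neg_add_eq_sub]
  · rwa [neg_add_eq_sub]

namespace ModeVars

variable {n : ℕ} {x y κ ρ : ℂ}

/-- The side conditions of `field_simp` in the computations with modes. -/
theorem ne_zero_forms (v : ModeVars h k r rs n x y κ ρ) :
    n ≠ 0 ∧ x ≠ 0 ∧ y ≠ 0 ∧ κ ≠ 0 ∧ ρ ≠ 0 ∧ DifferenceNeZero (x ^ 2) 1 ∧
      DifferenceNeZero (y ^ 2) 1 ∧ DifferenceNeZero 1 (ρ ^ 2) ∧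
      DifferenceNeZero (κ ^ 4) (ρ ^ 2) :=
  ⟨v.n_ne, v.x_ne, v.y_ne, v.κ_ne, v.ρ_ne, differenceNeZero_of_sub_ne_zero v.x_sq,
    differenceNeZero_of_sub_ne_zero v.y_sq, differenceNeZero_of_sub_ne_zero v.ρ_sq,
    differenceNeZero_of_sub_ne_zero v.ρs_sq⟩

theorem qpow_two (v : ModeVars h k r rs n x y κ ρ) : qpow h (2 * n) = y ^ 2 := by
  rw [← v.y_eq, sq, ← qpow_add]; congr 1; ring

theorem qpow_k (v : ModeVars h k r rs n x y κ ρ) : qpow h (k * n) = κ ^ 2 := by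
  rw [← v.κ_eq, sq, ← qpow_add]; congr 1; ring

set_option linter.unusedSimpArgs false

theorem osc_bigPsiPlusField (v : ModeVars h k r rs n x y κ ρ) :
    (bigPsiPlusField h k r rs).osc .a n = (x - x⁻¹) * y⁻¹ / (1 - ρ ^ 2) ∧
    (bigPsiPlusField h k r rs).osc .b n = (x - x⁻¹) * κ⁻¹ * (1 + y⁻¹ ^ 2) / (1 - ρ ^ 2) ∧
    (bigPsiPlusField h k r rs).osc .c n = 0 ∧
    (bigPsiPlusField h k r rs).osc .a (-(n : ℤ)) =
      -((x - x⁻¹) * ρ ^ 2 * κ ^ 2 * y⁻¹ / (κ ^ 4 - ρ ^ 2)) ∧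
    (bigPsiPlusField h k r rs).osc .b (-(n : ℤ)) =
      -((x - x⁻¹) * ρ ^ 2 * κ * (1 + y⁻¹ ^ 2) / (κ ^ 4 - ρ ^ 2)) ∧
    (bigPsiPlusField h k r rs).osc .c (-(n : ℤ)) = 0 := by
  have hn : 0 < n := Nat.pos_of_ne_zero v.n_ne
  have hn' : ¬ ((n : ℤ) < 0) := by omega
  obtain ⟨hn₀, hx, hy, hκ, hρ, ⟨_, _, _, _, _, _⟩, ⟨_, _, _, _, _, _⟩, ⟨_, _, _, _, _, _⟩,
    ⟨_, _, _, _, _, _⟩⟩ := v.ne_zero_forms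
  refine ⟨?_, ?_, ?_, ?_, ?_, ?_⟩ <;>
  · simp [bigPsiPlusField, uPlusField, psiPlusField, uMinusField, osc_add, osc_sub, osc_scale,
      osc_plus, osc_minus, osc_full, osc_starPlus, osc_starMinus, hn, hn', qint, v.rs_eq,
      -neg_add_rev, -neg_sub, sub_eq_add_neg, add_mul, mul_add, add_div, neg_add, qpow_add, qpow_neg,
      v.qpow_two, v.qpow_k, v.x_eq, v.y_eq, v.κ_eq, v.ρ_eq]
    try field_simp
    try ring

theorem osc_bigPsiMinusField (v : ModeVars h k r rs n x y κ ρ) :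
    (bigPsiMinusField h k r rs).osc .a n = (x - x⁻¹) * ρ ^ 2 * y⁻¹ * κ⁻¹ ^ 2 / (1 - ρ ^ 2) ∧
    (bigPsiMinusField h k r rs).osc .b n =
      (x - x⁻¹) * ρ ^ 2 * κ⁻¹ ^ 3 * (1 + y⁻¹ ^ 2) / (1 - ρ ^ 2) ∧
    (bigPsiMinusField h k r rs).osc .c n = 0 ∧
    (bigPsiMinusField h k r rs).osc .a (-(n : ℤ)) = -((x - x⁻¹) * κ ^ 4 * y⁻¹ / (κ ^ 4 - ρ ^ 2)) ∧
    (bigPsiMinusField h k r rs).osc .b (-(n : ℤ)) =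
      -((x - x⁻¹) * κ ^ 3 * (1 + y⁻¹ ^ 2) / (κ ^ 4 - ρ ^ 2)) ∧
    (bigPsiMinusField h k r rs).osc .c (-(n : ℤ)) = 0 := by
  have hn : 0 < n := Nat.pos_of_ne_zero v.n_ne
  have hn' : ¬ ((n : ℤ) < 0) := by omega
  obtain ⟨hn₀, hx, hy, hκ, hρ, ⟨_, _, _, _, _, _⟩, ⟨_, _, _, _, _, _⟩, ⟨_, _, _, _, _, _⟩,
    ⟨_, _, _, _, _, _⟩⟩ := v.ne_zero_forms
  refine ⟨?_, ?_, ?_, ?_, ?_, ?_⟩ <;>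
  · simp [bigPsiMinusField, uPlusField, psiMinusField, uMinusField, osc_add, osc_sub, osc_scale,
      osc_plus, osc_minus, osc_full, osc_starPlus, osc_starMinus, hn, hn', qint, v.rs_eq,
      -neg_add_rev, -neg_sub, sub_eq_add_neg, add_mul, mul_add, add_div, neg_add, qpow_add, qpow_neg,
      v.qpow_two, v.qpow_k, v.x_eq, v.y_eq, v.κ_eq, v.ρ_eq]
    try field_simp
    try ring

theorem osc_eField_zero (v : ModeVars h k r rs n x y κ ρ) :
    (eField h k rs 0).osc .a n = 0 ∧
    (eField h k rs 0).osc .b n = (x - x⁻¹) * y / (y - y⁻¹) ∧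
    (eField h k rs 0).osc .c n = (x - x⁻¹) * y⁻¹ / (y - y⁻¹) ∧
    (eField h k rs 0).osc .a (-(n : ℤ)) = -((x - x⁻¹) * ρ ^ 2 * κ * y⁻¹ / (κ ^ 4 - ρ ^ 2)) ∧
    (eField h k rs 0).osc .b (-(n : ℤ)) = -((x - x⁻¹) * y / (y - y⁻¹)) -
      (x - x⁻¹) * ρ ^ 2 * (1 + y⁻¹ ^ 2) / (κ ^ 4 - ρ ^ 2) ∧
    (eField h k rs 0).osc .c (-(n : ℤ)) = -((x - x⁻¹) * y / (y - y⁻¹)) := by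
  have hn : 0 < n := Nat.pos_of_ne_zero v.n_ne
  have hn' : ¬ ((n : ℤ) < 0) := by omega
  obtain ⟨hn₀, hx, hy, hκ, hρ, ⟨_, _, _, _, _, _⟩, ⟨_, _, _, _, _, _⟩, ⟨_, _, _, _, _, _⟩,
    ⟨_, _, _, _, _, _⟩⟩ := v.ne_zero_forms
  refine ⟨?_, ?_, ?_, ?_, ?_, ?_⟩ <;>
  · simp [eField, ePlusField, uPlusField, fullBC, osc_add, osc_sub, osc_scale,
      osc_plus, osc_minus, osc_full, osc_starPlus, osc_starMinus, hn, hn', qint, v.rs_eq,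
      -neg_add_rev, -neg_sub, sub_eq_add_neg, add_mul, mul_add, add_div, neg_add, qpow_add, qpow_neg,
      v.qpow_two, v.qpow_k, v.x_eq, v.y_eq, v.κ_eq, v.ρ_eq]
    try field_simp
    try ring

theorem osc_eField_one (v : ModeVars h k r rs n x y κ ρ) :
    (eField h k rs 1).osc .a n = 0 ∧
    (eField h k rs 1).osc .b n = (x - x⁻¹) * y / (y - y⁻¹) ∧
    (eField h k rs 1).osc .c n = (x - x⁻¹) * y / (y - y⁻¹) ∧
    (eField h k rs 1).osc .a (-(n : ℤ)) = -((x - x⁻¹) * ρ ^ 2 * κ * y⁻¹ / (κ ^ 4 - ρ ^ 2)) ∧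
    (eField h k rs 1).osc .b (-(n : ℤ)) = -((x - x⁻¹) * y / (y - y⁻¹)) -
      (x - x⁻¹) * ρ ^ 2 * (1 + y⁻¹ ^ 2) / (κ ^ 4 - ρ ^ 2) ∧
    (eField h k rs 1).osc .c (-(n : ℤ)) = -((x - x⁻¹) * y⁻¹ / (y - y⁻¹)) := by
  have hn : 0 < n := Nat.pos_of_ne_zero v.n_ne
  have hn' : ¬ ((n : ℤ) < 0) := by omega
  obtain ⟨hn₀, hx, hy, hκ, hρ, ⟨_, _, _, _, _, _⟩, ⟨_, _, _, _, _, _⟩, ⟨_, _, _, _, _, _⟩,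
    ⟨_, _, _, _, _, _⟩⟩ := v.ne_zero_forms
  refine ⟨?_, ?_, ?_, ?_, ?_, ?_⟩ <;>
  · simp [eField, ePlusField, uPlusField, fullBC, osc_add, osc_sub, osc_scale,
      osc_plus, osc_minus, osc_full, osc_starPlus, osc_starMinus, hn, hn', qint, v.rs_eq,
      -neg_add_rev, -neg_sub, sub_eq_add_neg, add_mul, mul_add, add_div, neg_add, qpow_add, qpow_neg,
      v.qpow_two, v.qpow_k, v.x_eq, v.y_eq, v.κ_eq, v.ρ_eq]
    try field_simp
    try ring

theorem osc_fField_zero (v : ModeVars h k r rs n x y κ ρ) :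
    (fField h k r 0).osc .a n = (x - x⁻¹) * ρ ^ 2 * κ⁻¹ * y⁻¹ / (1 - ρ ^ 2) ∧
    (fField h k r 0).osc .b n = -((x - x⁻¹) * κ ^ 2 * y / (y - y⁻¹)) +
      (x - x⁻¹) * ρ ^ 2 * κ⁻¹ ^ 2 * (1 + y⁻¹ ^ 2) / (1 - ρ ^ 2) ∧
    (fField h k r 0).osc .c n = -((x - x⁻¹) * κ ^ 2 * y / (y - y⁻¹)) ∧
    (fField h k r 0).osc .a (-(n : ℤ)) = -((x - x⁻¹) * κ⁻¹ * y⁻¹) ∧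
    (fField h k r 0).osc .b (-(n : ℤ)) = (x - x⁻¹) * κ⁻¹ ^ 2 * y⁻¹ ^ 3 / (y - y⁻¹) ∧
    (fField h k r 0).osc .c (-(n : ℤ)) = (x - x⁻¹) * κ⁻¹ ^ 2 * y⁻¹ / (y - y⁻¹) := by
  have hn : 0 < n := Nat.pos_of_ne_zero v.n_ne
  have hn' : ¬ ((n : ℤ) < 0) := by omega
  obtain ⟨hn₀, hx, hy, hκ, hρ, ⟨_, _, _, _, _, _⟩, ⟨_, _, _, _, _, _⟩, ⟨_, _, _, _, _, _⟩,
    ⟨_, _, _, _, _, _⟩⟩ := v.ne_zero_forms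
  refine ⟨?_, ?_, ?_, ?_, ?_, ?_⟩ <;>
  · simp [fField, eMinusField, uMinusField, fullBC, osc_add, osc_sub, osc_scale,
      osc_plus, osc_minus, osc_full, osc_starPlus, osc_starMinus, hn, hn', qint, v.rs_eq,
      -neg_add_rev, -neg_sub, sub_eq_add_neg, add_mul, mul_add, add_div, neg_add, qpow_add, qpow_neg,
      v.qpow_two, v.qpow_k, v.x_eq, v.y_eq, v.κ_eq, v.ρ_eq]
    try field_simp
    try ring

theorem osc_fField_one (v : ModeVars h k r rs n x y κ ρ) :
    (fField h k r 1).osc .a n = (x - x⁻¹) * κ⁻¹ * y⁻¹ / (1 - ρ ^ 2) ∧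
    (fField h k r 1).osc .b n = -((x - x⁻¹) * κ⁻¹ ^ 2 * y⁻¹ ^ 3 / (y - y⁻¹)) +
      (x - x⁻¹) * ρ ^ 2 * κ⁻¹ ^ 2 * (1 + y⁻¹ ^ 2) / (1 - ρ ^ 2) ∧
    (fField h k r 1).osc .c n = -((x - x⁻¹) * κ⁻¹ ^ 2 * y⁻¹ / (y - y⁻¹)) ∧
    (fField h k r 1).osc .a (-(n : ℤ)) = 0 ∧
    (fField h k r 1).osc .b (-(n : ℤ)) = (x - x⁻¹) * κ ^ 2 * y / (y - y⁻¹) ∧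
    (fField h k r 1).osc .c (-(n : ℤ)) = (x - x⁻¹) * κ ^ 2 * y / (y - y⁻¹) := by
  have hn : 0 < n := Nat.pos_of_ne_zero v.n_ne
  have hn' : ¬ ((n : ℤ) < 0) := by omega
  obtain ⟨hn₀, hx, hy, hκ, hρ, ⟨_, _, _, _, _, _⟩, ⟨_, _, _, _, _, _⟩, ⟨_, _, _, _, _, _⟩,
    ⟨_, _, _, _, _, _⟩⟩ := v.ne_zero_forms
  refine ⟨?_, ?_, ?_, ?_, ?_, ?_⟩ <;>
  · simp [fField, eMinusField, uMinusField, fullBC, osc_add, osc_sub, osc_scale,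
      osc_plus, osc_minus, osc_full, osc_starPlus, osc_starMinus, hn, hn', qint, v.rs_eq,
      -neg_add_rev, -neg_sub, sub_eq_add_neg, add_mul, mul_add, add_div, neg_add, qpow_add, qpow_neg,
      v.qpow_two, v.qpow_k, v.x_eq, v.y_eq, v.κ_eq, v.ρ_eq]
    try field_simp
    try ring

end ModeVars

end

set_option linter.unusedSimpArgs false

/-! ### Contractions of the currents -/

section

variable {h : ℂ} {k r rs : ℝ}

namespace ModeVars

variable {n : ℕ} {x y κ ρ : ℂ}

theorem bracket_a (v : ModeVars h k r rs n x y κ ρ) : bracket h k .a n =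
    (κ ^ 2 * y ^ 2 - κ⁻¹ ^ 2 * y⁻¹ ^ 2) * (y ^ 2 - y⁻¹ ^ 2) / ((x - x⁻¹) * (x - x⁻¹)) / n := by
  simp only [bracket, qint, Int.cast_natCast, add_mul, neg_add, qpow_add, qpow_neg,
    v.qpow_two, v.qpow_k, v.x_eq, inv_pow, div_mul_div_comm]

theorem bracket_b (v : ModeVars h k r rs n x y κ ρ) : bracket h k .b n =
    -((y - y⁻¹) ^ 2 / (x - x⁻¹) ^ 2 / n) := by
  simp only [bracket, qint, Int.cast_natCast, qpow_neg, v.y_eq, v.x_eq, div_pow]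

theorem bracket_c (v : ModeVars h k r rs n x y κ ρ) : bracket h k .c n =
    (y - y⁻¹) ^ 2 / (x - x⁻¹) ^ 2 / n := by
  simp only [bracket, qint, Int.cast_natCast, qpow_neg, v.y_eq, v.x_eq, div_pow]

theorem qpow_pow_two (v : ModeVars h k r rs n x y κ ρ) : qpow h 2 ^ n = y ^ 2 := by
  rw [← qpow_mul_natCast, v.qpow_two]

theorem qpow_pow_half (v : ModeVars h k r rs n x y κ ρ) : qpow h (k / 2) ^ n = κ := by
  rw [← qpow_mul_natCast, v.κ_eq]

theorem qpow_pow_r (v : ModeVars h k r rs n x y κ ρ) : qpow h (2 * r) ^ n = ρ ^ 2 := by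
  rw [← v.ρ_eq, ← qpow_mul_natCast, sq, ← qpow_add]; congr 1; ring

theorem qpow_pow_rs (v : ModeVars h k r rs n x y κ ρ) :
    qpow h (2 * rs) ^ n = ρ ^ 2 * κ⁻¹ ^ 4 := by
  have e : qpow h (r * n) = qpow h (rs * n) * κ ^ 2 := by
    rw [v.rs_eq, ← v.qpow_k, ← qpow_add]; congr 1; push_cast; ring
  have e' : qpow h (2 * rs) ^ n = qpow h (rs * n) ^ 2 := by
    rw [← qpow_mul_natCast, sq, ← qpow_add]; congr 1; ring
  have hκ := v.κ_ne
  rw [e', ← v.ρ_eq, e]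
  field_simp

/-- The contraction of `Ψ^+` with itself. Here and below `q ^ (2 r) = p`, `q ^ (2 r^*) = p^*`, and a
term `b ^ n / (n (1 - t ^ n))` stands for a factor `1 / (b x; t)` of the exponential at
`x = w / z`. -/
theorem coeff_contraction_psiPlus_psiPlus (v : ModeVars h k r rs n x y κ ρ) :
    PowerSeries.coeff n (contraction h k (bigPsiPlusField h k r rs) (bigPsiPlusField h k r rs)) =
      1 / n * ((qpow h 2) ^ n / (1 - qpow h (2 * rs) ^ n) +
        ((qpow h 2)⁻¹) ^ n / (1 - qpow h (2 * r) ^ n) -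
        ((qpow h 2)⁻¹) ^ n / (1 - qpow h (2 * rs) ^ n) -
        (qpow h 2) ^ n / (1 - qpow h (2 * r) ^ n)) := by
  obtain ⟨a01, a02, a03, -, -, -⟩ := v.osc_bigPsiPlusField
  obtain ⟨-, -, -, b01, b02, b03⟩ := v.osc_bigPsiPlusField
  obtain ⟨hn₀, hx, hy, hκ, hρ, ⟨_, _, _, _, _, _⟩, ⟨_, _, _, _, _, _⟩, ⟨_, _, _, _, _, _⟩,
    ⟨_, _, _, _, _, _⟩⟩ := v.ne_zero_forms
  simp [coeff_contraction _ _ v.n_ne, a01, a02, a03, b01, b02, b03,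
    v.bracket_a, v.bracket_b, v.bracket_c, mul_pow, inv_pow, v.qpow_pow_two,
    v.qpow_pow_half, v.qpow_pow_r, v.qpow_pow_rs]
  try field_simp
  try ring

theorem coeff_contraction_psiMinus_psiMinus (v : ModeVars h k r rs n x y κ ρ) :
    PowerSeries.coeff n (contraction h k (bigPsiMinusField h k r rs) (bigPsiMinusField h k r rs)) =
      1 / n * ((qpow h 2) ^ n / (1 - qpow h (2 * rs) ^ n) +
        ((qpow h 2)⁻¹) ^ n / (1 - qpow h (2 * r) ^ n) -
        ((qpow h 2)⁻¹) ^ n / (1 - qpow h (2 * rs) ^ n) -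
        (qpow h 2) ^ n / (1 - qpow h (2 * r) ^ n)) := by
  obtain ⟨a01, a02, a03, -, -, -⟩ := v.osc_bigPsiMinusField
  obtain ⟨-, -, -, b01, b02, b03⟩ := v.osc_bigPsiMinusField
  obtain ⟨hn₀, hx, hy, hκ, hρ, ⟨_, _, _, _, _, _⟩, ⟨_, _, _, _, _, _⟩, ⟨_, _, _, _, _, _⟩,
    ⟨_, _, _, _, _, _⟩⟩ := v.ne_zero_forms
  simp [coeff_contraction _ _ v.n_ne, a01, a02, a03, b01, b02, b03,
    v.bracket_a, v.bracket_b, v.bracket_c, mul_pow, inv_pow, v.qpow_pow_two,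
    v.qpow_pow_half, v.qpow_pow_r, v.qpow_pow_rs]
  try field_simp
  try ring

/-- The arguments are written with `p^* q ^ k`, whose square is `p p^*`; this makes the two orders
reflections of each other. -/
theorem coeff_contraction_psiPlus_psiMinus (v : ModeVars h k r rs n x y κ ρ) :
    PowerSeries.coeff n (contraction h k (bigPsiPlusField h k r rs) (bigPsiMinusField h k r rs)) =
      1 / n * (((qpow h (2 * rs))⁻¹ * (qpow h (k / 2) * qpow h (k / 2))⁻¹ * qpow h 2) ^ n /
          (1 - qpow h (2 * rs) ^ n) +
        ((qpow h (2 * rs))⁻¹ * (qpow h (k / 2) * qpow h (k / 2))⁻¹ * (qpow h 2)⁻¹) ^ n /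
          (1 - qpow h (2 * r) ^ n) -
        ((qpow h (2 * rs))⁻¹ * (qpow h (k / 2) * qpow h (k / 2))⁻¹ * (qpow h 2)⁻¹) ^ n /
          (1 - qpow h (2 * rs) ^ n) -
        ((qpow h (2 * rs))⁻¹ * (qpow h (k / 2) * qpow h (k / 2))⁻¹ * qpow h 2) ^ n /
          (1 - qpow h (2 * r) ^ n)) := by
  obtain ⟨a01, a02, a03, -, -, -⟩ := v.osc_bigPsiPlusField
  obtain ⟨-, -, -, b01, b02, b03⟩ := v.osc_bigPsiMinusField
  obtain ⟨hn₀, hx, hy, hκ, hρ, ⟨_, _, _, _, _, _⟩, ⟨_, _, _, _, _, _⟩, ⟨_, _, _, _, _, _⟩,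
    ⟨_, _, _, _, _, _⟩⟩ := v.ne_zero_forms
  simp [coeff_contraction _ _ v.n_ne, a01, a02, a03, b01, b02, b03,
    v.bracket_a, v.bracket_b, v.bracket_c, mul_pow, inv_pow, v.qpow_pow_two,
    v.qpow_pow_half, v.qpow_pow_r, v.qpow_pow_rs]
  try field_simp
  try ring

theorem coeff_contraction_psiMinus_psiPlus (v : ModeVars h k r rs n x y κ ρ) :
    PowerSeries.coeff n (contraction h k (bigPsiMinusField h k r rs) (bigPsiPlusField h k r rs)) =
      1 / n * ((qpow h (2 * rs) * (qpow h (k / 2) * qpow h (k / 2)) * qpow h 2) ^ n /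
          (1 - qpow h (2 * rs) ^ n) +
        (qpow h (2 * rs) * (qpow h (k / 2) * qpow h (k / 2)) * (qpow h 2)⁻¹) ^ n /
          (1 - qpow h (2 * r) ^ n) -
        (qpow h (2 * rs) * (qpow h (k / 2) * qpow h (k / 2)) * (qpow h 2)⁻¹) ^ n /
          (1 - qpow h (2 * rs) ^ n) -
        (qpow h (2 * rs) * (qpow h (k / 2) * qpow h (k / 2)) * qpow h 2) ^ n /
          (1 - qpow h (2 * r) ^ n)) := by
  obtain ⟨a01, a02, a03, -, -, -⟩ := v.osc_bigPsiMinusField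
  obtain ⟨-, -, -, b01, b02, b03⟩ := v.osc_bigPsiPlusField
  obtain ⟨hn₀, hx, hy, hκ, hρ, ⟨_, _, _, _, _, _⟩, ⟨_, _, _, _, _, _⟩, ⟨_, _, _, _, _, _⟩,
    ⟨_, _, _, _, _, _⟩⟩ := v.ne_zero_forms
  simp [coeff_contraction _ _ v.n_ne, a01, a02, a03, b01, b02, b03,
    v.bracket_a, v.bracket_b, v.bracket_c, mul_pow, inv_pow, v.qpow_pow_two,
    v.qpow_pow_half, v.qpow_pow_r, v.qpow_pow_rs]
  try field_simp
  try ring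

theorem coeff_contraction_psiPlus_e (v : ModeVars h k r rs n x y κ ρ) (i : Fin 2) :
    PowerSeries.coeff n (contraction h k (bigPsiPlusField h k r rs) (eField h k rs i)) =
      1 / n * ((qpow h 2 * (qpow h (k / 2))⁻¹) ^ n / (1 - qpow h (2 * rs) ^ n) -
        ((qpow h 2)⁻¹ * (qpow h (k / 2))⁻¹) ^ n / (1 - qpow h (2 * rs) ^ n)) := by
  obtain ⟨a01, a02, a03, -, -, -⟩ := v.osc_bigPsiPlusField
  obtain ⟨-, -, -, b01, b02, b03⟩ := v.osc_eField_zero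
  obtain ⟨-, -, -, b11, b12, b13⟩ := v.osc_eField_one
  obtain ⟨hn₀, hx, hy, hκ, hρ, ⟨_, _, _, _, _, _⟩, ⟨_, _, _, _, _, _⟩, ⟨_, _, _, _, _, _⟩,
    ⟨_, _, _, _, _, _⟩⟩ := v.ne_zero_forms
  fin_cases i <;>
  · simp [coeff_contraction _ _ v.n_ne, a01, a02, a03, b01, b02, b03, b11, b12, b13,
      v.bracket_a, v.bracket_b, v.bracket_c, mul_pow, inv_pow, v.qpow_pow_two,
      v.qpow_pow_half, v.qpow_pow_r, v.qpow_pow_rs]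
    try field_simp
    try ring

theorem coeff_contraction_e_psiPlus (v : ModeVars h k r rs n x y κ ρ) (i : Fin 2) :
    PowerSeries.coeff n (contraction h k (eField h k rs i) (bigPsiPlusField h k r rs)) =
      1 / n * ((qpow h (2 * rs) * qpow h 2 * qpow h (k / 2)) ^ n / (1 - qpow h (2 * rs) ^ n) -
        (qpow h (2 * rs) * (qpow h 2)⁻¹ * qpow h (k / 2)) ^ n / (1 - qpow h (2 * rs) ^ n)) := by
  obtain ⟨a01, a02, a03, -, -, -⟩ := v.osc_eField_zero
  obtain ⟨a11, a12, a13, -, -, -⟩ := v.osc_eField_one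
  obtain ⟨-, -, -, b01, b02, b03⟩ := v.osc_bigPsiPlusField
  obtain ⟨hn₀, hx, hy, hκ, hρ, ⟨_, _, _, _, _, _⟩, ⟨_, _, _, _, _, _⟩, ⟨_, _, _, _, _, _⟩,
    ⟨_, _, _, _, _, _⟩⟩ := v.ne_zero_forms
  fin_cases i <;>
  · simp [coeff_contraction _ _ v.n_ne, a01, a02, a03, a11, a12, a13, b01, b02, b03,
      v.bracket_a, v.bracket_b, v.bracket_c, mul_pow, inv_pow, v.qpow_pow_two,
      v.qpow_pow_half, v.qpow_pow_r, v.qpow_pow_rs]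
    try field_simp
    try ring

theorem coeff_contraction_psiMinus_e (v : ModeVars h k r rs n x y κ ρ) (i : Fin 2) :
    PowerSeries.coeff n (contraction h k (bigPsiMinusField h k r rs) (eField h k rs i)) =
      1 / n * ((qpow h (2 * rs) * qpow h 2 * qpow h (k / 2)) ^ n / (1 - qpow h (2 * rs) ^ n) -
        (qpow h (2 * rs) * (qpow h 2)⁻¹ * qpow h (k / 2)) ^ n / (1 - qpow h (2 * rs) ^ n)) := by
  obtain ⟨a01, a02, a03, -, -, -⟩ := v.osc_bigPsiMinusField
  obtain ⟨-, -, -, b01, b02, b03⟩ := v.osc_eField_zero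
  obtain ⟨-, -, -, b11, b12, b13⟩ := v.osc_eField_one
  obtain ⟨hn₀, hx, hy, hκ, hρ, ⟨_, _, _, _, _, _⟩, ⟨_, _, _, _, _, _⟩, ⟨_, _, _, _, _, _⟩,
    ⟨_, _, _, _, _, _⟩⟩ := v.ne_zero_forms
  fin_cases i <;>
  · simp [coeff_contraction _ _ v.n_ne, a01, a02, a03, b01, b02, b03, b11, b12, b13,
      v.bracket_a, v.bracket_b, v.bracket_c, mul_pow, inv_pow, v.qpow_pow_two,
      v.qpow_pow_half, v.qpow_pow_r, v.qpow_pow_rs]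
    try field_simp
    try ring

theorem coeff_contraction_e_psiMinus (v : ModeVars h k r rs n x y κ ρ) (i : Fin 2) :
    PowerSeries.coeff n (contraction h k (eField h k rs i) (bigPsiMinusField h k r rs)) =
      1 / n * ((qpow h 2 * (qpow h (k / 2))⁻¹) ^ n / (1 - qpow h (2 * rs) ^ n) -
        ((qpow h 2)⁻¹ * (qpow h (k / 2))⁻¹) ^ n / (1 - qpow h (2 * rs) ^ n)) := by
  obtain ⟨a01, a02, a03, -, -, -⟩ := v.osc_eField_zero
  obtain ⟨a11, a12, a13, -, -, -⟩ := v.osc_eField_one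
  obtain ⟨-, -, -, b01, b02, b03⟩ := v.osc_bigPsiMinusField
  obtain ⟨hn₀, hx, hy, hκ, hρ, ⟨_, _, _, _, _, _⟩, ⟨_, _, _, _, _, _⟩, ⟨_, _, _, _, _, _⟩,
    ⟨_, _, _, _, _, _⟩⟩ := v.ne_zero_forms
  fin_cases i <;>
  · simp [coeff_contraction _ _ v.n_ne, a01, a02, a03, a11, a12, a13, b01, b02, b03,
      v.bracket_a, v.bracket_b, v.bracket_c, mul_pow, inv_pow, v.qpow_pow_two,
      v.qpow_pow_half, v.qpow_pow_r, v.qpow_pow_rs]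
    try field_simp
    try ring

theorem coeff_contraction_psiPlus_f (v : ModeVars h k r rs n x y κ ρ) (i : Fin 2) :
    PowerSeries.coeff n (contraction h k (bigPsiPlusField h k r rs) (fField h k r i)) =
      1 / n * (((qpow h 2)⁻¹ * qpow h (k / 2)) ^ n / (1 - qpow h (2 * r) ^ n) -
        (qpow h 2 * qpow h (k / 2)) ^ n / (1 - qpow h (2 * r) ^ n)) := by
  obtain ⟨a01, a02, a03, -, -, -⟩ := v.osc_bigPsiPlusField
  obtain ⟨-, -, -, b01, b02, b03⟩ := v.osc_fField_zero
  obtain ⟨-, -, -, b11, b12, b13⟩ := v.osc_fField_one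
  obtain ⟨hn₀, hx, hy, hκ, hρ, ⟨_, _, _, _, _, _⟩, ⟨_, _, _, _, _, _⟩, ⟨_, _, _, _, _, _⟩,
    ⟨_, _, _, _, _, _⟩⟩ := v.ne_zero_forms
  fin_cases i <;>
  · simp [coeff_contraction _ _ v.n_ne, a01, a02, a03, b01, b02, b03, b11, b12, b13,
      v.bracket_a, v.bracket_b, v.bracket_c, mul_pow, inv_pow, v.qpow_pow_two,
      v.qpow_pow_half, v.qpow_pow_r, v.qpow_pow_rs]
    try field_simp
    try ring

theorem coeff_contraction_f_psiPlus (v : ModeVars h k r rs n x y κ ρ) (i : Fin 2) :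
    PowerSeries.coeff n (contraction h k (fField h k r i) (bigPsiPlusField h k r rs)) =
      1 / n * ((qpow h (2 * r) * (qpow h 2)⁻¹ * (qpow h (k / 2))⁻¹) ^ n / (1 - qpow h (2 * r) ^ n) -
        (qpow h (2 * r) * qpow h 2 * (qpow h (k / 2))⁻¹) ^ n / (1 - qpow h (2 * r) ^ n)) := by
  obtain ⟨a01, a02, a03, -, -, -⟩ := v.osc_fField_zero
  obtain ⟨a11, a12, a13, -, -, -⟩ := v.osc_fField_one
  obtain ⟨-, -, -, b01, b02, b03⟩ := v.osc_bigPsiPlusField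
  obtain ⟨hn₀, hx, hy, hκ, hρ, ⟨_, _, _, _, _, _⟩, ⟨_, _, _, _, _, _⟩, ⟨_, _, _, _, _, _⟩,
    ⟨_, _, _, _, _, _⟩⟩ := v.ne_zero_forms
  fin_cases i <;>
  · simp [coeff_contraction _ _ v.n_ne, a01, a02, a03, a11, a12, a13, b01, b02, b03,
      v.bracket_a, v.bracket_b, v.bracket_c, mul_pow, inv_pow, v.qpow_pow_two,
      v.qpow_pow_half, v.qpow_pow_r, v.qpow_pow_rs]
    try field_simp
    try ring

theorem coeff_contraction_psiMinus_f (v : ModeVars h k r rs n x y κ ρ) (i : Fin 2) :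
    PowerSeries.coeff n (contraction h k (bigPsiMinusField h k r rs) (fField h k r i)) =
      1 / n * ((qpow h (2 * r) * (qpow h 2)⁻¹ * (qpow h (k / 2))⁻¹) ^ n / (1 - qpow h (2 * r) ^ n) -
        (qpow h (2 * r) * qpow h 2 * (qpow h (k / 2))⁻¹) ^ n / (1 - qpow h (2 * r) ^ n)) := by
  obtain ⟨a01, a02, a03, -, -, -⟩ := v.osc_bigPsiMinusField
  obtain ⟨-, -, -, b01, b02, b03⟩ := v.osc_fField_zero
  obtain ⟨-, -, -, b11, b12, b13⟩ := v.osc_fField_one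
  obtain ⟨hn₀, hx, hy, hκ, hρ, ⟨_, _, _, _, _, _⟩, ⟨_, _, _, _, _, _⟩, ⟨_, _, _, _, _, _⟩,
    ⟨_, _, _, _, _, _⟩⟩ := v.ne_zero_forms
  fin_cases i <;>
  · simp [coeff_contraction _ _ v.n_ne, a01, a02, a03, b01, b02, b03, b11, b12, b13,
      v.bracket_a, v.bracket_b, v.bracket_c, mul_pow, inv_pow, v.qpow_pow_two,
      v.qpow_pow_half, v.qpow_pow_r, v.qpow_pow_rs]
    try field_simp
    try ring

theorem coeff_contraction_f_psiMinus (v : ModeVars h k r rs n x y κ ρ) (i : Fin 2) :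
    PowerSeries.coeff n (contraction h k (fField h k r i) (bigPsiMinusField h k r rs)) =
      1 / n * (((qpow h 2)⁻¹ * qpow h (k / 2)) ^ n / (1 - qpow h (2 * r) ^ n) -
        (qpow h 2 * qpow h (k / 2)) ^ n / (1 - qpow h (2 * r) ^ n)) := by
  obtain ⟨a01, a02, a03, -, -, -⟩ := v.osc_fField_zero
  obtain ⟨a11, a12, a13, -, -, -⟩ := v.osc_fField_one
  obtain ⟨-, -, -, b01, b02, b03⟩ := v.osc_bigPsiMinusField
  obtain ⟨hn₀, hx, hy, hκ, hρ, ⟨_, _, _, _, _, _⟩, ⟨_, _, _, _, _, _⟩, ⟨_, _, _, _, _, _⟩,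
    ⟨_, _, _, _, _, _⟩⟩ := v.ne_zero_forms
  fin_cases i <;>
  · simp [coeff_contraction _ _ v.n_ne, a01, a02, a03, a11, a12, a13, b01, b02, b03,
      v.bracket_a, v.bracket_b, v.bracket_c, mul_pow, inv_pow, v.qpow_pow_two,
      v.qpow_pow_half, v.qpow_pow_r, v.qpow_pow_rs]
    try field_simp
    try ring

/-- The pairs of terms of `e(z) e(w)` differ in the linear factor `1 - d i j w / z` only. -/
theorem coeff_contraction_e_e (v : ModeVars h k r rs n x y κ ρ) (i : Fin 2) (j : Fin 2) :
    PowerSeries.coeff n (contraction h k (eField h k rs i) (eField h k rs j)) =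
      1 / n * ((qpow h 2) ^ n / (1 - qpow h (2 * rs) ^ n) -
        (qpow h (2 * rs) * (qpow h 2)⁻¹) ^ n / (1 - qpow h (2 * rs) ^ n) -
        (![![1, (qpow h 2)⁻¹], ![qpow h 2, 1]] i j) ^ n) := by
  obtain ⟨a01, a02, a03, -, -, -⟩ := v.osc_eField_zero
  obtain ⟨a11, a12, a13, -, -, -⟩ := v.osc_eField_one
  obtain ⟨-, -, -, b01, b02, b03⟩ := v.osc_eField_zero
  obtain ⟨-, -, -, b11, b12, b13⟩ := v.osc_eField_one
  obtain ⟨hn₀, hx, hy, hκ, hρ, ⟨_, _, _, _, _, _⟩, ⟨_, _, _, _, _, _⟩, ⟨_, _, _, _, _, _⟩,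
    ⟨_, _, _, _, _, _⟩⟩ := v.ne_zero_forms
  fin_cases i <;> fin_cases j <;>
  · simp [coeff_contraction _ _ v.n_ne, a01, a02, a03, a11, a12, a13, b01, b02, b03, b11, b12, b13,
      v.bracket_a, v.bracket_b, v.bracket_c, mul_pow, inv_pow, v.qpow_pow_two,
      v.qpow_pow_half, v.qpow_pow_r, v.qpow_pow_rs]
    try field_simp
    try ring

theorem coeff_contraction_f_f (v : ModeVars h k r rs n x y κ ρ) (i : Fin 2) (j : Fin 2) :
    PowerSeries.coeff n (contraction h k (fField h k r i) (fField h k r j)) =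
      1 / n * (((qpow h 2)⁻¹) ^ n / (1 - qpow h (2 * r) ^ n) -
        (qpow h (2 * r) * qpow h 2) ^ n / (1 - qpow h (2 * r) ^ n) -
        (![![1, (qpow h 2)⁻¹], ![qpow h 2, 1]] i j) ^ n) := by
  obtain ⟨a01, a02, a03, -, -, -⟩ := v.osc_fField_zero
  obtain ⟨a11, a12, a13, -, -, -⟩ := v.osc_fField_one
  obtain ⟨-, -, -, b01, b02, b03⟩ := v.osc_fField_zero
  obtain ⟨-, -, -, b11, b12, b13⟩ := v.osc_fField_one
  obtain ⟨hn₀, hx, hy, hκ, hρ, ⟨_, _, _, _, _, _⟩, ⟨_, _, _, _, _, _⟩, ⟨_, _, _, _, _, _⟩,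
    ⟨_, _, _, _, _, _⟩⟩ := v.ne_zero_forms
  fin_cases i <;> fin_cases j <;>
  · simp [coeff_contraction _ _ v.n_ne, a01, a02, a03, a11, a12, a13, b01, b02, b03, b11, b12, b13,
      v.bracket_a, v.bracket_b, v.bracket_c, mul_pow, inv_pow, v.qpow_pow_two,
      v.qpow_pow_half, v.qpow_pow_r, v.qpow_pow_rs]
    try field_simp
    try ring

/-- The contraction is `0` for `i = j`; otherwise its exponential has a single simple pole, at
`z = q ^ k w` or `z = q ^ (-k) w`. -/
theorem coeff_contraction_e_f (v : ModeVars h k r rs n x y κ ρ) (i : Fin 2) (j : Fin 2) :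
    PowerSeries.coeff n (contraction h k (eField h k rs i) (fField h k r j)) =
      1 / n * ((![![0, qpow h (k / 2) * qpow h (k / 2)],
          ![(qpow h (k / 2) * qpow h (k / 2))⁻¹, 0]] i j) ^ n -
        (![![0, qpow h (k / 2) * qpow h (k / 2) * qpow h 2],
          ![(qpow h (k / 2) * qpow h (k / 2) * qpow h 2)⁻¹, 0]] i j) ^ n) := by
  obtain ⟨a01, a02, a03, -, -, -⟩ := v.osc_eField_zero
  obtain ⟨a11, a12, a13, -, -, -⟩ := v.osc_eField_one
  obtain ⟨-, -, -, b01, b02, b03⟩ := v.osc_fField_zero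
  obtain ⟨-, -, -, b11, b12, b13⟩ := v.osc_fField_one
  obtain ⟨hn₀, hx, hy, hκ, hρ, ⟨_, _, _, _, _, _⟩, ⟨_, _, _, _, _, _⟩, ⟨_, _, _, _, _, _⟩,
    ⟨_, _, _, _, _, _⟩⟩ := v.ne_zero_forms
  fin_cases i <;> fin_cases j <;>
  · simp [coeff_contraction _ _ v.n_ne, a01, a02, a03, a11, a12, a13, b01, b02, b03, b11, b12, b13,
      v.bracket_a, v.bracket_b, v.bracket_c, mul_pow, inv_pow, v.qpow_pow_two,
      v.qpow_pow_half, v.qpow_pow_r, v.qpow_pow_rs]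
    try field_simp
    try ring

theorem coeff_contraction_f_e (v : ModeVars h k r rs n x y κ ρ) (i : Fin 2) (j : Fin 2) :
    PowerSeries.coeff n (contraction h k (fField h k r i) (eField h k rs j)) =
      1 / n * ((![![0, qpow h (k / 2) * qpow h (k / 2)],
          ![(qpow h (k / 2) * qpow h (k / 2))⁻¹, 0]] i j) ^ n -
        (![![0, qpow h (k / 2) * qpow h (k / 2) * qpow h 2],
          ![(qpow h (k / 2) * qpow h (k / 2) * qpow h 2)⁻¹, 0]] i j) ^ n) := by
  obtain ⟨a01, a02, a03, -, -, -⟩ := v.osc_fField_zero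
  obtain ⟨a11, a12, a13, -, -, -⟩ := v.osc_fField_one
  obtain ⟨-, -, -, b01, b02, b03⟩ := v.osc_eField_zero
  obtain ⟨-, -, -, b11, b12, b13⟩ := v.osc_eField_one
  obtain ⟨hn₀, hx, hy, hκ, hρ, ⟨_, _, _, _, _, _⟩, ⟨_, _, _, _, _, _⟩, ⟨_, _, _, _, _, _⟩,
    ⟨_, _, _, _, _, _⟩⟩ := v.ne_zero_forms
  fin_cases i <;> fin_cases j <;>
  · simp [coeff_contraction _ _ v.n_ne, a01, a02, a03, a11, a12, a13, b01, b02, b03, b11, b12, b13,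
      v.bracket_a, v.bracket_b, v.bracket_c, mul_pow, inv_pow, v.qpow_pow_two,
      v.qpow_pow_half, v.qpow_pow_r, v.qpow_pow_rs]
    try field_simp
    try ring

end ModeVars

end

/-! ### Meromorphic continuation of the contractions -/

section

theorem qPoch_zero_mul (x t : ℂ) : qPoch (0 * x) t = 1 := by rw [zero_mul, qPoch_zero_left]

theorem expSumsTo_ratio {γ : PowerSeries ℂ} (h0 : PowerSeries.coeff 0 γ = 0) {α β t : ℂ}
    (ht : ‖t‖ < 1) (hγ : ∀ n : ℕ, n ≠ 0 → PowerSeries.coeff n γ =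
      1 / n * (β ^ n / (1 - t ^ n) - α ^ n / (1 - t ^ n))) :
    ExpSumsTo γ (fun x => qPoch (α * x) t) (fun x => qPoch (β * x) t) := by
  have := expSumsTo_qPoch h0 (a₁ := α) (a₂ := 0) (b₁ := β) (b₂ := 0) ht
    (s₂ := 0) (by simp) ht (t₂ := 0) (by simp)
    fun n hn => by rw [hγ n hn, zero_pow hn]; ring
  simpa only [qPoch_zero_mul, mul_one] using this

theorem expSumsTo_ratio_mul_linear {γ : PowerSeries ℂ} (h0 : PowerSeries.coeff 0 γ = 0)
    {α β t d : ℂ} (ht : ‖t‖ < 1) (hγ : ∀ n : ℕ, n ≠ 0 → PowerSeries.coeff n γ =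
      1 / n * (β ^ n / (1 - t ^ n) - α ^ n / (1 - t ^ n) - d ^ n)) :
    ExpSumsTo γ (fun x => qPoch (α * x) t * (1 - d * x)) (fun x => qPoch (β * x) t) := by
  have := expSumsTo_qPoch h0 (a₁ := α) (a₂ := d) (b₁ := β) (b₂ := 0) ht
    (s₂ := 0) (by simp) ht (t₂ := 0) (by simp)
    fun n hn => by rw [hγ n hn, zero_pow hn, sub_zero, div_one]; ring
  simpa only [qPoch_zero_mul, qPoch_zero_right, zero_mul, sub_zero, mul_one] using this

/-! ### Theta function identities -/

variable {t : ℂ}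

/-- With `u = z / w`, the function `(α x; t) / (β x; t)` at `x = w / z` divided by the reflected one
`(t β⁻¹ x; t) / (t α⁻¹ x; t)` at `x = z / w`, with the denominators cleared. -/
theorem theta_inv_mul_relation (ht : ‖t‖ < 1) {α β u : ℂ} (hα : α ≠ 0) (hβ : β ≠ 0)
    (hu : u ≠ 0) :
    β * (qPoch (α * u⁻¹) t * qPoch (t * α⁻¹ * u) t * theta t (β⁻¹ * u)) =
      α * (theta t (α⁻¹ * u) * qPoch (t * β⁻¹ * u) t * qPoch (β * u⁻¹) t) := by
  rw [theta, theta, qPoch_eq_mul (α * u⁻¹) ht, qPoch_eq_mul (β⁻¹ * u) ht,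
    qPoch_eq_mul (α⁻¹ * u) ht, qPoch_eq_mul (β * u⁻¹) ht]
  rw [show t * (β⁻¹ * u)⁻¹ = β * u⁻¹ * t by rw [mul_inv, inv_inv]; ring,
    show t * (α⁻¹ * u)⁻¹ = α * u⁻¹ * t by rw [mul_inv, inv_inv]; ring,
    show t * α⁻¹ * u = α⁻¹ * u * t by ring, show t * β⁻¹ * u = β⁻¹ * u * t by ring]
  have e : β * ((1 - α * u⁻¹) * (1 - β⁻¹ * u)) = α * ((1 - α⁻¹ * u) * (1 - β * u⁻¹)) := by
    field_simp
    ring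
  linear_combination qPoch (α * u⁻¹ * t) t * qPoch (α⁻¹ * u * t) t * qPoch (β⁻¹ * u * t) t *
    qPoch (β * u⁻¹ * t) t * qPoch t t * e

/-- The variant of `theta_inv_mul_relation` with the factor `t` in the other of the two
functions. -/
theorem theta_inv_mul_relation' {α β u : ℂ} :
    qPoch (t * α * u⁻¹) t * qPoch (α⁻¹ * u) t * theta t (β⁻¹ * u) =
      theta t (α⁻¹ * u) * qPoch (β⁻¹ * u) t * qPoch (t * β * u⁻¹) t := by
  rw [theta, theta, mul_inv, mul_inv, inv_inv, inv_inv, mul_assoc t α, mul_assoc t β]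
  ring

/-- The relation for the contraction functions of two of the currents `Ψ^±`. -/
theorem theta_reflection_relation {s : ℂ} (ht : ‖t‖ < 1) (hs : ‖s‖ < 1) {α u : ℂ} :
    qPoch (α⁻¹ * u⁻¹) s * qPoch (α * u⁻¹) t * (qPoch (α * u) s * qPoch (α⁻¹ * u) t) *
        (theta t (α * u) * theta s (α⁻¹ * u)) =
      theta t (α⁻¹ * u) * theta s (α * u) * (qPoch (α⁻¹ * u) s * qPoch (α * u) t) *
        (qPoch (α * u⁻¹) s * qPoch (α⁻¹ * u⁻¹) t) := by
  simp only [theta, mul_inv, inv_inv]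
  rw [qPoch_eq_mul (α⁻¹ * u⁻¹) ht, qPoch_eq_mul (α * u⁻¹) ht, qPoch_eq_mul (α⁻¹ * u⁻¹) hs,
    qPoch_eq_mul (α * u⁻¹) hs, mul_comm t, mul_comm t, mul_comm s, mul_comm s]
  ring

/-- The relation for contractions with linear factors `1 - d x` and `1 - d' x`, which cancel against
the zero mode factors `a` and `b`. -/
theorem theta_linear_relation (ht : ‖t‖ < 1) {α u a b d d' : ℂ} (hα : α ≠ 0) (hu : u ≠ 0)
    (hab : a * (d - u) = b * (1 - d' * u)) :
    a * (qPoch (t * α⁻¹ * u⁻¹) t * (1 - d * u⁻¹)) * qPoch (α * u) t * theta t (α⁻¹ * u) =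
      α⁻¹ * theta t (α * u) * (b * (qPoch (t * α⁻¹ * u) t * (1 - d' * u))) *
        qPoch (α * u⁻¹) t := by
  rw [theta, theta, mul_inv, mul_inv, inv_inv, qPoch_eq_mul (α * u⁻¹) ht,
    qPoch_eq_mul (α⁻¹ * u) ht, mul_comm t (α * u⁻¹), ← mul_assoc t,
    show t * α⁻¹ * u = α⁻¹ * u * t by ring]
  have e : a * (1 - d * u⁻¹) * (1 - α⁻¹ * u) = α⁻¹ * b * (1 - d' * u) * (1 - α * u⁻¹) := by
    rw [mul_assoc α⁻¹, ← hab]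
    field_simp
    ring
  linear_combination qPoch (t * α⁻¹ * u⁻¹) t * qPoch (α * u) t * qPoch (α⁻¹ * u * t) t *
    qPoch (α * u⁻¹ * t) t * qPoch t t * e

end

/-! ### The currents as combinations of vertex operators -/

section

variable {h : ℂ} {k r rs : ℝ}

/-- The label after the action of `e(z)`; it determines the label before it. -/
def Charge.lower (χ : Charge) : Charge := ⟨χ.l, χ.m₁ - 1, χ.m₂ - 1⟩

/-- The label after the action of `f(z)`. -/
def Charge.raise (χ : Charge) : Charge := ⟨χ.l, χ.m₁ + 1, χ.m₂ + 1⟩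

theorem Charge.lower_raise (χ : Charge) : χ.raise.lower = χ := by
  ext <;> simp [Charge.lower, Charge.raise]

theorem Charge.raise_lower (χ : Charge) : χ.lower.raise = χ := by
  ext <;> simp [Charge.lower, Charge.raise]

theorem contraction_eq_zero {X Y : LinField}
    (hXY : ∀ i (n : ℕ), n ≠ 0 → X.osc i n * Y.osc i (-(n : ℤ)) = 0) :
    contraction h k X Y = 0 := by
  ext n
  rcases eq_or_ne n 0 with rfl | hn
  · rw [coeff_zero_contraction, map_zero]
  · rw [coeff_contraction _ _ hn, hXY _ _ hn, hXY _ _ hn, hXY _ _ hn]; simp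

theorem ActsAs.finite_support_fmul {A B : FormalField} {χ χ' χ'' : Charge} {a b : ℂ}
    {X Y : LinField} {e e' : ℤ} (hA : ActsAs h k A χ' χ'' a X e) (hB : ActsAs h k B χ χ' b Y e')
    (hXY : contraction h k X Y = 0) (m : ℤ) (v : Fock) :
    (Function.support fun i : ℤ => A i (B (m - i) (Finsupp.single χ v))).Finite := by
  refine (finite_support_vertexOp_vertexOp hXY (-e) (m - e') v).subset fun i hi hi' => hi ?_
  simp only at hi' ⊢
  rw [hB, hA, map_smul, neg_add_eq_sub] at *
  rw [sub_right_comm, hi', smul_zero, smul_zero, Finsupp.single_zero]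

theorem ActsAs.fmul_qdiff {U : FormalField} {A : Fin 2 → FormalField} {χ χ' χ'' : Charge}
    {u : ℂ} {a : Fin 2 → ℂ} {X : LinField} {Y : Fin 2 → LinField} {e e' : ℤ}
    (hU : ActsAs h k U χ' χ'' u X e) (hA : ∀ i, ActsAs h k (A i) χ χ' (a i) (Y i) e')
    (hXY : ∀ i, contraction h k X (Y i) = 0) :
    ActsAsSum h k (EllipticCurrents.fmul U (qdiff h (A 0) (A 1))) χ χ''
      (fun i => -1 / (qpow h 1 - qpow h (-1)) * (![1, -1] i * (u * a i))) (fun i => X + Y i)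
      (e + e' - 1) := by
  intro m v
  have h1 : ∀ i : ℤ, U i (qdiff h (A 0) (A 1) (m - i) (Finsupp.single χ v)) =
      (-1 / (qpow h 1 - qpow h (-1))) • (U i (A 0 (m + 1 - i) (Finsupp.single χ v)) -
        U i (A 1 (m + 1 - i) (Finsupp.single χ v))) := by
    intro i
    rw [qdiff, hA, hA, ← Finsupp.single_sub, Finsupp.smul_single, hU, hA, hA, hU, hU,
      ← Finsupp.single_sub, Finsupp.smul_single, map_smul, map_sub, smul_comm, smul_sub,
      show m - i + 1 = m + 1 - i by ring]
  have h2 := ((hU.fmul (hA 0) (hXY 0)) (m + 1) v)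
  have h3 := ((hU.fmul (hA 1) (hXY 1)) (m + 1) v)
  rw [EllipticCurrents.fmul] at h2 h3
  rw [EllipticCurrents.fmul, finsum_congr h1, ← smul_finsum, finsum_sub_distrib
    (hU.finite_support_fmul (hA 0) (hXY 0) _ _) (hU.finite_support_fmul (hA 1) (hXY 1) _ _),
    h2, h3, ← Finsupp.single_sub, Finsupp.smul_single, Fin.sum_univ_two]
  simp only [Matrix.cons_val_zero, Matrix.cons_val_one, smul_sub, smul_smul]
  rw [show m + 1 - (e + e') = m - (e + e' - 1) by ring, sub_eq_add_neg, ← neg_smul]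
  congr 4 <;> ring

theorem ActsAs.qdiff_fmul {U : FormalField} {A : Fin 2 → FormalField} {χ χ' χ'' : Charge}
    {u : ℂ} {a : Fin 2 → ℂ} {X : LinField} {Y : Fin 2 → LinField} {e e' : ℤ}
    (hU : ActsAs h k U χ χ' u X e) (hA : ∀ i, ActsAs h k (A i) χ' χ'' (a i) (Y i) e')
    (hXY : ∀ i, contraction h k (Y i) X = 0) :
    ActsAsSum h k (EllipticCurrents.fmul (qdiff h (A 0) (A 1)) U) χ χ''
      (fun i => -1 / (qpow h 1 - qpow h (-1)) * (![1, -1] i * (a i * u))) (fun i => Y i + X)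
      (e' + e - 1) := by
  intro m v
  have h2 := (((hA 0).fmul hU (hXY 0)) (m + 1) v)
  have h3 := (((hA 1).fmul hU (hXY 1)) (m + 1) v)
  rw [EllipticCurrents.fmul] at h2 h3
  have h1 : ∑ᶠ i : ℤ, qdiff h (A 0) (A 1) i (U (m - i) (Finsupp.single χ v)) =
      ∑ᶠ i : ℤ, (-1 / (qpow h 1 - qpow h (-1))) • (A 0 i (U (m + 1 - i) (Finsupp.single χ v)) -
        A 1 i (U (m + 1 - i) (Finsupp.single χ v))) := by
    refine Eq.trans (finsum_congr fun i => ?_) (finsum_comp_equiv (Equiv.addRight 1))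
    rw [qdiff, Equiv.coe_addRight, add_sub_add_right_eq_sub]
  rw [EllipticCurrents.fmul, h1, ← smul_finsum, finsum_sub_distrib
    ((hA 0).finite_support_fmul hU (hXY 0) _ _) ((hA 1).finite_support_fmul hU (hXY 1) _ _),
    h2, h3, ← Finsupp.single_sub, Finsupp.smul_single, Fin.sum_univ_two]
  simp only [Matrix.cons_val_zero, Matrix.cons_val_one, smul_sub, smul_smul]
  rw [show m + 1 - (e' + e) = m - (e' + e - 1) by ring, sub_eq_add_neg, ← neg_smul]
  congr 4 <;> ring

theorem LinField.add_q (X Y : LinField) (i : Boson) : (X + Y).q i = X.q i + Y.q i := rfl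

theorem LinField.add_pConst (X Y : LinField) (i : Boson) :
    (X + Y).pConst i = X.pConst i + Y.pConst i := rfl

theorem LinField.add_pLog (X Y : LinField) (i : Boson) :
    (X + Y).pLog i = X.pLog i + Y.pLog i := rfl

theorem LinField.sub_q (X Y : LinField) (i : Boson) : (X - Y).q i = X.q i - Y.q i := rfl

theorem LinField.sub_pConst (X Y : LinField) (i : Boson) :
    (X - Y).pConst i = X.pConst i - Y.pConst i := rfl

theorem LinField.sub_pLog (X Y : LinField) (i : Boson) :
    (X - Y).pLog i = X.pLog i - Y.pLog i := rfl

theorem actsAs_normalExp_of_eq {X : LinField} {χ χ' : Charge} {e : ℤ} {c : ℂ}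
    (he : ∑ i : Boson, X.pLog i * χ.p i = e)
    (hc : ∑ i : Boson, X.pConst i * χ.p i = c * h) (hχ : χ.shift k X.q = χ') :
    ActsAs h k (normalExp h k X) χ χ' (qpow h c) X e := by
  have := actsAs_normalExp (h := h) (k := k) he
  rwa [hc, hχ] at this

set_option linter.unusedSimpArgs false

theorem actsAs_uPlus (χ : Charge) : ActsAs h k (UPlus h k rs) χ χ 1 (uPlusField h k rs) 0 := by
  rw [← qpow_zero (h := h)]
  refine actsAs_normalExp_of_eq ?_ ?_ ?_
  · simp [LinField.add_pLog, LinField.scale, starMinus]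
  · simp [LinField.add_pConst, LinField.scale, starMinus]
  · ext <;> simp [Charge.shift, LinField.add_q, LinField.scale, starMinus]

theorem actsAs_uMinus (χ : Charge) : ActsAs h k (UMinus h k r) χ χ 1 (uMinusField h k r) 0 := by
  rw [← qpow_zero (h := h)]
  refine actsAs_normalExp_of_eq ?_ ?_ ?_
  · simp [LinField.add_pLog, LinField.scale, starPlus]
  · simp [LinField.add_pConst, LinField.scale, starPlus]
  · ext <;> simp [Charge.shift, LinField.add_q, LinField.scale, starPlus]

/-- The eigenvalue of `p_a + 2 p_b`, the zero mode in the exponents of `Ψ^±(z)` up to sign. -/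
def Charge.weight (χ : Charge) : ℂ := χ.l - 2 * χ.m₁

theorem actsAs_psiPlus (χ : Charge) :
    ActsAs h k (psiPlus h k) χ χ (qpow h χ.weight) (psiPlusField h k) 0 := by
  refine actsAs_normalExp_of_eq ?_ ?_ ?_
  · simp [LinField.add_pLog, LinField.scale, plus]
  · simp [sum_boson, Charge.p, Charge.weight, LinField.add_pConst, LinField.scale, plus]
    ring
  · ext <;> simp [Charge.shift, LinField.add_q, LinField.scale, plus]

theorem actsAs_psiMinus (χ : Charge) :
    ActsAs h k (psiMinus h k) χ χ (qpow h (-χ.weight)) (psiMinusField h k) 0 := by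
  refine actsAs_normalExp_of_eq ?_ ?_ ?_
  · simp [LinField.add_pLog, LinField.scale, minus]
  · simp [sum_boson, Charge.p, Charge.weight, LinField.add_pConst, LinField.scale, minus]
    ring
  · ext <;> simp [Charge.shift, LinField.add_q, LinField.scale, minus]

/-- The two terms of `e^+(z)`. -/
def ePlusTerm (h : ℂ) (k : ℝ) (i : Fin 2) : FormalField := normalExp h k (ePlusField h i)

/-- The two terms of `e^-(z)`. -/
def eMinusTerm (h : ℂ) (k : ℝ) (i : Fin 2) : FormalField := normalExp h k (eMinusField h k i)

/-- The zero mode factors of the two terms of `e^+(z)`. -/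
def ePlusConst (h : ℂ) (χ : Charge) : Fin 2 → ℂ := ![qpow h (-χ.m₂), qpow h χ.m₂]

/-- The zero mode factors of the two terms of `e^-(z)`. -/
def eMinusConst (h : ℂ) (k : ℝ) (χ : Charge) : Fin 2 → ℂ :=
  ![qpow h (-((k + 1) * (χ.m₂ - χ.m₁) + χ.l - χ.m₁)),
    qpow h ((k + 1) * (χ.m₂ - χ.m₁) + χ.l - χ.m₁)]

theorem actsAs_ePlusTerm {χ : Charge} {d : ℤ} (hd : χ.m₂ - χ.m₁ = d) (i : Fin 2) :
    ActsAs h k (ePlusTerm h k i) χ χ.lower (ePlusConst h χ i) (ePlusField h i) (-d) := by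
  fin_cases i <;> refine actsAs_normalExp_of_eq ?_ ?_ ?_
  all_goals first
    | ext <;> simp [Charge.shift, Charge.lower, ePlusField, fullBC, LinField.add_q,
        LinField.sub_q, LinField.scale, plus, minus, full, sub_eq_add_neg]
    | push_cast
      simp [sum_boson, ← hd, Charge.p, ePlusField, fullBC, LinField.add_pConst,
        LinField.sub_pConst, LinField.add_pLog, LinField.sub_pLog, LinField.scale, plus, minus,
        full]
      try ring

theorem actsAs_eMinusTerm {χ : Charge} {d : ℤ} (hd : χ.m₂ - χ.m₁ = d) (i : Fin 2) :
    ActsAs h k (eMinusTerm h k i) χ χ.raise (eMinusConst h k χ i) (eMinusField h k i) d := by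
  fin_cases i <;> refine actsAs_normalExp_of_eq ?_ ?_ ?_
  all_goals first
    | ext <;> simp [Charge.shift, Charge.raise, eMinusField, fullBC, LinField.add_q,
        LinField.sub_q, LinField.scale, plus, minus, full, sub_eq_add_neg]
    | simp [sum_boson, ← hd, Charge.p, eMinusField, fullBC, LinField.add_pConst,
        LinField.sub_pConst, LinField.add_pLog, LinField.sub_pLog, LinField.scale, plus, minus,
        full]
      try ring

theorem osc_uPlusField (i : Boson) (n : ℕ) : (uPlusField h k rs).osc i n = 0 := by
  have hn : ¬ ((n : ℤ) < 0) := by omega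
  simp [uPlusField, osc_add, osc_scale, osc_starMinus, hn]

theorem osc_uMinusField (i : Boson) (n : ℕ) : (uMinusField h k r).osc i (-(n : ℤ)) = 0 := by
  have hn : ¬ ((n : ℤ) < 0) := by omega
  simp [uMinusField, osc_add, osc_scale, osc_starPlus, hn]

theorem contraction_uPlusField_scale (s : ℂ) (Y : LinField) :
    contraction h k ((uPlusField h k rs).scale h s) Y = 0 :=
  contraction_eq_zero fun i n _ => by rw [osc_scale, osc_uPlusField]; simp

theorem contraction_uMinusField_scale (s : ℂ) (X : LinField) :
    contraction h k X ((uMinusField h k r).scale h s) = 0 :=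
  contraction_eq_zero fun i n _ => by rw [osc_scale, osc_uMinusField]; simp

theorem actsAs_PsiPlus (χ : Charge) :
    ActsAs h k (PsiPlus h k r rs) χ χ (qpow h χ.weight) (bigPsiPlusField h k r rs) 0 := by
  have := ((actsAs_uPlus χ).fscale (k / 2)).fmul ((actsAs_psiPlus χ).fmul
    ((actsAs_uMinus (h := h) (k := k) (r := r) χ).fscale (-(k / 2)))
    (contraction_uMinusField_scale _ _)) (contraction_uPlusField_scale (rs := rs) _ _)
  simp only [Int.cast_zero, mul_zero, qpow_zero, one_mul, mul_one, add_zero] at this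
  exact this

theorem actsAs_PsiMinus (χ : Charge) :
    ActsAs h k (PsiMinus h k r rs) χ χ (qpow h (-χ.weight)) (bigPsiMinusField h k r rs) 0 := by
  have := ((actsAs_uPlus χ).fscale (-(k / 2))).fmul ((actsAs_psiMinus χ).fmul
    ((actsAs_uMinus (h := h) (k := k) (r := r) χ).fscale (k / 2))
    (contraction_uMinusField_scale _ _)) (contraction_uPlusField_scale (rs := rs) _ _)
  simp only [Int.cast_zero, mul_zero, qpow_zero, one_mul, mul_one, add_zero] at this
  exact this

theorem actsAsSum_eCurrent {χ : Charge} {d : ℤ} (hd : χ.m₂ - χ.m₁ = d) :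
    ActsAsSum h k (eCurrent h k rs) χ χ.lower
      (fun i => -1 / (qpow h 1 - qpow h (-1)) * (![1, -1] i * ePlusConst h χ i))
      (eField h k rs) (-d - 1) := by
  have := ActsAs.fmul_qdiff (actsAs_uPlus (rs := rs) χ.lower)
    (actsAs_ePlusTerm (h := h) (k := k) hd) fun i => contraction_eq_zero fun j n _ => by
      rw [osc_uPlusField, zero_mul]
  simp only [one_mul, zero_add] at this
  exact this

theorem actsAsSum_fCurrent {χ : Charge} {d : ℤ} (hd : χ.m₂ - χ.m₁ = d) :
    ActsAsSum h k (fCurrent h k r) χ χ.raise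
      (fun i => -1 / (qpow h 1 - qpow h (-1)) * (![1, -1] i * eMinusConst h k χ i))
      (fField h k r) (d - 1) := by
  have := ActsAs.qdiff_fmul (actsAs_uMinus (r := r) χ)
    (actsAs_eMinusTerm (h := h) (k := k) hd) fun i => contraction_eq_zero fun j n _ => by
      rw [osc_uMinusField, mul_zero]
  simp only [mul_one, add_zero] at this
  exact this

end

/-! ### The commutator of `e(z)` and `f(w)` -/

section

theorem one_sub_mul_geometric (α : ℂ) :
    (1 - PowerSeries.C α * PowerSeries.X) * PowerSeries.mk (fun n => α ^ n) = 1 := by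
  ext n
  rw [sub_mul, one_mul, map_sub, mul_assoc, PowerSeries.coeff_C_mul, PowerSeries.coeff_one]
  cases n with
  | zero => simp
  | succ n => rw [PowerSeries.coeff_succ_X_mul]; simp [pow_succ']

theorem coeffMap_eulerCoeff_one_sub (α : ℂ) :
    coeffMap eulerCoeff (1 - PowerSeries.C α * PowerSeries.X : PowerSeries ℂ) =
      -(PowerSeries.C α * PowerSeries.X) := by
  ext n
  rw [coeff_coeffMap, map_sub, map_neg, PowerSeries.coeff_C_mul, PowerSeries.coeff_one,
    PowerSeries.coeff_X]
  rcases eq_or_ne n 0 with rfl | h0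
  · simp [eulerCoeff]
  rcases eq_or_ne n 1 with rfl | h1
  · simp [eulerCoeff]
  · simp [eulerCoeff, h0, h1]

/-- `exp (∑ (α ^ n - β ^ n) x ^ n / n) = (1 - β x) / (1 - α x)`. -/
theorem coeff_psExp_of_sub_pow {γ : PowerSeries ℂ} (h0 : PowerSeries.coeff 0 γ = 0) {α β : ℂ}
    (hγ : ∀ n : ℕ, n ≠ 0 → PowerSeries.coeff n γ = 1 / n * (α ^ n - β ^ n)) (n : ℕ) :
    PowerSeries.coeff n (psExp γ) = if n = 0 then 1 else α ^ (n - 1) * (α - β) := by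
  set A : PowerSeries ℂ := PowerSeries.mk fun n => α ^ n with hA
  set B : PowerSeries ℂ := PowerSeries.mk fun n => β ^ n with hB
  set a : PowerSeries ℂ := PowerSeries.C α * PowerSeries.X with ha
  set b : PowerSeries ℂ := PowerSeries.C β * PowerSeries.X with hb
  have eA : (1 - a) * A = 1 := one_sub_mul_geometric α
  have eB : (1 - b) * B = 1 := one_sub_mul_geometric β
  have dA : coeffMap eulerCoeff A = a * A * A := by
    have h1 := congrArg (coeffMap eulerCoeff) eA
    have h2 : coeffMap (eulerCoeff (R := ℂ)) 1 = 0 := by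
      have := coeffMap_eulerCoeff_one_sub 0
      simpa using this
    rw [coeffMap_mul gradedLeibniz_eulerCoeff, coeffMap_eulerCoeff_one_sub, h2] at h1
    linear_combination A * h1 - coeffMap eulerCoeff A * eA
  have hC : coeffMap eulerCoeff γ = A - B := by
    ext n
    rw [coeff_coeffMap, map_sub, hA, hB, PowerSeries.coeff_mk, PowerSeries.coeff_mk]
    rcases eq_or_ne n 0 with rfl | hn
    · simp [eulerCoeff]
    · have hn' : (n : ℂ) ≠ 0 := Nat.cast_ne_zero.2 hn
      rw [hγ n hn]
      simp [eulerCoeff, hn']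
  have key : (1 - b) * A = psExp γ := by
    refine psExp_unique h0 (fun _ _ => Commute.all _ _) ?_ ?_
    · rw [coeffMap_mul gradedLeibniz_eulerCoeff, coeffMap_eulerCoeff_one_sub, dA, hC]
      linear_combination -((1 - b) * A) * eA + A * eB
    · simp [hA, hb]
  rw [← key, sub_mul, one_mul, map_sub, hb, mul_assoc, PowerSeries.coeff_C_mul]
  cases n with
  | zero => simp [hA]
  | succ n => rw [PowerSeries.coeff_succ_X_mul]; simp [hA, pow_succ]; ring

variable {h : ℂ} {k r rs : ℝ}

theorem finsum_comp_of_support_subset {ι κ M : Type*} [AddCommMonoid M] {g : ι → κ}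
    (hg : Function.Injective g) {F : κ → M} (hF : ∀ t, t ∉ Set.range g → F t = 0) :
    ∑ᶠ i, F (g i) = ∑ᶠ t, F t := by
  rw [← finsum_mem_range hg, finsum_mem_def]
  refine finsum_congr fun t => ?_
  by_cases ht : t ∈ Set.range g
  · rw [Set.indicator_of_mem ht]
  · rw [Set.indicator_of_notMem ht, hF t ht]

/-- The two expansions of a contraction with a simple pole at `z = α w` differ by a delta function,
on whose support the product of the two vertex operators becomes a single one. -/
theorem vertexOp_commutator {X Y : LinField} {σ ω : ℂ} (hω : ω ≠ 0)
    (hXY : ∀ n : ℕ, n ≠ 0 → PowerSeries.coeff n (contraction h k X Y) =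
      1 / n * (qpow h σ ^ n - (qpow h σ * ω ^ 2) ^ n))
    (hYX : ∀ n : ℕ, n ≠ 0 → PowerSeries.coeff n (contraction h k Y X) =
      1 / n * ((qpow h σ)⁻¹ ^ n - (qpow h σ * ω ^ 2)⁻¹ ^ n)) (M N : ℤ) (v : Fock) :
    ω⁻¹ • vertexOp h k X M (vertexOp h k Y N v) - ω • vertexOp h k Y N (vertexOp h k X M v) =
      ((ω⁻¹ - ω) * qpow h (σ * N)) • vertexOp h k (X + Y.scale h (-σ)) (M + N) v := by
  set α := qpow h σ with hα
  have hα0 : α ≠ 0 := qpow_ne_zero _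
  have hfin : ∀ c : ℤ → ℂ,
      (Function.support fun s => c s • normalPair h k X Y (M + s) (N - s) v).Finite := fun c =>
    (finite_support_normalPair (h := h) (k := k) X Y M N v).subset
      fun s hs hs' => hs (by simp only at hs' ⊢; rw [hs', smul_zero])
  have hright : vertexOp h k (X + Y.scale h (-σ)) (M + N) v =
      ∑ᶠ s : ℤ, (α⁻¹ ^ N * α ^ s) • normalPair h k X Y (M + s) (N - s) v := by
    rw [vertexOp_add, ← finsum_comp_equiv (Equiv.addLeft M)]
    refine finsum_congr fun s => ?_
    rw [Equiv.coe_addLeft, normalPair_scale_right, add_sub_add_left_eq_sub, neg_mul, qpow_neg,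
      qpow_mul_intCast, ← hα, zpow_sub₀ hα0, inv_zpow]
    congr 1
    rw [inv_div, div_eq_inv_mul]
  -- Both products as sums over all integers, with the coefficients extended by zero.
  have h1 : vertexOp h k X M (vertexOp h k Y N v) = ∑ᶠ s : ℤ,
      (if s < 0 then 0 else if s = 0 then 1 else α ^ (s - 1) * (α - α * ω ^ 2)) •
        normalPair h k X Y (M + s) (N - s) v := by
    rw [vertexOp_vertexOp, ← finsum_comp_of_support_subset (g := fun s : ℕ => (s : ℤ))
      (fun a b e => Int.ofNat.inj e)]
    · refine finsum_congr fun s => ?_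
      rw [coeff_psExp_of_sub_pow (coeff_zero_contraction _ _) hXY]
      congr 1
      cases s with
      | zero => simp
      | succ s =>
        rw [if_neg (by omega), if_neg (by omega), if_neg (by omega)]
        simp
    · intro t ht
      rw [if_pos, zero_smul]
      by_contra h0
      exact ht ⟨t.toNat, by simp only; omega⟩
  have h2 : vertexOp h k Y N (vertexOp h k X M v) = ∑ᶠ s : ℤ,
      (if 0 < s then 0 else if s = 0 then 1 else α ^ (s + 1) * (α⁻¹ - (α * ω ^ 2)⁻¹)) •
        normalPair h k X Y (M + s) (N - s) v := by
    rw [vertexOp_vertexOp, ← finsum_comp_of_support_subset (g := fun s : ℕ => -(s : ℤ))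
      (fun a b e => Int.ofNat.inj (neg_injective e))]
    · refine finsum_congr fun s => ?_
      rw [coeff_psExp_of_sub_pow (coeff_zero_contraction _ _) hYX, normalPair_comm,
        sub_neg_eq_add, ← sub_eq_add_neg]
      congr 1
      cases s with
      | zero => simp
      | succ s =>
        rw [if_neg (by omega), if_neg (by omega), if_neg (by omega)]
        simp
    · intro t ht
      rw [if_pos, zero_smul]
      by_contra h0
      exact ht ⟨(-t).toNat, by simp only; omega⟩
  rw [h1, h2, hright, smul_finsum, smul_finsum, smul_finsum, ← finsum_sub_distrib]
  · refine finsum_congr fun s => ?_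
    rw [smul_smul, smul_smul, smul_smul, ← sub_smul]
    congr 1
    have hN : qpow h (σ * N) * (α⁻¹ ^ N * α ^ s) = α ^ s := by
      rw [qpow_mul_intCast, ← hα, ← mul_assoc, ← mul_zpow, mul_inv_cancel₀ hα0, one_zpow, one_mul]
    rw [mul_assoc, hN]
    rcases lt_trichotomy s 0 with hs | rfl | hs
    · rw [if_pos hs, if_neg hs.not_gt, if_neg hs.ne, zpow_add_one₀ hα0]
      field_simp
      ring
    · simp
    · rw [if_neg hs.not_gt, if_neg hs.ne', if_pos hs, zpow_sub_one₀ hα0]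
      field_simp
      ring
  · simp only [smul_smul]
    exact hfin _
  · simp only [smul_smul]
    exact hfin _

end

section

variable {h : ℂ} {k r rs : ℝ}

/-- On the support `w = q ^ (-k) z` of the first delta function, the exponents of `e(z)` and `f(w)`
add up to that of `Ψ^+(q ^ (-k/2) z)`. -/
theorem vertexOp_eField_add_fField (hre : h.re < 0) (hr : 0 < r) (hrs : 0 < rs)
    (hrc : rs = r - k) (L : ℤ) :
    vertexOp h k (eField h k rs 0 + (fField h k r 1).scale h (-k)) L =
      vertexOp h k ((bigPsiPlusField h k r rs).scale h (-(k / 2))) L := by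
  refine vertexOp_congr (fun i n hn => ?_) (fun i n hn => ?_) L
  all_goals
    obtain ⟨x, y, κ, ρ, v⟩ := exists_modeVars hre hr hrs hrc hn
    obtain ⟨a1, a2, a3, a4, a5, a6⟩ := v.osc_eField_zero
    obtain ⟨b1, b2, b3, b4, b5, b6⟩ := v.osc_fField_one
    obtain ⟨c1, c2, c3, c4, c5, c6⟩ := v.osc_bigPsiPlusField
    obtain ⟨hn₀, hx, hy, hκ, hρ, ⟨_, _, _, _, _, _⟩, ⟨_, _, _, _, _, _⟩, ⟨_, _, _, _, _, _⟩,
      ⟨_, _, _, _, _, _⟩⟩ := v.ne_zero_forms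
    cases i <;>
    · simp [osc_add, osc_scale, a1, a2, a3, a4, a5, a6, b1, b2, b3, b4, b5, b6, c1, c2, c3, c4,
        c5, c6, qpow_neg, v.qpow_k, v.κ_eq]
      try field_simp
      try ring

/-- On the support `z = q ^ (-k) w` of the second delta function, the exponents of `e(z)` and
`f(w)` add up to that of `Ψ^-(q ^ (-k/2) w) = Ψ^-(q ^ (k/2) z)`. -/
theorem vertexOp_eField_add_fField' (hre : h.re < 0) (hr : 0 < r) (hrs : 0 < rs)
    (hrc : rs = r - k) (L : ℤ) :
    vertexOp h k (eField h k rs 1 + (fField h k r 0).scale h k) L =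
      vertexOp h k ((bigPsiMinusField h k r rs).scale h (k / 2)) L := by
  refine vertexOp_congr (fun i n hn => ?_) (fun i n hn => ?_) L
  all_goals
    obtain ⟨x, y, κ, ρ, v⟩ := exists_modeVars hre hr hrs hrc hn
    obtain ⟨a1, a2, a3, a4, a5, a6⟩ := v.osc_eField_one
    obtain ⟨b1, b2, b3, b4, b5, b6⟩ := v.osc_fField_zero
    obtain ⟨c1, c2, c3, c4, c5, c6⟩ := v.osc_bigPsiMinusField
    obtain ⟨hn₀, hx, hy, hκ, hρ, ⟨_, _, _, _, _, _⟩, ⟨_, _, _, _, _, _⟩, ⟨_, _, _, _, _, _⟩,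
      ⟨_, _, _, _, _, _⟩⟩ := v.ne_zero_forms
    cases i <;>
    · simp [osc_add, osc_scale, a1, a2, a3, a4, a5, a6, b1, b2, b3, b4, b5, b6, c1, c2, c3, c4,
        c5, c6, qpow_neg, v.qpow_k, v.κ_eq]
      try field_simp
      try ring

theorem ePlusConst_lower (χ : Charge) (i : Fin 2) :
    ePlusConst h χ.lower i = ![qpow h 1, qpow h (-1)] i * ePlusConst h χ i := by
  fin_cases i <;> simp [ePlusConst, Charge.lower, ← qpow_add] <;> (congr 1; try ring)

theorem ePlusConst_raise (χ : Charge) (i : Fin 2) :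
    ePlusConst h χ.raise i = ![qpow h (-1), qpow h 1] i * ePlusConst h χ i := by
  fin_cases i <;> simp [ePlusConst, Charge.raise, ← qpow_add] <;> (congr 1; try ring)

theorem eMinusConst_lower (χ : Charge) (i : Fin 2) :
    eMinusConst h k χ.lower i = ![qpow h (-1), qpow h 1] i * eMinusConst h k χ i := by
  fin_cases i <;> simp [eMinusConst, Charge.lower, ← qpow_add] <;> (congr 1; try ring)

theorem eMinusConst_raise (χ : Charge) (i : Fin 2) :
    eMinusConst h k χ.raise i = ![qpow h 1, qpow h (-1)] i * eMinusConst h k χ i := by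
  fin_cases i <;> simp [eMinusConst, Charge.raise, ← qpow_add] <;> (congr 1; try ring)

theorem vertexOp_comm_of_contraction_eq_zero {X Y : LinField} (hXY : contraction h k X Y = 0)
    (hYX : contraction h k Y X = 0) (M N : ℤ) (v : Fock) :
    vertexOp h k X M (vertexOp h k Y N v) = vertexOp h k Y N (vertexOp h k X M v) := by
  have key : ∀ {X Y : LinField}, contraction h k X Y = 0 → ∀ (M N : ℤ),
      vertexOp h k X M (vertexOp h k Y N v) = normalPair h k X Y M N v := by
    intro X Y hXY M N
    rw [vertexOp_vertexOp, hXY, psExp_zero, finsum_eq_single _ 0]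
    · simp
    · intro n hn
      rw [PowerSeries.coeff_one, if_neg hn, zero_smul]
  rw [key hXY, key hYX, normalPair_comm]

theorem contraction_eq_zero_of_coeff {X Y : LinField}
    (hXY : ∀ n : ℕ, n ≠ 0 → PowerSeries.coeff n (contraction h k X Y) = 0) :
    contraction h k X Y = 0 := by
  ext n
  rcases eq_or_ne n 0 with rfl | hn
  · rw [coeff_zero_contraction, map_zero]
  · rw [hXY n hn, map_zero]

theorem eCurrent_fCurrent_commutator (hre : h.re < 0) (hr : 0 < r) (hrs : 0 < rs)
    (hrc : rs = r - k) {χ : Charge} {d : ℤ} (hd : χ.m₂ - χ.m₁ = d) (m n : ℤ) (v : Fock) :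
    eCurrent h k rs m (fCurrent h k r n (Finsupp.single χ v)) -
        fCurrent h k r n (eCurrent h k rs m (Finsupp.single χ v)) =
      (1 / (qpow h 1 - qpow h (-1))) •
        (deltaLeft (qpow h (-k)) (fscale h (-(k / 2)) (PsiPlus h k r rs)) (m + 1) (n + 1)
            (Finsupp.single χ v) -
          deltaRight (qpow h k) (fscale h (-(k / 2)) (PsiMinus h k r rs)) (m + 1) (n + 1)
            (Finsupp.single χ v)) := by
  have hraise : χ.raise.m₂ - χ.raise.m₁ = d := by rw [← hd]; simp [Charge.raise]
  have hlower : χ.lower.m₂ - χ.lower.m₁ = d := by rw [← hd]; simp [Charge.lower]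
  have hef := actsAsSum_eCurrent (h := h) (k := k) (rs := rs) hraise
  have hfe := actsAsSum_fCurrent (h := h) (k := k) (r := r) hlower
  rw [χ.lower_raise] at hef
  rw [χ.raise_lower] at hfe
  set ω := qpow h 1 with hω
  have hω0 : ω ≠ 0 := qpow_ne_zero _
  have hω2 : ω ^ 2 - 1 ≠ 0 := by
    obtain ⟨x, y, κ, ρ, w⟩ := exists_modeVars hre hr hrs hrc one_ne_zero
    rw [hω, w.x_eq]; exact w.x_sq
  have hωω : qpow h 2 = ω ^ 2 := by rw [hω, sq, ← qpow_add]; norm_num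
  have hkk : qpow h (k / 2) * qpow h (k / 2) = qpow h k := by rw [← qpow_add, add_halves]
  -- The four pairs of vertex operators.
  have c00 := vertexOp_comm_of_contraction_eq_zero (h := h) (k := k) (X := eField h k rs 0)
    (Y := fField h k r 0)
    (contraction_eq_zero_of_coeff fun n hn => by
      obtain ⟨x, y, κ, ρ, w⟩ := exists_modeVars hre hr hrs hrc hn
      rw [w.coeff_contraction_e_f]; simp)
    (contraction_eq_zero_of_coeff fun n hn => by
      obtain ⟨x, y, κ, ρ, w⟩ := exists_modeVars hre hr hrs hrc hn
      rw [w.coeff_contraction_f_e]; simp) (m + d + 1) (n - d + 1) v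
  have c11 := vertexOp_comm_of_contraction_eq_zero (h := h) (k := k) (X := eField h k rs 1)
    (Y := fField h k r 1)
    (contraction_eq_zero_of_coeff fun n hn => by
      obtain ⟨x, y, κ, ρ, w⟩ := exists_modeVars hre hr hrs hrc hn
      rw [w.coeff_contraction_e_f]; simp)
    (contraction_eq_zero_of_coeff fun n hn => by
      obtain ⟨x, y, κ, ρ, w⟩ := exists_modeVars hre hr hrs hrc hn
      rw [w.coeff_contraction_f_e]; simp) (m + d + 1) (n - d + 1) v
  have c01 := vertexOp_commutator (h := h) (k := k) (X := eField h k rs 0)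
    (Y := fField h k r 1) (σ := k) hω0
    (fun n hn => by
      obtain ⟨x, y, κ, ρ, w⟩ := exists_modeVars hre hr hrs hrc hn
      rw [w.coeff_contraction_e_f, hkk, hωω]; simp)
    (fun n hn => by
      obtain ⟨x, y, κ, ρ, w⟩ := exists_modeVars hre hr hrs hrc hn
      rw [w.coeff_contraction_f_e, hkk, hωω]; simp) (m + d + 1) (n - d + 1) v
  have c10 := vertexOp_commutator (h := h) (k := k) (X := eField h k rs 1)
    (Y := fField h k r 0) (σ := -k) (inv_ne_zero hω0)
    (fun n hn => by
      obtain ⟨x, y, κ, ρ, w⟩ := exists_modeVars hre hr hrs hrc hn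
      rw [w.coeff_contraction_e_f, hkk, hωω, qpow_neg]; simp [mul_comm])
    (fun n hn => by
      obtain ⟨x, y, κ, ρ, w⟩ := exists_modeVars hre hr hrs hrc hn
      rw [w.coeff_contraction_f_e, hkk, hωω, qpow_neg]; simp [mul_comm]) (m + d + 1) (n - d + 1) v
  rw [vertexOp_eField_add_fField hre hr hrs hrc, vertexOp_scale] at c01
  rw [neg_neg, vertexOp_eField_add_fField' hre hr hrs hrc, vertexOp_scale, inv_inv] at c10
  rw [show m + d + 1 + (n - d + 1) = m + n + 2 by ring] at c01 c10
  -- The zero modes.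
  have e0 := ePlusConst_raise (h := h) χ 0
  have e1 := ePlusConst_raise (h := h) χ 1
  have f0 := eMinusConst_lower (h := h) (k := k) χ 0
  have f1 := eMinusConst_lower (h := h) (k := k) χ 1
  simp only [Matrix.cons_val_zero, Matrix.cons_val_one, qpow_neg, ← hω] at e0 e1 f0 f1
  have s01 : ePlusConst h χ 0 * eMinusConst h k χ 1 * (qpow h (k * (n - d + 1 : ℤ)) *
      qpow h (-(k / 2) * (m + n + 2 : ℤ))) =
      qpow h (-k) ^ (-(n + 1)) * (qpow h (-(k / 2) * (m + n + 2 : ℤ)) * qpow h χ.weight) := by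
    rw [← qpow_mul_intCast]
    simp only [ePlusConst, eMinusConst, Charge.weight, Matrix.cons_val_zero, Matrix.cons_val_one,
      ← qpow_add, hd]
    congr 1; push_cast; linear_combination -hd
  have s10 : ePlusConst h χ 1 * eMinusConst h k χ 0 * (qpow h (-k * (n - d + 1 : ℤ)) *
      qpow h (k / 2 * (m + n + 2 : ℤ))) =
      qpow h k ^ (m + 1) * (qpow h (-(k / 2) * (m + n + 2 : ℤ)) * qpow h (-χ.weight)) := by
    rw [← qpow_mul_intCast]
    simp only [ePlusConst, eMinusConst, Charge.weight, Matrix.cons_val_zero, Matrix.cons_val_one,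
      ← qpow_add, hd]
    congr 1; push_cast; linear_combination hd
  rw [actsAsSum_fCurrent hd, hef, actsAsSum_eCurrent hd, hfe, deltaLeft, deltaRight, fscale,
    fscale, actsAs_PsiPlus, actsAs_PsiMinus, ← Finsupp.single_sub]
  simp only [Finsupp.smul_single, ← Finsupp.single_sub]
  congr 1
  rw [show m - (-d - 1) = m + d + 1 by ring, show n - (d - 1) = n - d + 1 by ring,
    show m + 1 + (n + 1) = m + n + 2 by ring, show n + 1 + (m + 1) = m + n + 2 by ring, sub_zero]
  simp only [Fin.sum_univ_two, map_add, map_smul, smul_add, smul_smul, Matrix.cons_val_zero,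
    Matrix.cons_val_one, e0, e1, f0, f1,
    show qpow h (-1) = ω⁻¹ by rw [qpow_neg], ← hω]
  have hω3 : ω - ω⁻¹ ≠ 0 := by
    intro e
    apply hω2
    field_simp at e
    linear_combination e
  set g := 1 / (ω - ω⁻¹) with hg
  have hg' : -1 / (ω - ω⁻¹) = -g := by rw [hg, neg_div]
  have hgg : g * (ω - ω⁻¹) = 1 := one_div_mul_cancel hω3
  rw [smul_sub, smul_smul, smul_smul, hg', ← s01, ← s10]
  simp only [smul_smul] at c01 c10
  rw [c00, c11]
  set T := qpow h (k * (n - d + 1 : ℤ)) * qpow h (-(k / 2) * (m + n + 2 : ℤ)) with hT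
  set T' := qpow h (-k * (n - d + 1 : ℤ)) * qpow h (k / 2 * (m + n + 2 : ℤ)) with hT'
  rw [mul_assoc, ← hT] at c01
  rw [mul_assoc, ← hT'] at c10
  linear_combination (norm := module)
    (-(g ^ 2 * ePlusConst h χ 0 * eMinusConst h k χ 1)) • c01 -
    (g ^ 2 * ePlusConst h χ 1 * eMinusConst h k χ 0) • c10 +
    hgg • ((g * (ePlusConst h χ 0 * eMinusConst h k χ 1 * T)) •
      vertexOp h k (bigPsiPlusField h k r rs) (m + n + 2) v) -
    hgg • ((g * (ePlusConst h χ 1 * eMinusConst h k χ 0 * T')) •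
      vertexOp h k (bigPsiMinusField h k r rs) (m + n + 2) v)

end

/-! ### The exchange relations -/

section

variable {h : ℂ} {k r rs : ℝ}

/-- A vertex operator `A` and a combination `B`, all of whose contractions are `(α x; t) / (β x; t)`
in the order `A B` and the reflection of this function in the order `B A`. -/
theorem exchange_of_ratio {ι : Type} [Fintype ι] [Nonempty ι] {A B : FormalField} {χ χ₁ : Charge}
    {X : LinField} {Y : ι → LinField} {a a' : ℂ} {b : ι → ℂ} {eA eB : ℤ} {α β t c : ℂ}
    (ht : ‖t‖ < 1) (ht0 : t ≠ 0) (hα : α ≠ 0) (hβ : β ≠ 0)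
    (hA : ActsAs h k A χ₁ χ₁ a X eA) (hA' : ActsAs h k A χ χ a' X eA)
    (hB : ActsAsSum h k B χ χ₁ b Y eB)
    (hC : ∀ i (n : ℕ), n ≠ 0 → PowerSeries.coeff n (contraction h k X (Y i)) =
      1 / n * (β ^ n / (1 - t ^ n) - α ^ n / (1 - t ^ n)))
    (hC' : ∀ i (n : ℕ), n ≠ 0 → PowerSeries.coeff n (contraction h k (Y i) X) =
      1 / n * ((t * α⁻¹) ^ n / (1 - t ^ n) - (t * β⁻¹) ^ n / (1 - t ^ n)))
    (ha : a * α = c * β * a') :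
    Exchange χ A B (fun x => c * theta t (α⁻¹ * x)) (fun x => theta t (β⁻¹ * x)) := by
  refine exchange_of_expSumsTo ?_ hB hA.actsAsSum hA'.actsAsSum hB
    (fun _ i => expSumsTo_ratio (coeff_zero_contraction _ _) ht (hC i))
    (fun i _ => expSumsTo_ratio (coeff_zero_contraction _ _) ht (hC' i)) fun _ i u hu => ?_
  · obtain ⟨x, hx, hx'⟩ :=
      exists_theta_ne_zero ht ht ht0 ht0 (inv_ne_zero hβ) (inv_ne_zero hβ)
    exact ⟨x, hx, left_ne_zero_of_mul hx'⟩
  · refine mul_left_cancel₀ (mul_ne_zero hα hβ) ?_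
    linear_combination (a * b i * α) * theta_inv_mul_relation ht hα hβ hu +
      b i * α * (theta t (α⁻¹ * u) * qPoch (t * β⁻¹ * u) t * qPoch (β * u⁻¹) t) * ha

/-- The variant of `exchange_of_ratio` in which the contractions are `(t α x; t) / (t β x; t)` in
the order `A B`. -/
theorem exchange_of_ratio' {ι : Type} [Fintype ι] [Nonempty ι] {A B : FormalField}
    {χ χ₁ : Charge} {X : LinField} {Y : ι → LinField} {a a' : ℂ} {b : ι → ℂ} {eA eB : ℤ}
    {α β t c : ℂ} (ht : ‖t‖ < 1) (ht0 : t ≠ 0) (hβ : β ≠ 0)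
    (hA : ActsAs h k A χ₁ χ₁ a X eA) (hA' : ActsAs h k A χ χ a' X eA)
    (hB : ActsAsSum h k B χ χ₁ b Y eB)
    (hC : ∀ i (n : ℕ), n ≠ 0 → PowerSeries.coeff n (contraction h k X (Y i)) =
      1 / n * ((t * β) ^ n / (1 - t ^ n) - (t * α) ^ n / (1 - t ^ n)))
    (hC' : ∀ i (n : ℕ), n ≠ 0 → PowerSeries.coeff n (contraction h k (Y i) X) =
      1 / n * (α⁻¹ ^ n / (1 - t ^ n) - β⁻¹ ^ n / (1 - t ^ n)))
    (ha : a = c * a') :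
    Exchange χ A B (fun x => c * theta t (α⁻¹ * x)) (fun x => theta t (β⁻¹ * x)) := by
  refine exchange_of_expSumsTo ?_ hB hA.actsAsSum hA'.actsAsSum hB
    (fun _ i => expSumsTo_ratio (coeff_zero_contraction _ _) ht (hC i))
    (fun i _ => expSumsTo_ratio (coeff_zero_contraction _ _) ht (hC' i)) fun _ i u hu => ?_
  · obtain ⟨x, hx, hx'⟩ :=
      exists_theta_ne_zero ht ht ht0 ht0 (inv_ne_zero hβ) (inv_ne_zero hβ)
    exact ⟨x, hx, left_ne_zero_of_mul hx'⟩
  · rw [ha]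
    linear_combination c * a' * b i * theta_inv_mul_relation' (t := t) (α := α) (β := β) (u := u)

/-- The exchange relation of a combination of vertex operators with itself, when the contractions
are `(t x / α; t) (1 - d i j x) / (α x; t)`. -/
theorem exchange_of_ratio_mul_linear {ι : Type} [Fintype ι] [Nonempty ι] {A : FormalField}
    {χ χ₁ χ₂ : Charge} {X : ι → LinField} {a b : ι → ℂ} {e : ℤ} {α t : ℂ} {d : ι → ι → ℂ}
    (ht : ‖t‖ < 1) (ht0 : t ≠ 0) (hα : α ≠ 0)
    (hA : ActsAsSum h k A χ χ₁ b X e) (hA' : ActsAsSum h k A χ₁ χ₂ a X e)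
    (hC : ∀ i j (n : ℕ), n ≠ 0 → PowerSeries.coeff n (contraction h k (X i) (X j)) =
      1 / n * (α ^ n / (1 - t ^ n) - (t * α⁻¹) ^ n / (1 - t ^ n) - d i j ^ n))
    (hab : ∀ i j u, a i * b j * (d i j - u) = a j * b i * (1 - d j i * u)) :
    Exchange χ A A (fun x => α⁻¹ * theta t (α * x)) (fun x => theta t (α⁻¹ * x)) := by
  refine exchange_of_expSumsTo ?_ hA hA' hA hA'
    (fun i j => expSumsTo_ratio_mul_linear (coeff_zero_contraction _ _) ht (hC i j))
    (fun i j => expSumsTo_ratio_mul_linear (coeff_zero_contraction _ _) ht (hC i j))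
    fun i j u hu => theta_linear_relation ht hα hu (hab i j u)
  obtain ⟨x, hx, hx'⟩ := exists_theta_ne_zero ht ht ht0 ht0 (inv_ne_zero hα) (inv_ne_zero hα)
  exact ⟨x, hx, left_ne_zero_of_mul hx'⟩

/-- The exchange relation of two vertex operators with contractions
`(s x / α; t') (s α x; t) / ((s α x; t') (s x / α; t))` in one order, and with `s⁻¹` in place of `s`
in the other. -/
theorem exchange_of_reflection {A B : FormalField} {χ : Charge} {X Y : LinField} {a b : ℂ}
    {eA eB : ℤ} {α t t' s : ℂ} (ht : ‖t‖ < 1) (ht' : ‖t'‖ < 1) (ht0 : t ≠ 0) (ht0' : t' ≠ 0)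
    (hα : α ≠ 0) (hs : s ≠ 0) (hA : ActsAs h k A χ χ a X eA) (hB : ActsAs h k B χ χ b Y eB)
    (hC : ∀ n : ℕ, n ≠ 0 → PowerSeries.coeff n (contraction h k X Y) =
      1 / n * ((s⁻¹ * α) ^ n / (1 - t' ^ n) + (s⁻¹ * α⁻¹) ^ n / (1 - t ^ n) -
        (s⁻¹ * α⁻¹) ^ n / (1 - t' ^ n) - (s⁻¹ * α) ^ n / (1 - t ^ n)))
    (hC' : ∀ n : ℕ, n ≠ 0 → PowerSeries.coeff n (contraction h k Y X) =
      1 / n * ((s * α) ^ n / (1 - t' ^ n) + (s * α⁻¹) ^ n / (1 - t ^ n) -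
        (s * α⁻¹) ^ n / (1 - t' ^ n) - (s * α) ^ n / (1 - t ^ n))) :
    Exchange χ A B (fun x => theta t (s * α⁻¹ * x) * theta t' (s * α * x))
      (fun x => theta t (s * α * x) * theta t' (s * α⁻¹ * x)) := by
  refine exchange_of_expSumsTo (exists_theta_ne_zero ht ht' ht0 ht0' (mul_ne_zero hs hα)
      (mul_ne_zero hs (inv_ne_zero hα))) hB.actsAsSum hA.actsAsSum hA.actsAsSum hB.actsAsSum
    (fun _ _ => expSumsTo_qPoch (coeff_zero_contraction _ _) ht' ht ht' ht hC)
    (fun _ _ => expSumsTo_qPoch (coeff_zero_contraction _ _) ht' ht ht' ht hC') fun _ _ u hu => ?_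
  have key := theta_reflection_relation ht ht' (α := α) (u := s * u)
  have e1 : ∀ y : ℂ, y * (s * u)⁻¹ = s⁻¹ * y * u⁻¹ := fun y => by rw [mul_inv]; ring
  have e2 : ∀ y : ℂ, y * (s * u) = s * y * u := fun y => by ring
  simp only [e1, e2] at key
  linear_combination a * b * key

end

/-! ### The elliptic commutation relations -/

section

variable {h : ℂ} {k r rs : ℝ}

theorem Charge.weight_lower (χ : Charge) : χ.lower.weight = χ.weight + 2 := by
  simp only [Charge.weight, Charge.lower]; ring

theorem Charge.weight_raise (χ : Charge) : χ.raise.weight = χ.weight - 2 := by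
  simp only [Charge.weight, Charge.raise]; ring

/-- The factors from commuting the zero modes compensate the linear factors of the contractions. -/
theorem zeroMode_mul_linear (i j : Fin 2) (u : ℂ) :
    ![qpow h 1, qpow h (-1)] i * (![![1, (qpow h 2)⁻¹], ![qpow h 2, 1]] i j - u) =
      ![qpow h 1, qpow h (-1)] j * (1 - ![![1, (qpow h 2)⁻¹], ![qpow h 2, 1]] j i * u) := by
  have h2 : qpow h 2 = qpow h 1 ^ 2 := by rw [sq, ← qpow_add]; norm_num
  have h1 : qpow h 1 ≠ 0 := qpow_ne_zero _
  rw [h2, show qpow h (-1) = (qpow h 1)⁻¹ from qpow_neg _]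
  fin_cases i <;> fin_cases j <;> simp <;> field_simp

/-- The currents satisfy the elliptic relations on every Fock space on which their powers of `z` are
integral. Convergence needs `h.re < 0`, which is `‖q‖ < 1`. -/
theorem isElliptic (hre : h.re < 0) (hr : 0 < r) (hrs : 0 < rs) (hrc : rs = r - k)
    {χ : Charge} {d : ℤ} (hd : χ.m₂ - χ.m₁ = d) :
    IsElliptic h k r rs χ (PsiPlus h k r rs) (PsiMinus h k r rs) (eCurrent h k rs)
      (fCurrent h k r) := by
  have hp : ‖qpow h (2 * r)‖ < 1 := by
    have := norm_qpow_lt_one hre (mul_pos two_pos hr)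
    simpa using this
  have hps : ‖qpow h (2 * rs)‖ < 1 := by
    have := norm_qpow_lt_one hre (mul_pos two_pos hrs)
    simpa using this
  have hp0 : qpow h (2 * r) ≠ 0 := qpow_ne_zero _
  have hps0 : qpow h (2 * rs) ≠ 0 := qpow_ne_zero _
  have hq0 : qpow h 2 ≠ 0 := qpow_ne_zero _
  have hK0 : qpow h (k / 2) ≠ 0 := qpow_ne_zero _
  have hK : qpow h k = qpow h (k / 2) * qpow h (k / 2) := by rw [← qpow_add, add_halves]
  have hpp : qpow h (2 * r) =
      qpow h (2 * rs) * (qpow h k * qpow h k) := by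
    rw [← qpow_add, ← qpow_add, hrc]; congr 1; push_cast; ring
  have hraise : χ.raise.m₂ - χ.raise.m₁ = d := by rw [← hd]; simp [Charge.raise]
  have hlower : χ.lower.m₂ - χ.lower.m₁ = d := by rw [← hd]; simp [Charge.lower]
  have mv : ∀ {n : ℕ}, n ≠ 0 → ∃ x y κ ρ, ModeVars h k r rs n x y κ ρ :=
    exists_modeVars hre hr hrs hrc
  have qadd : ∀ x y : ℂ, qpow h (x + y) = qpow h x * qpow h y := fun _ _ => qpow_add _ _
  have qneg : ∀ x : ℂ, qpow h (-x) = (qpow h x)⁻¹ := fun _ => qpow_neg _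
  -- The reflection parameter is `1` for equal signs and `p^* q ^ k` for opposite signs.
  constructor
  · have := exchange_of_reflection (s := 1) hp hps hp0 hps0 hq0 one_ne_zero (actsAs_PsiPlus χ)
      (actsAs_PsiPlus χ)
      (fun n hn => by
        obtain ⟨x, y, κ, ρ, v⟩ := mv hn
        rw [v.coeff_contraction_psiPlus_psiPlus]; simp)
      (fun n hn => by
        obtain ⟨x, y, κ, ρ, v⟩ := mv hn
        rw [v.coeff_contraction_psiPlus_psiPlus]; simp)
    simpa only [qneg, one_mul] using this
  · have := exchange_of_reflection (s := 1) hp hps hp0 hps0 hq0 one_ne_zero (actsAs_PsiMinus χ)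
      (actsAs_PsiMinus χ)
      (fun n hn => by
        obtain ⟨x, y, κ, ρ, v⟩ := mv hn
        rw [v.coeff_contraction_psiMinus_psiMinus]; simp)
      (fun n hn => by
        obtain ⟨x, y, κ, ρ, v⟩ := mv hn
        rw [v.coeff_contraction_psiMinus_psiMinus]; simp)
    simpa only [qneg, one_mul] using this
  · have := exchange_of_reflection (s := qpow h (2 * rs) * (qpow h (k / 2) * qpow h (k / 2))) hp hps
      hp0 hps0 hq0 (mul_ne_zero hps0 (mul_ne_zero hK0 hK0)) (actsAs_PsiPlus χ) (actsAs_PsiMinus χ)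
      (fun n hn => by
        obtain ⟨x, y, κ, ρ, v⟩ := mv hn
        rw [v.coeff_contraction_psiPlus_psiMinus, mul_inv (qpow h (2 * rs))])
      (fun n hn => by
        obtain ⟨x, y, κ, ρ, v⟩ := mv hn
        rw [v.coeff_contraction_psiMinus_psiPlus])
    have e1 : qpow h (2 * r) * qpow h (-2 - k) =
        qpow h (2 * rs) * (qpow h (k / 2) * qpow h (k / 2)) * (qpow h 2)⁻¹ := by
      rw [hpp, ← hK, ← qneg]; simp only [← qadd]; congr 1; ring
    have e2 : qpow h (2 * r) * qpow h (2 - k) =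
        qpow h (2 * rs) * (qpow h (k / 2) * qpow h (k / 2)) * qpow h 2 := by
      rw [hpp, ← hK]; simp only [← qadd]; congr 1; ring
    have e3 : qpow h (2 * rs) * qpow h (2 + k) =
        qpow h (2 * rs) * (qpow h (k / 2) * qpow h (k / 2)) * qpow h 2 := by
      rw [← hK]; simp only [← qadd]; congr 1; ring
    have e4 : qpow h (2 * rs) * qpow h (-2 + k) =
        qpow h (2 * rs) * (qpow h (k / 2) * qpow h (k / 2)) * (qpow h 2)⁻¹ := by
      rw [← hK, ← qneg]; simp only [← qadd]; congr 1; ring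
    rw [e1, e2, e3, e4]
    exact this
  · have := exchange_of_ratio (α := (qpow h 2)⁻¹ * (qpow h (k / 2))⁻¹)
      (β := qpow h 2 * (qpow h (k / 2))⁻¹) (c := qpow h (-2)) hps hps0 (by simp [hq0, hK0])
      (by simp [hq0, hK0]) (actsAs_PsiPlus (r := r) χ.lower) (actsAs_PsiPlus (r := r) χ)
      (actsAsSum_eCurrent hd)
      (fun i n hn => by
        obtain ⟨x, y, κ, ρ, v⟩ := mv hn
        rw [v.coeff_contraction_psiPlus_e])
      (fun i n hn => by
        obtain ⟨x, y, κ, ρ, v⟩ := mv hn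
        rw [v.coeff_contraction_e_psiPlus, mul_inv, mul_inv, inv_inv, inv_inv]
        ring)
      (by rw [χ.weight_lower, qadd, qneg]; field_simp)
    have e1 : ((qpow h 2)⁻¹ * (qpow h (k / 2))⁻¹)⁻¹ = qpow h (2 + k / 2) := by
      rw [← qneg, ← qneg, ← qadd, ← qneg]; congr 1; ring
    have e2 : (qpow h 2 * (qpow h (k / 2))⁻¹)⁻¹ = qpow h (-2 + k / 2) := by
      rw [← qneg, ← qadd, ← qneg]; congr 1; ring
    rwa [e1, e2] at this
  · have := exchange_of_ratio' (α := (qpow h 2)⁻¹ * qpow h (k / 2))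
      (β := qpow h 2 * qpow h (k / 2)) (c := qpow h (-2)) hps hps0
      (mul_ne_zero hq0 hK0) (actsAs_PsiMinus (r := r) χ.lower) (actsAs_PsiMinus (r := r) χ)
      (actsAsSum_eCurrent hd)
      (fun i n hn => by
        obtain ⟨x, y, κ, ρ, v⟩ := mv hn
        rw [v.coeff_contraction_psiMinus_e, mul_assoc, mul_assoc])
      (fun i n hn => by
        obtain ⟨x, y, κ, ρ, v⟩ := mv hn
        rw [v.coeff_contraction_e_psiMinus, mul_inv, mul_inv, inv_inv])
      (by rw [χ.weight_lower, neg_add, qadd]; ring)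
    have e1 : ((qpow h 2)⁻¹ * qpow h (k / 2))⁻¹ = qpow h (2 - k / 2) := by
      rw [← qneg, ← qadd, ← qneg]; congr 1; ring
    have e2 : (qpow h 2 * qpow h (k / 2))⁻¹ = qpow h (-2 - k / 2) := by
      rw [← qadd, ← qneg]; congr 1; ring
    rwa [e1, e2] at this
  · have := exchange_of_ratio (α := qpow h 2 * qpow h (k / 2))
      (β := (qpow h 2)⁻¹ * qpow h (k / 2)) (c := qpow h 2) hp hp0 (mul_ne_zero hq0 hK0)
      (by simp [hq0, hK0]) (actsAs_PsiPlus (rs := rs) χ.raise) (actsAs_PsiPlus (rs := rs) χ)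
      (actsAsSum_fCurrent hd)
      (fun i n hn => by
        obtain ⟨x, y, κ, ρ, v⟩ := mv hn
        rw [v.coeff_contraction_psiPlus_f])
      (fun i n hn => by
        obtain ⟨x, y, κ, ρ, v⟩ := mv hn
        rw [v.coeff_contraction_f_psiPlus, mul_inv, mul_inv, inv_inv]
        ring)
      (by rw [χ.weight_raise, sub_eq_add_neg, qadd, qneg]; field_simp)
    have e1 : (qpow h 2 * qpow h (k / 2))⁻¹ = qpow h (-2 - k / 2) := by
      rw [← qadd, ← qneg]; congr 1; ring
    have e2 : ((qpow h 2)⁻¹ * qpow h (k / 2))⁻¹ = qpow h (2 - k / 2) := by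
      rw [← qneg, ← qadd, ← qneg]; congr 1; ring
    rwa [e1, e2] at this
  · have := exchange_of_ratio' (α := qpow h 2 * (qpow h (k / 2))⁻¹)
      (β := (qpow h 2)⁻¹ * (qpow h (k / 2))⁻¹) (c := qpow h 2) hp hp0
      (by simp [hq0, hK0]) (actsAs_PsiMinus (rs := rs) χ.raise) (actsAs_PsiMinus (rs := rs) χ)
      (actsAsSum_fCurrent hd)
      (fun i n hn => by
        obtain ⟨x, y, κ, ρ, v⟩ := mv hn
        rw [v.coeff_contraction_psiMinus_f, mul_assoc, mul_assoc])
      (fun i n hn => by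
        obtain ⟨x, y, κ, ρ, v⟩ := mv hn
        rw [v.coeff_contraction_f_psiMinus, mul_inv, mul_inv, inv_inv, inv_inv])
      (by rw [χ.weight_raise, neg_sub, sub_eq_add_neg, qadd])
    have e1 : (qpow h 2 * (qpow h (k / 2))⁻¹)⁻¹ = qpow h (-2 + k / 2) := by
      rw [← qneg, ← qadd, ← qneg]; congr 1; ring
    have e2 : ((qpow h 2)⁻¹ * (qpow h (k / 2))⁻¹)⁻¹ = qpow h (2 + k / 2) := by
      rw [← qneg, ← qneg, ← qadd, ← qneg]; congr 1; ring
    rwa [e1, e2] at this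
  · exact eCurrent_fCurrent_commutator hre hr hrs hrc hd
  · have := exchange_of_ratio_mul_linear (α := qpow h 2) hps hps0 hq0
      (actsAsSum_eCurrent hd) (actsAsSum_eCurrent hlower)
      (fun i j n hn => by
        obtain ⟨x, y, κ, ρ, v⟩ := mv hn
        exact v.coeff_contraction_e_e i j)
      (fun i j u => by
        rw [ePlusConst_lower, ePlusConst_lower]
        generalize -1 / (qpow h 1 - qpow h (-1)) = g
        linear_combination g * ![1, -1] i * ePlusConst h χ i * (g * ![1, -1] j *
          ePlusConst h χ j) * zeroMode_mul_linear i j u)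
    simpa only [qneg] using this
  · have := exchange_of_ratio_mul_linear (α := (qpow h 2)⁻¹) hp hp0 (inv_ne_zero hq0)
      (actsAsSum_fCurrent hd) (actsAsSum_fCurrent hraise)
      (fun i j n hn => by
        obtain ⟨x, y, κ, ρ, v⟩ := mv hn
        rw [inv_inv]
        exact v.coeff_contraction_f_f i j)
      (fun i j u => by
        rw [eMinusConst_raise, eMinusConst_raise]
        generalize -1 / (qpow h 1 - qpow h (-1)) = g
        linear_combination g * ![1, -1] i * eMinusConst h k χ i * (g * ![1, -1] j *
          eMinusConst h k χ j) * zeroMode_mul_linear i j u)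
    simpa only [qneg, inv_inv] using this

end

end EllipticCurrents

end

theorem proposition2 (q h : ℂ) (hh : Complex.exp h = q) (hq : ‖q‖ < 1)
    (c k r rs : ℝ) (hr : 0 < r) (hrs : 0 < rs) (hrc : rs = r - c) (hkc : k = c) (hk : k ≠ -2)
    (l m₁ m₂ : ℂ) (hm : ∃ d : ℤ, m₂ - m₁ = (d : ℂ)) :
    EllipticCurrents.IsElliptic h c r rs ⟨l, m₁, m₂⟩
      (EllipticCurrents.PsiPlus h k r rs) (EllipticCurrents.PsiMinus h k r rs)
      (EllipticCurrents.eCurrent h k rs) (EllipticCurrents.fCurrent h k r) := by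
  subst hkc
  obtain ⟨d, hd⟩ := hm
  refine EllipticCurrents.isElliptic ?_ hr hrs hrc (χ := ⟨l, m₁, m₂⟩) hd
  rwa [← hh, Complex.norm_exp, Real.exp_lt_one_iff] at hq
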